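/- Let $G=(V,E,\omega)$ be an undirected graph with edge weights $\omega:E\to\mathbb R_{\ge 0}$ and let $\varepsilon\in\mathbb R$. The weight of a (simple) path is the sum of the weights of its edges; a shortest path is a path of minimum weight between its end points (paths with a single vertex are included). A function $\tilde\omega:E\to\mathbb N_0$ is a *path-oblivious $\varepsilon$-rounding* of $G$ if $|\tilde\omega(\pi)-\omega(\pi)|<\varepsilon$ for every shortest path $\pi$ of $(V,E,\omega)$; it is a *weak $\varepsilon$-rounding* if, in addition, every shortest path of $(V,E,\omega)$ is a shortest path of $(V,E,\tilde\omega)$; and a *strong $\varepsilon$-rounding* if it is weak and every shortest path of $(V,E,\tilde\omega)$ is a shortest path of $(V,E,\omega)$. For a finite tree $T$ with root $r$ and an $\varepsilon$-rounding $\tilde\omega$, the *root error range* is the interval $[\min_v e(r,v),\max_v e(r,v)]$, where $e(r,v)=\tilde\omega(\pi(r,v))-\omega(\pi(r,v))$ and $\pi(r,v)$ is the path of $T$ from $r$ to $v$. An $\varepsilon$-rounding is *locally optimal* if its root error range does not strictly contain the root error range of another $\varepsilon$-rounding of $T$. The *error range set* $\mathcal E(T)$ is the set of root error ranges of the locally optimal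 $\varepsilon$-roundings of $T$. Running times are on a real RAM, that is, a random access machine with natural-number cells and real cells in which memory access, addition, subtraction, comparison, and the floor function take unit time each. Constants in the $O(\cdot)$ are absolute, that is, independent of the tree, the weights and $\varepsilon$, and each algorithm is a single program for all inputs. **Theorem.** 1. On a tree, a function $\tilde\omega$ is a path-oblivious $\varepsilon$-rounding if and only if it is a weak $\varepsilon$-rounding, if and only if it is a strong $\varepsilon$-rounding. (So one simply speaks of $\varepsilon$-roundings of trees.) 2. There is an algorithm that, given an edge-weighted tree $T$ with $n$ vertices (as a list of its weighted edges) and $\varepsilon$, decides in $O(n^2)$ time whether $T$ admits an $\varepsilon$-rounding. 3. For every finite rooted edge-weighted tree $T$ and every $\varepsilon$, the set $\mathcal E(T)$ has at most $2|T|$ elements, where $|T|$ is the number of vertices of $T$. 4. Let $T'$ be obtained from a finite tree $T$ with root $u$ by adding a new vertex $p$ and a weighted edge $\{p,u\}$, and let $p$ be the root of $T'$. Given $\varepsilon$, the weight of $\{p,u\}$, and $\mathcal E(T)$ in ascending order of lower bounds, one can compute $\mathcal E(T')$ in ascending order of lower bounds in $O(|T|)$ time. 5. Let $T_1$ and $T_2$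 be finite trees with common root $r$ that have only the vertex $r$ in common, and let $r$ be the root of their union $T_1\cup T_2$. Given $\varepsilon$ and $\mathcal E(T_1)$ and $\mathcal E(T_2)$, each in ascending order of lower bounds, one can compute $\mathcal E(T_1\cup T_2)$ in ascending order of lower bounds in $O(|T_1|+|T_2|)$ time. -/

import Mathlib

open scoped NNReal

universe u

/-! ## Roundings of edge-weighted graphs

An edge weighting of a simple graph on `V` is a function on `Sym2 V`; only its values at the
edges of the graph are ever used. -/

namespace Rounding

variable {V : Type u}

/-- The weight of a walk: the sum of the weights of its edges. -/
def walkWeight {M : Type*} [AddCommMonoid M] {G : SimpleGraph V} (w : Sym2 V → M) {a b : V}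
    (p : G.Walk a b) : M :=
  (p.edges.map w).sum

/-- `p` is a (simple) path of minimum weight among all paths with the same end points. -/
def IsShortestPath {M : Type*} [AddCommMonoid M] [LE M] {G : SimpleGraph V} (w : Sym2 V → M)
    {a b : V} (p : G.Walk a b) : Prop :=
  p.IsPath ∧ ∀ q : G.Walk a b, q.IsPath → walkWeight w p ≤ walkWeight w q

/-- The signed rounding error of `w'` with respect to `w` on a walk. -/
noncomputable def walkError {G : SimpleGraph V} (w : Sym2 V → ℝ≥0) (w' : Sym2 V → ℕ) {a b : V}
    (p : G.Walk a b) : ℝ :=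
  ((walkWeight w' p : ℕ) : ℝ) - ((walkWeight w p : ℝ≥0) : ℝ)

/-- Path-oblivious `ε`-rounding: the weight of every shortest path changes by less than `ε`. -/
def IsPathOblivious (G : SimpleGraph V) (w : Sym2 V → ℝ≥0) (ε : ℝ) (w' : Sym2 V → ℕ) : Prop :=
  ∀ (a b : V) (p : G.Walk a b), IsShortestPath w p → |walkError w w' p| < ε

/-- Weak `ε`-rounding: moreover, shortest paths remain shortest paths. -/
def IsWeak (G : SimpleGraph V) (w : Sym2 V → ℝ≥0) (ε : ℝ) (w' : Sym2 V → ℕ) : Prop :=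
  IsPathOblivious G w ε w' ∧
    ∀ (a b : V) (p : G.Walk a b), IsShortestPath w p → IsShortestPath w' p

/-- Strong `ε`-rounding: moreover, no new shortest paths appear. -/
def IsStrong (G : SimpleGraph V) (w : Sym2 V → ℝ≥0) (ε : ℝ) (w' : Sym2 V → ℕ) : Prop :=
  IsWeak G w ε w' ∧
    ∀ (a b : V) (p : G.Walk a b), IsShortestPath w' p → IsShortestPath w p

/-! ### Root error ranges, for trees

The word `ε`-rounding is used for trees, where the three notions above agree; the definitions
below use the path-oblivious one. -/

/-- The rounding errors on the paths from `r` to all vertices. -/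
def rootErrors (G : SimpleGraph V) (w : Sym2 V → ℝ≥0) (r : V) (w' : Sym2 V → ℕ) : Set ℝ :=
  {x | ∃ (v : V) (p : G.Walk r v), p.IsPath ∧ x = walkError w w' p}

/-- `[I.1, I.2]` is the root error range of `w'`: its end points are the minimum and the maximum
of the rounding errors on the paths from the root. -/
def IsRootErrorRange (G : SimpleGraph V) (w : Sym2 V → ℝ≥0) (r : V) (w' : Sym2 V → ℕ)
    (I : ℝ × ℝ) : Prop :=
  IsLeast (rootErrors G w r w') I.1 ∧ IsGreatest (rootErrors G w r w') I.2

/-- `w'` is a locally optimal `ε`-rounding: it is an `ε`-rounding, and no `ε`-rounding has a root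
error range that is strictly contained in the one of `w'`. -/
def IsLocallyOptimal (G : SimpleGraph V) (w : Sym2 V → ℝ≥0) (ε : ℝ) (r : V)
    (w' : Sym2 V → ℕ) : Prop :=
  IsPathOblivious G w ε w' ∧
    ∀ I : ℝ × ℝ, IsRootErrorRange G w r w' I →
      ¬ ∃ (w'' : Sym2 V → ℕ) (J : ℝ × ℝ), IsPathOblivious G w ε w'' ∧
        IsRootErrorRange G w r w'' J ∧ Set.Icc J.1 J.2 ⊂ Set.Icc I.1 I.2

/-- The error range set of the tree `G` with root `r`. An interval `[a, b]` is represented by the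
pair `(a, b)`. -/
def errorRangeSet (G : SimpleGraph V) (w : Sym2 V → ℝ≥0) (ε : ℝ) (r : V) : Set (ℝ × ℝ) :=
  {I | ∃ w' : Sym2 V → ℕ, IsLocallyOptimal G w ε r w' ∧ IsRootErrorRange G w r w' I}

/-- The restriction of a weighting to the edges between vertices of `A`. -/
def restrictWeight (w : Sym2 V → ℝ≥0) (A : Set V) : Sym2 A → ℝ≥0 :=
  fun e => w (e.map Subtype.val)

/-- `L` lists the elements of `S`, each once, in ascending order of the first component. -/
def IsAscendingListOf (L : List (ℝ × ℝ)) (S : Set (ℝ × ℝ)) : Prop :=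
  L.Pairwise (fun I J => I.1 < J.1) ∧ ∀ I, I ∈ L ↔ I ∈ S

end Rounding

/-! ## A real RAM with floor function

Structured programs over a random access memory with natural-number cells and real cells.
There are natural-number variables, real variables, arrays of naturals and arrays of reals, each
numbered by `ℕ` (a program mentions finitely many of them); array indices are computed at run
time. The only arithmetic is addition, subtraction, order comparison, conversion of a natural to a
real and the floor function. Every elementary operation takes one unit of time. -/

namespace RealRAM

/-- The contents of the memory. -/
structure State where
  /-- natural-number variables -/
  nv : ℕ → ℕ
  /-- real variables -/
  rv : ℕ → ℝ
  /-- arrays of natural numbers -/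
  na : ℕ → ℕ → ℕ
  /-- arrays of reals -/
  ra : ℕ → ℕ → ℝ

/-- Expressions with natural-number value; subtraction is truncated at zero. -/
inductive NExp where
  | const (k : ℕ)
  | var (x : ℕ)
  | get (a : ℕ) (i : NExp)
  | add (e f : NExp)
  | sub (e f : NExp)

/-- Expressions with real value. -/
inductive RExp where
  | ofNat (e : NExp)
  | var (x : ℕ)
  | get (a : ℕ) (i : NExp)
  | add (e f : RExp)
  | sub (e f : RExp)

/-- Tests. -/
inductive Test where
  | natLt (e f : NExp)
  | realLt (e f : RExp)
  | not (b : Test)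
  | and (b c : Test)

/-- Programs. -/
inductive Prog where
  | skip
  | setNat (x : ℕ) (e : NExp)
  | setReal (x : ℕ) (e : RExp)
  | putNat (a : ℕ) (i e : NExp)
  | putReal (a : ℕ) (i : NExp) (e : RExp)
  | floor (x : ℕ) (e : RExp)
  | seq (P Q : Prog)
  | cond (b : Test) (P Q : Prog)
  | loop (b : Test) (P : Prog)

namespace NExp

/-- Value of an expression. -/
def val (s : State) : NExp → ℕ
  | const k => k
  | var x => s.nv x
  | get a i => s.na a (i.val s)
  | add e f => e.val s + f.val s
  | sub e f => e.val s - f.val s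

/-- Time for evaluating an expression: one unit for each constant, memory access or operation. -/
def cost : NExp → ℕ
  | const _ => 1
  | var _ => 1
  | get _ i => i.cost + 1
  | add e f => e.cost + f.cost + 1
  | sub e f => e.cost + f.cost + 1

end NExp

namespace RExp

/-- Value of an expression. -/
def val (s : State) : RExp → ℝ
  | ofNat e => (e.val s : ℝ)
  | var x => s.rv x
  | get a i => s.ra a (i.val s)
  | add e f => e.val s + f.val s
  | sub e f => e.val s - f.val s

/-- Time for evaluating an expression. -/
def cost : RExp → ℕ
  | ofNat e => e.cost + 1
  | var _ => 1
  | get _ i => i.cost + 1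
  | add e f => e.cost + f.cost + 1
  | sub e f => e.cost + f.cost + 1

end RExp

namespace Test

/-- The test succeeds. -/
def Holds (s : State) : Test → Prop
  | natLt e f => e.val s < f.val s
  | realLt e f => e.val s < f.val s
  | not b => ¬ b.Holds s
  | and b c => b.Holds s ∧ c.Holds s

/-- Time for evaluating a test. -/
def cost : Test → ℕ
  | natLt e f => e.cost + f.cost + 1
  | realLt e f => e.cost + f.cost + 1
  | not b => b.cost + 1
  | and b c => b.cost + c.cost + 1

end Test

namespace State

/-- Assign to a natural-number variable. -/
def setNat (s : State) (x v : ℕ) : State := { s with nv := Function.update s.nv x v }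

/-- Assign to a real variable. -/
def setReal (s : State) (x : ℕ) (v : ℝ) : State := { s with rv := Function.update s.rv x v }

/-- Assign to the entry `i` of the natural-number array `a`. -/
def putNat (s : State) (a i v : ℕ) : State :=
  { s with na := Function.update s.na a (Function.update (s.na a) i v) }

/-- Assign to the entry `i` of the real array `a`. -/
def putReal (s : State) (a i : ℕ) (v : ℝ) : State :=
  { s with ra := Function.update s.ra a (Function.update (s.ra a) i v) }

end State

/-- `Runs P s t s'`: started in memory `s`, the program `P` halts after exactly `t` units of time,
with memory `s'`. The floor instruction rounds down to a natural number (negative reals to `0`). -/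
inductive Runs : Prog → State → ℕ → State → Prop where
  | skip (s) : Runs .skip s 1 s
  | setNat (s x e) : Runs (.setNat x e) s (e.cost + 1) (s.setNat x (e.val s))
  | setReal (s x e) : Runs (.setReal x e) s (e.cost + 1) (s.setReal x (e.val s))
  | putNat (s a i e) :
      Runs (.putNat a i e) s (i.cost + e.cost + 1) (s.putNat a (i.val s) (e.val s))
  | putReal (s a i e) :
      Runs (.putReal a i e) s (i.cost + e.cost + 1) (s.putReal a (i.val s) (e.val s))
  | floor (s x e) : Runs (.floor x e) s (e.cost + 1) (s.setNat x ⌊e.val s⌋₊)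
  | seq {P Q s t s' t' s''} (h : Runs P s t s') (h' : Runs Q s' t' s'') :
      Runs (.seq P Q) s (t + t') s''
  | condTrue {b P Q s t s'} (hb : b.Holds s) (h : Runs P s t s') :
      Runs (.cond b P Q) s (b.cost + 1 + t) s'
  | condFalse {b P Q s t s'} (hb : ¬ b.Holds s) (h : Runs Q s t s') :
      Runs (.cond b P Q) s (b.cost + 1 + t) s'
  | loopTrue {b P s t s' t' s''} (hb : b.Holds s) (h : Runs P s t s')
      (h' : Runs (.loop b P) s' t' s'') :
      Runs (.loop b P) s (b.cost + 1 + t + t') s''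
  | loopFalse {b P s} (hb : ¬ b.Holds s) : Runs (.loop b P) s (b.cost + 1) s

/-- Running time and result are determined by the program and the initial memory. -/
theorem Runs.unique {P : Prog} {s s₁ s₂ : State} {t₁ t₂ : ℕ} (h₁ : Runs P s t₁ s₁)
    (h₂ : Runs P s t₂ s₂) : t₁ = t₂ ∧ s₁ = s₂ := by
  induction h₁ generalizing t₂ s₂ with
  | skip | setNat | setReal | putNat | putReal | floor => cases h₂; exact ⟨rfl, rfl⟩
  | seq _ _ ih ih' =>
    cases h₂ with
    | seq g g' =>
      obtain ⟨rfl, rfl⟩ := ih g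
      obtain ⟨rfl, rfl⟩ := ih' g'
      exact ⟨rfl, rfl⟩
  | condTrue hb _ ih =>
    cases h₂ with
    | condTrue _ g => obtain ⟨rfl, rfl⟩ := ih g; exact ⟨rfl, rfl⟩
    | condFalse hb' _ => exact absurd hb hb'
  | condFalse hb _ ih =>
    cases h₂ with
    | condTrue hb' _ => exact absurd hb' hb
    | condFalse _ g => obtain ⟨rfl, rfl⟩ := ih g; exact ⟨rfl, rfl⟩
  | loopTrue hb _ _ ih ih' =>
    cases h₂ with
    | loopTrue _ g g' =>
      obtain ⟨rfl, rfl⟩ := ih g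
      obtain ⟨rfl, rfl⟩ := ih' g'
      exact ⟨rfl, rfl⟩
    | loopFalse hb' => exact absurd hb hb'
  | loopFalse hb =>
    cases h₂ with
    | loopTrue hb' _ _ => exact absurd hb' hb
    | loopFalse _ => exact ⟨rfl, rfl⟩

/-! ### Input and output conventions -/

/-- `es` lists the edges of `G`, each once, in any order and with any orientation. -/
def IsEdgeListOf {n : ℕ} (es : List (Fin n × Fin n)) (G : SimpleGraph (Fin n)) : Prop :=
  (es.map fun e => s(e.1, e.2)).Nodup ∧ ∀ a b, s(a, b) ∈ es.map (fun e => s(e.1, e.2)) ↔ G.Adj a b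

/-- Initial memory for an edge-weighted graph on the vertices `0, …, n - 1` and a tolerance `ε`:
the numbers of vertices and of edges, `ε`, and for each listed edge its end points and weight.
All other memory cells are zero. -/
noncomputable def graphInput {n : ℕ} (es : List (Fin n × Fin n)) (w : Sym2 (Fin n) → ℝ≥0)
    (ε : ℝ) : State where
  nv x := if x = 0 then n else if x = 1 then es.length else 0
  rv x := if x = 0 then ε else 0
  na a i := if h : i < es.length then
      if a = 0 then es[i].1 else if a = 1 then es[i].2 else 0
    else 0
  ra a i := if h : i < es.length then
      if a = 0 then (w s(es[i].1, es[i].2) : ℝ) else 0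
    else 0

/-- Initial memory for two lists of intervals and two real numbers: the lengths of the lists, the
two numbers, and the lower and upper bounds of the intervals, in arrays `0`, `1` for the first list
and `2`, `3` for the second. All other memory cells are zero. -/
noncomputable def intervalInput (L M : List (ℝ × ℝ)) (ε x : ℝ) : State where
  nv k := if k = 0 then L.length else if k = 1 then M.length else 0
  rv k := if k = 0 then ε else if k = 1 then x else 0
  na _ _ := 0
  ra a i :=
    if a = 0 then (L.getD i (0, 0)).1
    else if a = 1 then (L.getD i (0, 0)).2
    else if a = 2 then (M.getD i (0, 0)).1
    else if a = 3 then (M.getD i (0, 0)).2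
    else 0

/-- The memory holds the list of intervals `L` as output: its length in natural variable `0`, the
lower and upper bounds in real arrays `0` and `1`. -/
def OutputsIntervals (s : State) (L : List (ℝ × ℝ)) : Prop :=
  s.nv 0 = L.length ∧ ∀ (i : ℕ) (h : i < L.length), s.ra 0 i = L[i].1 ∧ s.ra 1 i = L[i].2

end RealRAM

/-! In a tree there is only one path between two vertices, so every path is a shortest path for
every weighting. The conditions that separate the three notions of rounding are therefore void
(`isShortestPath_iff`).

Everything else rests on the set `ranges` of the root error ranges of all `ε`-roundings of a part of
the tree. The error range set is its set of inclusion-minimal intervals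
(`errorRangeSet_eq_minimals`). Two recursions describe `ranges`: a new root edge with error `d`
shifts an interval by `d` and enlarges it to contain `0` (`ranges_insert`), and merging at the root
takes hulls (`ranges_union`). In both cases the longest new paths are controlled by the end points
of the intervals alone. Both operations respect inclusion, so minimal intervals suffice as input.

The quantitative input is that minimal intervals lie in `(-2, 2)`. For `ε ≤ 2` this is the tolerance
itself. For `ε > 2`, rounding all depths down, or all depths up, gives `ε`-roundings with ranges
inside `(-1, 0]` and `[0, 1)` (`admissible_ranges`), and an interval that sticks out of `(-2, 2)`
strictly contains one of these. A lower bound has the form `k - h v` with `k` natural and `h v` the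
depth of a vertex. At most two such values per vertex lie in `(-2, 0]`, and a minimal interval is
determined by its lower bound; this gives the bound `2|T|` (`ncard_minimals_ranges_le`).

The same bound limits the new root edge to four rounded weights (`minimals_shiftSet`). For a union,
an interval of one list needs only one partner from the other, because lower and upper bounds of
minimal intervals increase together (`minimals_hullSet`). The candidates thus form a bounded number
of sorted lists of linear length, and one merge with a pruning stack extracts the minimal intervals
(`lin_merge`).

For the decision problem the vertices are ordered by growing a subtree from vertex `0`, and then
absorbed into their parents in reverse order by the two linear-time operations. There are `n - 1`
steps of cost `O(n)` in each phase. A rounding exists exactly if the final list is nonempty. -/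

/-! ### Reasoning about programs: execution, frame conditions, time bounds. -/

namespace RealRAM

attribute [local simp] State.setNat State.setReal State.putNat State.putReal

/-! ### Executing loop-free programs -/

namespace Prog

/-- The program contains no loop. -/
def loopFree : Prog → Bool
  | seq P Q => P.loopFree && Q.loopFree
  | cond _ P Q => P.loopFree && Q.loopFree
  | loop _ _ => false
  | _ => true

/-- A bound on the running time of a loop-free program. -/
def maxCost : Prog → ℕ
  | skip => 1
  | setNat _ e => e.cost + 1
  | setReal _ e => e.cost + 1
  | putNat _ i e => i.cost + e.cost + 1
  | putReal _ i e => i.cost + e.cost + 1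
  | floor _ e => e.cost + 1
  | seq P Q => P.maxCost + Q.maxCost
  | cond b P Q => b.cost + 1 + (P.maxCost + Q.maxCost)
  | loop _ _ => 0

open Classical in
/-- The final memory of a loop-free program. -/
noncomputable def run : Prog → State → State
  | skip, s => s
  | setNat x e, s => s.setNat x (e.val s)
  | setReal x e, s => s.setReal x (e.val s)
  | putNat a i e, s => s.putNat a (i.val s) (e.val s)
  | putReal a i e, s => s.putReal a (i.val s) (e.val s)
  | floor x e, s => s.setNat x ⌊e.val s⌋₊
  | seq P Q, s => Q.run (P.run s)
  | cond b P Q, s => if b.Holds s then P.run s else Q.run s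
  | loop _ _, s => s

/-- The cells written by a program, tagged `0` for natural variables, `1` for real variables,
`2` for arrays of naturals and `3` for arrays of reals. -/
def writes : Prog → List (ℕ × ℕ)
  | skip => []
  | setNat x _ => [(0, x)]
  | setReal x _ => [(1, x)]
  | putNat a _ _ => [(2, a)]
  | putReal a _ _ => [(3, a)]
  | floor x _ => [(0, x)]
  | seq P Q => P.writes ++ Q.writes
  | cond _ P Q => P.writes ++ Q.writes
  | loop _ P => P.writes

end Prog

/-- Without loops, execution is a total function of the memory, so correctness of straight-line code
reduces to computing `Prog.run`. Charging both branches of a conditional makes the time bound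
independent of the memory. -/
theorem exists_runs_run (P : Prog) (hP : P.loopFree = true) (s : State) :
    ∃ t, Runs P s t (P.run s) ∧ t ≤ P.maxCost := by
  induction P generalizing s with
  | skip => exact ⟨_, .skip s, le_rfl⟩
  | setNat x e => exact ⟨_, .setNat s x e, le_rfl⟩
  | setReal x e => exact ⟨_, .setReal s x e, le_rfl⟩
  | putNat a i e => exact ⟨_, .putNat s a i e, le_rfl⟩
  | putReal a i e => exact ⟨_, .putReal s a i e, le_rfl⟩
  | floor x e => exact ⟨_, .floor s x e, le_rfl⟩
  | seq P Q ihP ihQ =>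
    simp only [Prog.loopFree, Bool.and_eq_true] at hP
    obtain ⟨t, h, ht⟩ := ihP hP.1 s
    obtain ⟨t', h', ht'⟩ := ihQ hP.2 (P.run s)
    exact ⟨_, .seq h h', by simp only [Prog.maxCost]; omega⟩
  | cond b P Q ihP ihQ =>
    simp only [Prog.loopFree, Bool.and_eq_true] at hP
    by_cases hb : b.Holds s
    · obtain ⟨t, h, ht⟩ := ihP hP.1 s
      refine ⟨_, by simpa only [Prog.run, if_pos hb] using .condTrue hb h, ?_⟩
      simp only [Prog.maxCost]; omega
    · obtain ⟨t, h, ht⟩ := ihQ hP.2 s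
      refine ⟨_, by simpa only [Prog.run, if_neg hb] using .condFalse hb h, ?_⟩
      simp only [Prog.maxCost]; omega
  | loop b P => simp [Prog.loopFree] at hP

/-- The cells that are not written by `P` agree in `s` and `s'`. -/
structure SameOutside (P : Prog) (s s' : State) : Prop where
  nv : ∀ x, (0, x) ∉ P.writes → s'.nv x = s.nv x
  rv : ∀ x, (1, x) ∉ P.writes → s'.rv x = s.rv x
  na : ∀ x, (2, x) ∉ P.writes → s'.na x = s.na x
  ra : ∀ x, (3, x) ∉ P.writes → s'.ra x = s.ra x

/-- The frame rule. Since `writes` is a concrete list, that a cell is untouched is settled by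
`decide`, and specifications need to mention only the cells that change. -/
theorem Runs.sameOutside {P : Prog} {s s' : State} {t : ℕ} (h : Runs P s t s') :
    SameOutside P s s' := by
  induction h with
  | skip => exact ⟨fun _ _ => rfl, fun _ _ => rfl, fun _ _ => rfl, fun _ _ => rfl⟩
  | setNat | setReal | putNat | putReal | floor =>
    constructor <;> intro x hx <;> simp_all [Prog.writes, Function.update_of_ne]
  | seq _ _ ih ih' =>
    constructor <;> intro x hx <;>
      simp only [Prog.writes, List.mem_append, not_or] at hx
    · rw [ih'.nv x hx.2, ih.nv x hx.1]
    · rw [ih'.rv x hx.2, ih.rv x hx.1]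
    · rw [ih'.na x hx.2, ih.na x hx.1]
    · rw [ih'.ra x hx.2, ih.ra x hx.1]
  | condTrue _ _ ih =>
    constructor <;> intro x hx <;>
      simp only [Prog.writes, List.mem_append, not_or] at hx
    · exact ih.nv x hx.1
    · exact ih.rv x hx.1
    · exact ih.na x hx.1
    · exact ih.ra x hx.1
  | condFalse _ _ ih =>
    constructor <;> intro x hx <;>
      simp only [Prog.writes, List.mem_append, not_or] at hx
    · exact ih.nv x hx.2
    · exact ih.rv x hx.2
    · exact ih.na x hx.2
    · exact ih.ra x hx.2
  | loopTrue _ _ _ ih ih' =>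
    constructor <;> intro x hx
    · rw [ih'.nv x hx, ih.nv x hx]
    · rw [ih'.rv x hx, ih.rv x hx]
    · rw [ih'.na x hx, ih.na x hx]
    · rw [ih'.ra x hx, ih.ra x hx]
  | loopFalse => exact ⟨fun _ _ => rfl, fun _ _ => rfl, fun _ _ => rfl, fun _ _ => rfl⟩

/-- A loop whose body takes time at most `B` and decreases the measure `k`. -/
theorem exists_runs_loop {b : Test} {P : Prog} (Inv : ℕ → State → Prop) (B : ℕ)
    (step : ∀ k s, Inv k s → b.Holds s →
      ∃ t s', Runs P s t s' ∧ t ≤ B ∧ ∃ k' < k, Inv k' s') :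
    ∀ k s, Inv k s → ∃ t s', Runs (.loop b P) s t s' ∧
      t ≤ (B + b.cost + 1) * k + (b.cost + 1) ∧ (∃ k', Inv k' s') ∧ ¬ b.Holds s' := by
  intro k
  induction k using Nat.strong_induction_on with
  | _ k ih =>
    intro s hs
    by_cases hb : b.Holds s
    · obtain ⟨t, s', h, ht, k', hk, hs'⟩ := step k s hs hb
      obtain ⟨t', s'', h', ht', hI, hnb⟩ := ih k' hk s' hs'
      refine ⟨_, s'', .loopTrue hb h h', ?_, hI, hnb⟩
      have : (B + b.cost + 1) * (k' + 1) ≤ (B + b.cost + 1) * k := Nat.mul_le_mul_left _ hk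
      rw [mul_add, mul_one] at this
      omega
    · exact ⟨_, s, .loopFalse hb, by omega, ⟨k, hs⟩, hb⟩

/-! ### Linear-time specifications -/

/-- Started in a memory satisfying the precondition for the size `m`, the program halts in time
linear in `m`, and initial and final memory satisfy the postcondition. -/
def Lin (P : Prog) (Pre : ℕ → State → Prop) (Post : ℕ → State → State → Prop) : Prop :=
  ∃ C, ∀ m s, Pre m s → ∃ t s', Runs P s t s' ∧ t ≤ C * (m + 1) ∧ Post m s s'

namespace Lin

variable {P Q : Prog} {Pre Pre' : ℕ → State → Prop} {Post Post' : ℕ → State → State → Prop}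

theorem of_run (hP : P.loopFree = true) (h : ∀ m s, Pre m s → Post m s (P.run s)) :
    Lin P Pre Post := by
  refine ⟨P.maxCost, fun m s hs => ?_⟩
  obtain ⟨t, hr, ht⟩ := exists_runs_run P hP s
  exact ⟨t, _, hr, ht.trans (Nat.le_mul_of_pos_right _ m.succ_pos), h m s hs⟩

/-- The rule of consequence, with the frame condition supplied for free when the postcondition is
weakened. -/
theorem mono (h : Lin P Pre Post) (h₁ : ∀ m s, Pre' m s → Pre m s)
    (h₂ : ∀ m s s', Pre' m s → SameOutside P s s' → Post m s s' → Post' m s s') :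
    Lin P Pre' Post' := by
  obtain ⟨C, hC⟩ := h
  refine ⟨C, fun m s hs => ?_⟩
  obtain ⟨t, s', hr, ht, hp⟩ := hC m s (h₁ m s hs)
  exact ⟨t, s', hr, ht, h₂ m s s' hs hr.sameOutside hp⟩

/-- The intermediate memory stays existentially quantified together with both frame conditions, so a
chain of programs is unpacked only once, at its end. -/
theorem seq (hP : Lin P Pre Post) (hQ : Lin Q Pre' Post')
    (h : ∀ m s s', Pre m s → SameOutside P s s' → Post m s s' → Pre' m s') :
    Lin (.seq P Q) Pre (fun m s s'' => ∃ s', SameOutside P s s' ∧ Post m s s' ∧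
      SameOutside Q s' s'' ∧ Post' m s' s'') := by
  obtain ⟨C, hC⟩ := hP
  obtain ⟨D, hD⟩ := hQ
  refine ⟨C + D, fun m s hs => ?_⟩
  obtain ⟨t, s', hr, ht, hp⟩ := hC m s hs
  obtain ⟨t', s'', hr', ht', hp'⟩ := hD m s' (h m s s' hs hr.sameOutside hp)
  exact ⟨_, s'', .seq hr hr', by rw [add_mul]; omega,
    s', hr.sameOutside, hp, hr'.sameOutside, hp'⟩

/-- Intermediate lists may be longer than the input by a constant factor; running a specification at
size `c * m` is still linear in `m`. -/
theorem scale (c : ℕ) (h : Lin P Pre Post) :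
    Lin P (fun m => Pre (c * m)) (fun m => Post (c * m)) := by
  obtain ⟨C, hC⟩ := h
  refine ⟨C * (c + 1), fun m s hs => ?_⟩
  obtain ⟨t, s', hr, ht, hp⟩ := hC (c * m) s hs
  refine ⟨t, s', hr, ht.trans ?_, hp⟩
  rw [mul_assoc]
  exact Nat.mul_le_mul_left _ (by nlinarith)

/-- A loop with loop-free body; `k` is a measure that decreases in every iteration. -/
theorem loop {b : Test} (hP : P.loopFree = true) (c : ℕ)
    (Inv : ℕ → State → ℕ → State → Prop)
    (init : ∀ m s, Pre m s → ∃ k ≤ c * (m + 1), Inv m s k s)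
    (step : ∀ m s₀ k s, Pre m s₀ → Inv m s₀ k s → b.Holds s → ∃ k' < k, Inv m s₀ k' (P.run s))
    (post : ∀ m s₀ k s, Pre m s₀ → Inv m s₀ k s → ¬ b.Holds s → Post m s₀ s) :
    Lin (.loop b P) Pre Post := by
  refine ⟨(P.maxCost + b.cost + 1) * c + (b.cost + 1), fun m s hs => ?_⟩
  obtain ⟨k, hk, hI⟩ := init m s hs
  obtain ⟨t, s', hr, ht, ⟨k', hI'⟩, hnb⟩ := exists_runs_loop (b := b) (P := P) (Inv m s) P.maxCost
    (fun k s' hI' hb => by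
      obtain ⟨t, hr, ht⟩ := exists_runs_run P hP s'
      obtain ⟨k', hk', h⟩ := step m s k s' hs hI' hb
      exact ⟨t, _, hr, ht, k', hk', h⟩) k s hI
  refine ⟨t, s', hr, ht.trans ?_, post m s k' s' hs hI' hnb⟩
  have h1 := Nat.mul_le_mul_left (P.maxCost + b.cost + 1) hk
  rw [add_mul _ (b.cost + 1), mul_assoc]
  exact Nat.add_le_add h1 (Nat.le_mul_of_pos_right _ m.succ_pos)

end Lin

end RealRAM

/-! ### Antichains of intervals and the two recursions at the level of intervals. -/

namespace Rounding

/-! ### Intervals ordered by inclusion -/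

/-- The interval `I` is contained in the interval `J`. -/
def Sub (I J : ℝ × ℝ) : Prop := J.1 ≤ I.1 ∧ I.2 ≤ J.2

theorem Sub.refl (I : ℝ × ℝ) : Sub I I := ⟨le_rfl, le_rfl⟩

theorem Sub.trans {I J K : ℝ × ℝ} (h : Sub I J) (h' : Sub J K) : Sub I K :=
  ⟨h'.1.trans h.1, h.2.trans h'.2⟩

theorem Sub.antisymm {I J : ℝ × ℝ} (h : Sub I J) (h' : Sub J I) : I = J :=
  Prod.ext (le_antisymm h'.1 h.1) (le_antisymm h.2 h'.2)

/-- The inclusion-minimal elements of a set of intervals. -/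
def minimals (S : Set (ℝ × ℝ)) : Set (ℝ × ℝ) := {I | I ∈ S ∧ ∀ J ∈ S, Sub J I → J = I}

theorem minimals_subset (S : Set (ℝ × ℝ)) : minimals S ⊆ S := fun _ h => h.1

/-- Every interval of `S` contains an interval of `C`. -/
def Dominates (C S : Set (ℝ × ℝ)) : Prop := ∀ I ∈ S, ∃ J ∈ C, Sub J I

theorem Dominates.trans {C D S : Set (ℝ × ℝ)} (h : Dominates C D) (h' : Dominates D S) :
    Dominates C S := fun I hI => by
  obtain ⟨J, hJ, hJI⟩ := h' I hI
  obtain ⟨K, hK, hKJ⟩ := h J hJ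
  exact ⟨K, hK, hKJ.trans hJI⟩

/-- This is what makes small candidate sets possible: discarding members of `S` is harmless as long
as every interval of `S` still contains a remaining one. -/
theorem minimals_eq_of_dominates {C S : Set (ℝ × ℝ)} (hCS : C ⊆ S) (h : Dominates C S) :
    minimals C = minimals S := by
  ext I
  constructor
  · rintro ⟨hI, hm⟩
    refine ⟨hCS hI, fun J hJ hJI => ?_⟩
    obtain ⟨K, hK, hKJ⟩ := h J hJ
    have := hm K hK (hKJ.trans hJI)
    exact hJI.antisymm (this ▸ hKJ)
  · rintro ⟨hI, hm⟩
    obtain ⟨K, hK, hKI⟩ := h I hI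
    have := hm K (hCS hK) hKI
    subst this
    exact ⟨hK, fun J hJ hJI => hm J (hCS hJ) hJI⟩

/-- A shortest interval among the members of `S` inside `I` is minimal, since containment together
with at least equal length forces equality of both bounds. Finiteness provides the shortest one. -/
theorem dominates_minimals {S : Set (ℝ × ℝ)} (hS : S.Finite) : Dominates (minimals S) S := by
  intro I hI
  obtain ⟨J, ⟨hJ, hJI⟩, hmin⟩ := Set.exists_min_image {J | J ∈ S ∧ Sub J I} (fun J => J.2 - J.1)
    (hS.subset fun J h => h.1) ⟨I, hI, Sub.refl I⟩
  refine ⟨J, ⟨hJ, fun K hK hKJ => ?_⟩, hJI⟩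
  have h1 := hmin K ⟨hK, hKJ.trans hJI⟩
  obtain ⟨h2, h3⟩ := hKJ
  exact Prod.ext (by linarith) (by linarith)

/-- Pruning after each batch of candidates gives the same result as pruning once at the end. -/
theorem minimals_minimals_union {S S' : Set (ℝ × ℝ)} (hS : S.Finite) :
    minimals (minimals S ∪ S') = minimals (S ∪ S') := by
  refine minimals_eq_of_dominates (Set.union_subset_union_left _ (minimals_subset S)) ?_
  rintro I (hI | hI)
  · obtain ⟨J, hJ, h⟩ := dominates_minimals hS I hI
    exact ⟨J, Or.inl hJ, h⟩
  · exact ⟨I, Or.inr hI, Sub.refl I⟩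

/-- Intervals with a common lower bound are nested. Hence minimal intervals can be counted by their
lower bounds. -/
theorem minimals_injOn (S : Set (ℝ × ℝ)) : Set.InjOn Prod.fst (minimals S) := by
  intro I hI J hJ h
  rcases le_total I.2 J.2 with h' | h'
  · exact hJ.2 I hI.1 ⟨h.ge, h'⟩
  · exact (hI.2 J hJ.1 ⟨h.le, h'⟩).symm

/-- In a set of minimal intervals, lower and upper bounds are ordered alike. -/
theorem minimals_snd_lt {S : Set (ℝ × ℝ)} {I J : ℝ × ℝ} (hI : I ∈ minimals S)
    (hJ : J ∈ minimals S) (h : I.1 < J.1) : I.2 < J.2 := by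
  by_contra hc
  have := hI.2 J hJ.1 ⟨h.le, not_lt.1 hc⟩
  rw [this] at h
  exact lt_irrefl _ h

/-! ### Intervals of roundings of composite trees -/

/-- The range after shifting by the error `d` of a new edge at the root. -/
noncomputable def shift (d : ℝ) (I : ℝ × ℝ) : ℝ × ℝ := (min 0 (d + I.1), max 0 (d + I.2))

/-- The shifted interval stays inside `(-ε, ε)`. -/
def ShiftOK (ε d : ℝ) (I : ℝ × ℝ) : Prop := -ε < d + I.1 ∧ d + I.2 < ε

/-- All ranges for the tree with a new root edge of weight `x`. -/
def shiftSet (ε x : ℝ) (R : Set (ℝ × ℝ)) : Set (ℝ × ℝ) :=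
  {J | ∃ I ∈ R, ∃ k : ℕ, ShiftOK ε (k - x) I ∧ J = shift (k - x) I}

/-- The smallest interval containing two intervals that contain `0`. -/
noncomputable def hull (I J : ℝ × ℝ) : ℝ × ℝ := (min I.1 J.1, max I.2 J.2)

/-- Compatibility of the ranges of two trees that are merged at the root. -/
def HullOK (ε : ℝ) (I J : ℝ × ℝ) : Prop := -ε < I.1 + J.1 ∧ I.2 + J.2 < ε

/-- All ranges for two trees merged at the root. -/
def hullSet (ε : ℝ) (R S : Set (ℝ × ℝ)) : Set (ℝ × ℝ) :=
  {K | ∃ I ∈ R, ∃ J ∈ S, HullOK ε I J ∧ K = hull I J}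

/-- The properties of the set of all root error ranges that the algorithms rely on. -/
structure Admissible (ε : ℝ) (R : Set (ℝ × ℝ)) : Prop where
  finite : R.Finite
  bounds : ∀ I ∈ R, -ε < I.1 ∧ I.1 ≤ 0 ∧ 0 ≤ I.2 ∧ I.2 < ε
  low : 2 < ε → ∃ I ∈ R, -1 < I.1 ∧ I.2 ≤ 0
  high : 2 < ε → ∃ I ∈ R, 0 ≤ I.1 ∧ I.2 < 1

/-- For `ε ≤ 2` the tolerance gives the bounds. For `ε > 2`, an interval reaching down to `-2` would
contain the range from `low`, and minimality would make the two equal, although the lower bound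
there exceeds `-1`; the upper side uses `high`. -/
theorem Admissible.minimal_bounds {ε : ℝ} {R : Set (ℝ × ℝ)} (h : Admissible ε R) {I : ℝ × ℝ}
    (hI : I ∈ minimals R) : -2 < I.1 ∧ I.2 < 2 := by
  obtain ⟨h1, h2, h3, h4⟩ := h.bounds I hI.1
  rcases le_or_gt ε 2 with hε | hε
  · exact ⟨by linarith, by linarith⟩
  · constructor
    · obtain ⟨J, hJ, hJ1, hJ2⟩ := h.low hε
      by_contra hc
      have := hI.2 J hJ ⟨by linarith, by linarith⟩
      rw [this] at hJ1
      linarith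
    · obtain ⟨J, hJ, hJ1, hJ2⟩ := h.high hε
      by_contra hc
      have := hI.2 J hJ ⟨by linarith, by linarith⟩
      rw [this] at hJ2
      linarith

theorem shift_sub {d : ℝ} {I J : ℝ × ℝ} (h : Sub I J) : Sub (shift d I) (shift d J) :=
  ⟨min_le_min le_rfl (by linarith [h.1]), max_le_max le_rfl (by linarith [h.2])⟩

theorem ShiftOK.of_sub {ε d : ℝ} {I J : ℝ × ℝ} (h : Sub I J) (hJ : ShiftOK ε d J) :
    ShiftOK ε d I :=
  ⟨by linarith [h.1, hJ.1], by linarith [h.2, hJ.2]⟩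

theorem hull_sub {I J I' J' : ℝ × ℝ} (h : Sub I I') (h' : Sub J J') :
    Sub (hull I J) (hull I' J') :=
  ⟨min_le_min h.1 h'.1, max_le_max h.2 h'.2⟩

theorem HullOK.of_sub {ε : ℝ} {I J I' J' : ℝ × ℝ} (h : Sub I I') (h' : Sub J J')
    (hK : HullOK ε I' J') : HullOK ε I J :=
  ⟨by linarith [h.1, h'.1, hK.1], by linarith [h.2, h'.2, hK.2]⟩

/-- The candidates for the edge error `d`. -/
def shiftCands (ε x d : ℝ) (L : Set (ℝ × ℝ)) : Set (ℝ × ℝ) :=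
  {J | 0 ≤ d + x ∧ ∃ I ∈ L, ShiftOK ε d I ∧ J = shift d I}

/-- Four edge errors suffice. -/
theorem minimals_shiftSet {ε x : ℝ} (hx : 0 ≤ x) {R : Set (ℝ × ℝ)} (hR : Admissible ε R)
    (hR' : Admissible ε (shiftSet ε x R)) (d : ℝ) (hd : d = ⌊x⌋₊ - 1 - x) :
    minimals (shiftCands ε x d (minimals R) ∪ shiftCands ε x (d + 1) (minimals R) ∪
      shiftCands ε x (d + 1 + 1) (minimals R) ∪ shiftCands ε x (d + 1 + 1 + 1) (minimals R)) =
    minimals (shiftSet ε x R) := by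
  have hfl := Nat.floor_le hx
  have hfl' := Nat.lt_floor_add_one x
  -- The rounded weight `d' + x` is an integer; the test `0 ≤ d' + x` in `shiftCands` makes it
  -- natural. It matters only for `⌊x⌋₊ - 1` when `⌊x⌋₊ = 0`.
  have key : ∀ d' : ℝ, (∃ z : ℤ, d' + x = z) →
      shiftCands ε x d' (minimals R) ⊆ shiftSet ε x R := by
    rintro d' ⟨z, hz⟩ J ⟨h0, I, hI, hok, rfl⟩
    rw [hz] at h0
    lift z to ℕ using (by exact_mod_cast h0)
    have : d' = (z : ℕ) - x := by
      rw [← Int.cast_natCast (R := ℝ) z, ← hz]; ring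
    exact ⟨I, hI.1, z, this ▸ hok, by rw [this]⟩
  -- Only minimal members of `shiftSet` have to be dominated, and these are known to lie in `(-2,
  -- 2)`.
  refine minimals_eq_of_dominates ?_ (Dominates.trans ?_ (dominates_minimals hR'.finite))
  · refine Set.union_subset (Set.union_subset (Set.union_subset ?_ ?_) ?_) ?_ <;> apply key
    · exact ⟨⌊x⌋₊ - 1, by push_cast; rw [hd]; ring⟩
    · exact ⟨⌊x⌋₊, by push_cast; rw [hd]; ring⟩
    · exact ⟨⌊x⌋₊ + 1, by push_cast; rw [hd]; ring⟩
    · exact ⟨⌊x⌋₊ + 2, by push_cast; rw [hd]; ring⟩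
  · intro J hJ
    obtain ⟨hb1, hb2⟩ := hR'.minimal_bounds hJ
    obtain ⟨I, hI, k, hok, rfl⟩ := hJ.1
    obtain ⟨I₀, hI₀, hsub⟩ := dominates_minimals hR.finite I hI
    obtain ⟨-, h2, h3, -⟩ := hR.bounds I hI
    -- As `I` contains `0`, the shifted interval contains the edge error `k - x`, which is thus in
    -- `(-2, 2)`. This leaves the values from `⌊x⌋₊ - 1` to `⌊x⌋₊ + 2` for `k`.
    have hk1 : (-2 : ℝ) < k - x := by
      have : (shift (k - x) I).1 ≤ (k - x) + I.1 := min_le_right _ _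
      linarith
    have hk2 : (k : ℝ) - x < 2 := by
      have : (k - x) + I.2 ≤ (shift (k - x) I).2 := le_max_right _ _
      linarith
    refine ⟨shift (k - x) I₀, ?_, shift_sub hsub⟩
    have hmem : ∀ d' : ℝ, d' = k - x → shift (k - x) I₀ ∈ shiftCands ε x d' (minimals R) := by
      rintro d' rfl
      exact ⟨by simp, I₀, hI₀, hok.of_sub hsub, rfl⟩
    have h4 : ⌊x⌋₊ < k + 2 := by
      have : (⌊x⌋₊ : ℝ) < k + 2 := by linarith
      exact_mod_cast this
    have h5 : k < ⌊x⌋₊ + 3 := by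
      have : (k : ℝ) < ⌊x⌋₊ + 3 := by linarith
      exact_mod_cast this
    have h6 : k + 1 = ⌊x⌋₊ ∨ k = ⌊x⌋₊ ∨ k = ⌊x⌋₊ + 1 ∨ k = ⌊x⌋₊ + 2 := by omega
    rcases h6 with h | h | h | h
    · exact Or.inl (Or.inl (Or.inl (hmem _ (by rw [hd, ← h]; push_cast; ring))))
    · exact Or.inl (Or.inl (Or.inr (hmem _ (by rw [hd, ← h]; ring))))
    · exact Or.inl (Or.inr (hmem _ (by rw [hd, h]; push_cast; ring)))
    · exact Or.inr (hmem _ (by rw [hd, h]; push_cast; ring))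

/-- The candidates with an interval `I` of the first list, and an interval of the second list that
has minimal lower bound subject to the constraints given by `I`. -/
def hullCands (ε : ℝ) (L M : Set (ℝ × ℝ)) : Set (ℝ × ℝ) :=
  {K | ∃ I ∈ L, ∃ J ∈ M, (I.1 ≤ J.1 ∧ -ε < I.1 + J.1) ∧
    (∀ J' ∈ M, I.1 ≤ J'.1 → -ε < I.1 + J'.1 → J.1 ≤ J'.1) ∧ I.2 + J.2 < ε ∧
    K = (I.1, max I.2 J.2)}

theorem hull_comm (I J : ℝ × ℝ) : hull I J = hull J I := by
  simp only [hull, min_comm, max_comm]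

/-- Let `I` be the interval with the smaller lower bound, so that the hull with `J` is `(I.1, max
I.2 J.2)`. Its lower bound does not depend on `J`, and a smaller lower bound of `J` means a smaller
upper bound. The best partner is therefore the one with the least lower bound that is at least `I.1`
and keeps the sum above `-ε`; every other constraint only gets easier. The roles of the two lists
are exchanged in the other case. -/
theorem minimals_hullSet {ε : ℝ} {R S : Set (ℝ × ℝ)} (hR : R.Finite) (hS : S.Finite) :
    minimals (hullCands ε (minimals R) (minimals S) ∪ hullCands ε (minimals S) (minimals R)) =
      minimals (hullSet ε R S) := by
  have half : ∀ {R S : Set (ℝ × ℝ)}, S.Finite → ∀ I ∈ minimals R, ∀ J ∈ minimals S,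
      HullOK ε I J → I.1 ≤ J.1 →
      ∃ K ∈ hullCands ε (minimals R) (minimals S), Sub K (hull I J) := by
    intro R S hS I hI J hJ hok hle
    obtain ⟨J₀, ⟨hJ₀, hc1, hc2⟩, hmin⟩ := Set.exists_min_image
      {J' | J' ∈ minimals S ∧ I.1 ≤ J'.1 ∧ -ε < I.1 + J'.1} Prod.fst
      (hS.subset fun J h => h.1.1) ⟨J, hJ, hle, hok.1⟩
    have hle' := hmin J ⟨hJ, hle, hok.1⟩
    have h2 : J₀.2 ≤ J.2 := by
      rcases hle'.lt_or_eq with h | h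
      · exact (minimals_snd_lt hJ₀ hJ h).le
      · rw [minimals_injOn S hJ₀ hJ h]
    refine ⟨(I.1, max I.2 J₀.2), ⟨I, hI, J₀, hJ₀, ⟨hc1, hc2⟩,
      fun J' hJ' h h' => hmin J' ⟨hJ', h, h'⟩, by linarith [hok.2], rfl⟩, min_le_left _ _,
      max_le_max le_rfl h2⟩
  have incl : ∀ {R S : Set (ℝ × ℝ)}, hullCands ε (minimals R) (minimals S) ⊆ hullSet ε R S := by
    rintro R S K ⟨I, hI, J, hJ, ⟨h1, h2⟩, -, h3, rfl⟩
    exact ⟨I, hI.1, J, hJ.1, ⟨h2, h3⟩, by simp [hull, h1]⟩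
  have symm : ∀ {R S : Set (ℝ × ℝ)}, hullSet ε R S ⊆ hullSet ε S R := by
    rintro R S K ⟨I, hI, J, hJ, h, rfl⟩
    exact ⟨J, hJ, I, hI, ⟨by linarith [h.1], by linarith [h.2]⟩, hull_comm _ _⟩
  refine minimals_eq_of_dominates (Set.union_subset incl (incl.trans symm)) ?_
  rintro K ⟨I, hI, J, hJ, hok, rfl⟩
  obtain ⟨I₀, hI₀, hsI⟩ := dominates_minimals hR I hI
  obtain ⟨J₀, hJ₀, hsJ⟩ := dominates_minimals hS J hJ
  have hok' := hok.of_sub hsI hsJ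
  rcases le_total I₀.1 J₀.1 with h | h
  · obtain ⟨K, hK, hs⟩ := half hS I₀ hI₀ J₀ hJ₀ hok' h
    exact ⟨K, Or.inl hK, hs.trans (hull_sub hsI hsJ)⟩
  · obtain ⟨K, hK, hs⟩ := half hR J₀ hJ₀ I₀ hI₀
      ⟨by linarith [hok'.1], by linarith [hok'.2]⟩ h
    rw [hull_comm] at hs
    exact ⟨K, Or.inr hK, hs.trans (hull_sub hsI hsJ)⟩

end Rounding

/-! ### Errors on paths of a tree and the sets of all root error ranges. -/

namespace Rounding

variable {V : Type u}

/-! ### Errors of walks and of pairs of vertices -/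

/-- The rounding error of an edge. -/
noncomputable def edgeError (w : Sym2 V → ℝ≥0) (w' : Sym2 V → ℕ) (e : Sym2 V) : ℝ :=
  (w' e : ℝ) - (w e : ℝ)

theorem walkError_eq_sum {G : SimpleGraph V} (w : Sym2 V → ℝ≥0) (w' : Sym2 V → ℕ) {a b : V}
    (p : G.Walk a b) : walkError w w' p = (p.edges.map (edgeError w w')).sum := by
  unfold walkError walkWeight
  generalize p.edges = l
  induction l with
  | nil => simp
  | cons e l ih =>
    simp only [List.map_cons, List.sum_cons, Nat.cast_add, NNReal.coe_add, ← ih, edgeError]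
    ring

theorem walkError_nil {G : SimpleGraph V} (w : Sym2 V → ℝ≥0) (w' : Sym2 V → ℕ) (a : V) :
    walkError w w' (SimpleGraph.Walk.nil : G.Walk a a) = 0 := by
  simp [walkError_eq_sum]

theorem walkError_cons {G : SimpleGraph V} (w : Sym2 V → ℝ≥0) (w' : Sym2 V → ℕ) {a b c : V}
    (h : G.Adj a b) (p : G.Walk b c) :
    walkError w w' (SimpleGraph.Walk.cons h p) = edgeError w w' s(a, b) + walkError w w' p := by
  simp [walkError_eq_sum]

theorem walkError_append {G : SimpleGraph V} (w : Sym2 V → ℝ≥0) (w' : Sym2 V → ℕ) {a b c : V}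
    (p : G.Walk a b) (q : G.Walk b c) :
    walkError w w' (p.append q) = walkError w w' p + walkError w w' q := by
  simp [walkError_eq_sum, SimpleGraph.Walk.edges_append]

theorem walkError_reverse {G : SimpleGraph V} (w : Sym2 V → ℝ≥0) (w' : Sym2 V → ℕ) {a b : V}
    (p : G.Walk a b) : walkError w w' p.reverse = walkError w w' p := by
  simp [walkError_eq_sum, SimpleGraph.Walk.edges_reverse, List.sum_reverse]

open Classical in
/-- In a tree, the rounding error on the path from `a` to `b`. -/
noncomputable def treeErr (G : SimpleGraph V) (w : Sym2 V → ℝ≥0) (w' : Sym2 V → ℕ) (a b : V) : ℝ :=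
  if h : ∃ p : G.Walk a b, p.IsPath then walkError w w' h.choose else 0

theorem isPath_unique {G : SimpleGraph V} (hG : G.IsAcyclic) {a b : V} {p q : G.Walk a b}
    (hp : p.IsPath) (hq : q.IsPath) : p = q :=
  have := hG.subsingleton_path a b
  congrArg Subtype.val (Subsingleton.elim (⟨p, hp⟩ : G.Path a b) ⟨q, hq⟩)

theorem treeErr_eq {G : SimpleGraph V} (hG : G.IsAcyclic) (w : Sym2 V → ℝ≥0) (w' : Sym2 V → ℕ)
    {a b : V} {p : G.Walk a b} (hp : p.IsPath) : treeErr G w w' a b = walkError w w' p := by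
  have h : ∃ p : G.Walk a b, p.IsPath := ⟨p, hp⟩
  rw [treeErr, dif_pos h, isPath_unique hG h.choose_spec hp]

theorem exists_isPath {G : SimpleGraph V} (hG : G.IsTree) (a b : V) :
    ∃ p : G.Walk a b, p.IsPath := (hG.existsUnique_path a b).exists

theorem treeErr_self {G : SimpleGraph V} (hG : G.IsAcyclic) (w : Sym2 V → ℝ≥0) (w' : Sym2 V → ℕ)
    (a : V) : treeErr G w w' a a = 0 := by
  rw [treeErr_eq hG w w' (SimpleGraph.Walk.IsPath.nil (u := a)), walkError_nil]

theorem treeErr_comm {G : SimpleGraph V} (hG : G.IsTree) (w : Sym2 V → ℝ≥0) (w' : Sym2 V → ℕ)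
    (a b : V) : treeErr G w w' a b = treeErr G w w' b a := by
  obtain ⟨p, hp⟩ := exists_isPath hG a b
  rw [treeErr_eq hG.isAcyclic w w' hp, treeErr_eq hG.isAcyclic w w' hp.reverse, walkError_reverse]

/-- A path competes only with itself, so minimality is automatic for every weighting. This is all
that the equivalence of the three notions of rounding needs. -/
theorem isShortestPath_iff {G : SimpleGraph V} (hG : G.IsAcyclic) {M : Type*} [AddCommMonoid M]
    [Preorder M] (w : Sym2 V → M) {a b : V} (p : G.Walk a b) :
    IsShortestPath w p ↔ p.IsPath := by
  refine ⟨fun h => h.1, fun h => ⟨h, fun q hq => ?_⟩⟩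
  rw [isPath_unique hG h hq]

theorem isPathOblivious_iff_isWeak {G : SimpleGraph V} (hG : G.IsAcyclic) (w : Sym2 V → ℝ≥0)
    (ε : ℝ) (w' : Sym2 V → ℕ) : IsPathOblivious G w ε w' ↔ IsWeak G w ε w' := by
  simp [IsWeak, isShortestPath_iff hG]

theorem isWeak_iff_isStrong {G : SimpleGraph V} (hG : G.IsAcyclic) (w : Sym2 V → ℝ≥0)
    (ε : ℝ) (w' : Sym2 V → ℕ) : IsWeak G w ε w' ↔ IsStrong G w ε w' := by
  simp [IsStrong, isShortestPath_iff hG]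

/-! ### Ranges on path-closed vertex sets -/

/-- All root error ranges of roundings of the part of the tree `G` on the vertex set `A`. -/
def ranges (G : SimpleGraph V) (w : Sym2 V → ℝ≥0) (ε : ℝ) (A : Set V) (r : V) : Set (ℝ × ℝ) :=
  {I | ∃ w' : Sym2 V → ℕ, (∀ a ∈ A, ∀ b ∈ A, |treeErr G w w' a b| < ε) ∧
    IsLeast (treeErr G w w' r '' A) I.1 ∧ IsGreatest (treeErr G w w' r '' A) I.2}

theorem isPathOblivious_iff {G : SimpleGraph V} (hG : G.IsTree) (w : Sym2 V → ℝ≥0)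
    (ε : ℝ) (w' : Sym2 V → ℕ) :
    IsPathOblivious G w ε w' ↔ ∀ a ∈ Set.univ, ∀ b ∈ Set.univ, |treeErr G w w' a b| < ε := by
  constructor
  · intro h a _ b _
    obtain ⟨p, hp⟩ := exists_isPath hG a b
    rw [treeErr_eq hG.isAcyclic w w' hp]
    exact h a b p ((isShortestPath_iff hG.isAcyclic w p).2 hp)
  · intro h a b p hp
    rw [← treeErr_eq hG.isAcyclic w w' hp.1]
    exact h a trivial b trivial

theorem rootErrors_eq {G : SimpleGraph V} (hG : G.IsTree) (w : Sym2 V → ℝ≥0) (r : V)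
    (w' : Sym2 V → ℕ) : rootErrors G w r w' = treeErr G w w' r '' Set.univ := by
  ext x
  constructor
  · rintro ⟨v, p, hp, rfl⟩
    exact ⟨v, trivial, treeErr_eq hG.isAcyclic w w' hp⟩
  · rintro ⟨v, -, rfl⟩
    obtain ⟨p, hp⟩ := exists_isPath hG r v
    exact ⟨v, p, hp, treeErr_eq hG.isAcyclic w w' hp⟩

/-- The empty path puts `0` into every root error range. The intervals are therefore nonempty, and
inclusion of intervals as sets is the same as comparison of their end points. -/
theorem errorRangeSet_eq_minimals {G : SimpleGraph V} (hG : G.IsTree) (w : Sym2 V → ℝ≥0) (ε : ℝ)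
    (r : V) : errorRangeSet G w ε r = minimals (ranges G w ε Set.univ r) := by
  have key : ∀ (w' : Sym2 V → ℕ) (I : ℝ × ℝ), IsRootErrorRange G w r w' I →
      I.1 ≤ 0 ∧ 0 ≤ I.2 := by
    intro w' I h
    have h0 : (0 : ℝ) ∈ rootErrors G w r w' :=
      ⟨r, _, SimpleGraph.Walk.IsPath.nil, (walkError_nil w w' r).symm⟩
    exact ⟨h.1.2 h0, h.2.2 h0⟩
  have hmem : ∀ I, I ∈ ranges G w ε Set.univ r ↔
      ∃ w', IsPathOblivious G w ε w' ∧ IsRootErrorRange G w r w' I := by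
    intro I
    simp only [ranges, Set.mem_ofPred_eq, isPathOblivious_iff hG, IsRootErrorRange,
      rootErrors_eq hG]
  have hss : ∀ I J : ℝ × ℝ, J.1 ≤ J.2 →
      (Set.Icc J.1 J.2 ⊂ Set.Icc I.1 I.2 ↔ Sub J I ∧ J ≠ I) := by
    intro I J hJ
    rw [Set.ssubset_iff_subset_ne, Set.Icc_subset_Icc_iff hJ]
    refine and_congr_right fun h => not_congr ⟨fun h' => ?_, fun h' => by rw [h']⟩
    have hI := (Set.Icc_subset_Icc_iff (h.1.trans (hJ.trans h.2))).1 h'.ge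
    exact Sub.antisymm h hI
  ext I
  constructor
  · rintro ⟨w', ⟨hp, hopt⟩, hI⟩
    refine ⟨(hmem I).2 ⟨w', hp, hI⟩, fun J hJ hJI => ?_⟩
    by_contra hne
    obtain ⟨w'', hp'', hJ''⟩ := (hmem J).1 hJ
    have hk := key w'' J hJ''
    exact hopt I hI ⟨w'', J, hp'', hJ'', (hss I J (hk.1.trans hk.2)).2 ⟨hJI, hne⟩⟩
  · rintro ⟨hI, hmin⟩
    obtain ⟨w', hp, hI'⟩ := (hmem I).1 hI
    refine ⟨w', ⟨hp, ?_⟩, hI'⟩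
    rintro I' hI'' ⟨w'', J, hp'', hJ, hlt⟩
    have hII : I' = I := Prod.ext (hI''.1.unique hI'.1) (hI''.2.unique hI'.2)
    subst hII
    have hk := key w'' J hJ
    obtain ⟨h1, h2⟩ := (hss I' J (hk.1.trans hk.2)).1 hlt
    exact h2 (hmin J ((hmem J).2 ⟨w'', hp'', hJ⟩) h1)

/-- Paths between vertices of `A` stay in `A`. -/
def PathClosed (G : SimpleGraph V) (A : Set V) : Prop :=
  ∀ a ∈ A, ∀ b ∈ A, ∀ p : G.Walk a b, p.IsPath → ∀ x ∈ p.support, x ∈ A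

theorem PathClosed.singleton (G : SimpleGraph V) (v : V) : PathClosed G {v} := by
  rintro a rfl b hb p hp x hx
  obtain rfl : b = a := hb
  rw [(SimpleGraph.Walk.isPath_iff_nil.1 hp).eq_nil] at hx
  simpa using hx

theorem PathClosed.isTree_induce {G : SimpleGraph V} (hG : G.IsTree) {A : Set V}
    (hA : PathClosed G A) (hne : A.Nonempty) : (G.induce A).IsTree := by
  refine ⟨?_, hG.isAcyclic.induce A⟩
  have : Nonempty A := hne.to_subtype
  refine ⟨fun a b => ?_⟩
  obtain ⟨p, hp⟩ := exists_isPath hG a.1 b.1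
  exact ⟨p.induce A (hA _ a.2 _ b.2 p hp)⟩

theorem pathClosed_of_isTree_induce {G : SimpleGraph V} (hG : G.IsTree) {A : Set V}
    (h : (G.induce A).IsTree) : PathClosed G A := by
  intro a ha b hb p hp x hx
  obtain ⟨q, hq⟩ := exists_isPath h ⟨a, ha⟩ ⟨b, hb⟩
  have hq' := SimpleGraph.Walk.IsPath.map (f := (SimpleGraph.Embedding.induce A).toHom)
    (Subtype.val_injective) hq
  have : p = q.map (SimpleGraph.Embedding.induce A).toHom := isPath_unique hG.isAcyclic hp hq'
  rw [this] at hx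
  obtain ⟨y, -, rfl⟩ := List.mem_map.1 ((SimpleGraph.Walk.support_map _ q) ▸ hx)
  exact y.2

theorem treeErr_induce {G : SimpleGraph V} (hG : G.IsTree) {A : Set V}
    (h : (G.induce A).IsTree) (w : Sym2 V → ℝ≥0) (w' : Sym2 V → ℕ) (a b : A) :
    treeErr (G.induce A) (restrictWeight w A) (fun e => w' (e.map Subtype.val)) a b =
      treeErr G w w' a b := by
  obtain ⟨q, hq⟩ := exists_isPath h a b
  have hq' := SimpleGraph.Walk.IsPath.map (f := (SimpleGraph.Embedding.induce A).toHom)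
    (Subtype.val_injective) hq
  rw [treeErr_eq h.isAcyclic _ _ hq]
  refine Eq.trans ?_ (treeErr_eq hG.isAcyclic w w' hq').symm
  rw [walkError_eq_sum, walkError_eq_sum, SimpleGraph.Walk.edges_map, List.map_map]
  rfl

/-- Subtrees can be treated as path-closed vertex sets of one fixed tree, with no induced graph on a
subtype: their paths are paths of the big tree with the same edges. -/
theorem ranges_induce {G : SimpleGraph V} (hG : G.IsTree) {A : Set V}
    (h : (G.induce A).IsTree) (w : Sym2 V → ℝ≥0) (ε : ℝ) (r : V) (hr : r ∈ A) :
    ranges (G.induce A) (restrictWeight w A) ε Set.univ ⟨r, hr⟩ = ranges G w ε A r := by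
  have key : ∀ (w' : Sym2 V → ℕ) (I : ℝ × ℝ),
      ((∀ a ∈ Set.univ, ∀ b ∈ Set.univ, |treeErr (G.induce A) (restrictWeight w A)
        (fun e => w' (e.map Subtype.val)) a b| < ε) ∧
        IsLeast (treeErr (G.induce A) (restrictWeight w A)
          (fun e => w' (e.map Subtype.val)) ⟨r, hr⟩ '' Set.univ) I.1 ∧
        IsGreatest (treeErr (G.induce A) (restrictWeight w A)
          (fun e => w' (e.map Subtype.val)) ⟨r, hr⟩ '' Set.univ) I.2) ↔
      ((∀ a ∈ A, ∀ b ∈ A, |treeErr G w w' a b| < ε) ∧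
        IsLeast (treeErr G w w' r '' A) I.1 ∧ IsGreatest (treeErr G w w' r '' A) I.2) := by
    intro w' I
    have him : treeErr (G.induce A) (restrictWeight w A)
        (fun e => w' (e.map Subtype.val)) ⟨r, hr⟩ '' Set.univ = treeErr G w w' r '' A := by
      ext x
      constructor
      · rintro ⟨v, -, rfl⟩
        exact ⟨v, v.2, (treeErr_induce hG h w w' ⟨r, hr⟩ v).symm⟩
      · rintro ⟨v, hv, rfl⟩
        exact ⟨⟨v, hv⟩, trivial, treeErr_induce hG h w w' ⟨r, hr⟩ ⟨v, hv⟩⟩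
    rw [him]
    refine and_congr_left fun _ => ⟨fun H a ha b hb => ?_, fun H a _ b _ => ?_⟩
    · rw [← treeErr_induce hG h w w' ⟨a, ha⟩ ⟨b, hb⟩]
      exact H _ trivial _ trivial
    · rw [treeErr_induce hG h w w' a b]
      exact H _ a.2 _ b.2
  ext I
  constructor
  · rintro ⟨w₀, hw₀⟩
    have hinj : Function.Injective (Sym2.map (Subtype.val : A → V)) :=
      Sym2.map.injective Subtype.val_injective
    -- Any weighting of the subtree extends to the whole tree; the value `0` elsewhere is arbitrary.
    have : w₀ = fun e => (Function.extend (Sym2.map (Subtype.val : A → V)) w₀ 0)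
        (e.map Subtype.val) := by
      funext e
      rw [hinj.extend_apply]
    rw [this] at hw₀
    exact ⟨_, (key _ I).1 hw₀⟩
  · rintro ⟨w', hw'⟩
    exact ⟨_, (key w' I).2 hw'⟩

theorem errorRangeSet_induce {G : SimpleGraph V} (hG : G.IsTree) {A : Set V}
    (h : (G.induce A).IsTree) (w : Sym2 V → ℝ≥0) (ε : ℝ) (r : V) (hr : r ∈ A) :
    errorRangeSet (G.induce A) (restrictWeight w A) ε ⟨r, hr⟩ = minimals (ranges G w ε A r) := by
  rw [errorRangeSet_eq_minimals h, ranges_induce hG h]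

/-! ### Composite trees -/

/-- The path from `a` to `b` stays in `A`, so it uses only edges on which the two roundings agree.
This allows roundings to be changed or glued outside a part. -/
theorem treeErr_congr {G : SimpleGraph V} (hG : G.IsTree) {A : Set V} (hA : PathClosed G A)
    (w : Sym2 V → ℝ≥0) {w' w'' : Sym2 V → ℕ} (h : ∀ x ∈ A, ∀ y ∈ A, w' s(x, y) = w'' s(x, y))
    {a b : V} (ha : a ∈ A) (hb : b ∈ A) : treeErr G w w' a b = treeErr G w w'' a b := by
  obtain ⟨p, hp⟩ := exists_isPath hG a b
  rw [treeErr_eq hG.isAcyclic _ _ hp, treeErr_eq hG.isAcyclic _ _ hp, walkError_eq_sum,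
    walkError_eq_sum]
  congr 1
  refine List.map_congr_left fun e he => ?_
  induction e with
  | _ x y =>
    have hx := hA a ha b hb p hp x (p.fst_mem_support_of_mem_edges he)
    have hy := hA a ha b hb p hp y (p.snd_mem_support_of_mem_edges he)
    rw [edgeError, edgeError, h x hx y hy]

theorem isPath_append {G : SimpleGraph V} {a b c : V} {p : G.Walk a b} {q : G.Walk b c}
    (hp : p.IsPath) (hq : q.IsPath) (h : ∀ x ∈ p.support, x ∈ q.support → x = b) :
    (p.append q).IsPath := by
  rw [SimpleGraph.Walk.isPath_def, SimpleGraph.Walk.support_append, List.nodup_append]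
  refine ⟨hp.support_nodup, hq.support_nodup.tail, ?_⟩
  rintro x hx y hy rfl
  have := h x hx (List.mem_of_mem_tail hy)
  subst this
  have hn := hq.support_nodup
  rw [← SimpleGraph.Walk.cons_tail_support, List.nodup_cons] at hn
  exact hn.1 hy

theorem treeErr_append {G : SimpleGraph V} (hG : G.IsAcyclic) (w : Sym2 V → ℝ≥0)
    (w' : Sym2 V → ℕ) {a b c : V} {p : G.Walk a b} {q : G.Walk b c} (h : (p.append q).IsPath) :
    treeErr G w w' a c = treeErr G w w' a b + treeErr G w w' b c := by
  rw [treeErr_eq hG w w' h, treeErr_eq hG w w' h.of_append_left,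
    treeErr_eq hG w w' h.of_append_right, walkError_append]

theorem isPath_append_of_inter {G : SimpleGraph V} {A B : Set V} (hA : PathClosed G A)
    (hB : PathClosed G B) {r : V} (hAB : A ∩ B = {r}) {a b : V} (ha : a ∈ A) (hb : b ∈ B)
    {p : G.Walk a r} {q : G.Walk r b} (hp : p.IsPath) (hq : q.IsPath) : (p.append q).IsPath := by
  have hr : r ∈ A ∩ B := by rw [hAB]; rfl
  refine isPath_append hp hq fun x hx hx' => ?_
  have : x ∈ A ∩ B := ⟨hA a ha r hr.1 p hp x hx, hB r hr.2 b hb q hq x hx'⟩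
  rwa [hAB] at this

/-- The paths from `a` to `r` and from `r` to `b` stay in `A` and in `B`, so they meet only in `r`
and their concatenation is the path from `a` to `b`. -/
theorem treeErr_of_inter {G : SimpleGraph V} (hG : G.IsTree) {A B : Set V} (hA : PathClosed G A)
    (hB : PathClosed G B) {r : V} (hAB : A ∩ B = {r}) {a b : V} (ha : a ∈ A) (hb : b ∈ B)
    (w : Sym2 V → ℝ≥0) (w' : Sym2 V → ℕ) :
    treeErr G w w' a b = treeErr G w w' r a + treeErr G w w' r b := by
  obtain ⟨p, hp⟩ := exists_isPath hG a r
  obtain ⟨q, hq⟩ := exists_isPath hG r b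
  rw [treeErr_append hG.isAcyclic w w' (isPath_append_of_inter hA hB hAB ha hb hp hq),
    treeErr_comm hG w w' a r]

theorem PathClosed.union {G : SimpleGraph V} (hG : G.IsTree) {A B : Set V} (hA : PathClosed G A)
    (hB : PathClosed G B) {r : V} (hAB : A ∩ B = {r}) : PathClosed G (A ∪ B) := by
  have hr : r ∈ A ∩ B := by rw [hAB]; rfl
  have cross : ∀ a ∈ A, ∀ b ∈ B, ∀ p : G.Walk a b, p.IsPath → ∀ x ∈ p.support, x ∈ A ∪ B := by
    intro a ha b hb p hp x hx
    obtain ⟨p₁, hp₁⟩ := exists_isPath hG a r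
    obtain ⟨p₂, hp₂⟩ := exists_isPath hG r b
    have h := isPath_append_of_inter hA hB hAB ha hb hp₁ hp₂
    rw [isPath_unique hG.isAcyclic hp h, SimpleGraph.Walk.mem_support_append_iff] at hx
    rcases hx with hx | hx
    · exact Or.inl (hA a ha r hr.1 p₁ hp₁ x hx)
    · exact Or.inr (hB r hr.2 b hb p₂ hp₂ x hx)
  rintro a (ha | ha) b (hb | hb) p hp x hx
  · exact Or.inl (hA a ha b hb p hp x hx)
  · exact cross a ha b hb p hp x hx
  · exact cross b hb a ha p.reverse hp.reverse x (by simpa using hx)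
  · exact Or.inr (hB a ha b hb p hp x hx)

theorem isPath_cons_of_notMem {G : SimpleGraph V} {A : Set V} (hA : PathClosed G A) {p u v : V}
    (hp : p ∉ A) (hu : u ∈ A) (hv : v ∈ A) (h : G.Adj p u) {q : G.Walk u v} (hq : q.IsPath) :
    (SimpleGraph.Walk.cons h q).IsPath :=
  hq.cons fun hx => hp (hA u hu v hv q hq p hx)

theorem PathClosed.insert {G : SimpleGraph V} (hG : G.IsTree) {A : Set V} (hA : PathClosed G A)
    {p u : V} (hp : p ∉ A) (hu : u ∈ A) (h : G.Adj p u) : PathClosed G (insert p A) := by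
  have cross : ∀ b ∈ A, ∀ q : G.Walk p b, q.IsPath → ∀ x ∈ q.support, x ∈ Insert.insert p A := by
    intro b hb q hq x hx
    obtain ⟨q', hq'⟩ := exists_isPath hG u b
    rw [isPath_unique hG.isAcyclic hq (isPath_cons_of_notMem hA hp hu hb h hq'),
      SimpleGraph.Walk.support_cons, List.mem_cons] at hx
    rcases hx with rfl | hx
    · exact Or.inl rfl
    · exact Or.inr (hA u hu b hb q' hq' x hx)
  rintro a (rfl | ha) b (rfl | hb) q hq x hx
  · exact Or.inl (PathClosed.singleton G b b rfl b rfl q hq x hx)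
  · exact cross b hb q hq x hx
  · exact cross a ha q.reverse hq.reverse x (by simpa using hx)
  · exact Or.inr (hA a ha b hb q hq x hx)

theorem treeErr_cons {G : SimpleGraph V} (hG : G.IsTree) {A : Set V} (hA : PathClosed G A)
    {p u v : V} (hp : p ∉ A) (hu : u ∈ A) (hv : v ∈ A) (h : G.Adj p u) (w : Sym2 V → ℝ≥0)
    (w' : Sym2 V → ℕ) :
    treeErr G w w' p v = edgeError w w' s(p, u) + treeErr G w w' u v := by
  obtain ⟨q, hq⟩ := exists_isPath hG u v
  rw [treeErr_eq hG.isAcyclic w w' (isPath_cons_of_notMem hA hp hu hv h hq), walkError_cons,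
    treeErr_eq hG.isAcyclic w w' hq]

theorem exists_isLeast_isGreatest {A : Set V} (hA : A.Finite) (hne : A.Nonempty) (f : V → ℝ) :
    ∃ I : ℝ × ℝ, IsLeast (f '' A) I.1 ∧ IsGreatest (f '' A) I.2 := by
  obtain ⟨a, ha, h⟩ := Set.exists_min_image A f hA hne
  obtain ⟨b, hb, h'⟩ := Set.exists_max_image A f hA hne
  exact ⟨(f a, f b), ⟨⟨a, ha, rfl⟩, by rintro _ ⟨x, hx, rfl⟩; exact h x hx⟩,
    ⟨⟨b, hb, rfl⟩, by rintro _ ⟨x, hx, rfl⟩; exact h' x hx⟩⟩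

/-- Least and greatest errors after adding a root edge. -/
theorem range_insert {A : Set V} {p : V} {f g : V → ℝ} {d : ℝ} (hp : f p = 0)
    (hf : ∀ v ∈ A, f v = d + g v) {I : ℝ × ℝ} (h : IsLeast (g '' A) I.1)
    (h' : IsGreatest (g '' A) I.2) :
    IsLeast (f '' insert p A) (shift d I).1 ∧ IsGreatest (f '' insert p A) (shift d I).2 := by
  obtain ⟨⟨a, ha, hga⟩, hl⟩ := h
  obtain ⟨⟨b, hb, hgb⟩, hu⟩ := h'
  refine ⟨⟨?_, ?_⟩, ⟨?_, ?_⟩⟩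
  · rcases min_choice 0 (d + I.1) with h | h
    · exact ⟨p, Or.inl rfl, by simp only [shift]; rw [h, hp]⟩
    · exact ⟨a, Or.inr ha, by simp only [shift]; rw [h, hf a ha, hga]⟩
  · rintro _ ⟨v, rfl | hv, rfl⟩
    · exact (min_le_left _ _).trans hp.ge
    · exact (min_le_right _ _).trans (by rw [hf v hv]; linarith [hl ⟨v, hv, rfl⟩])
  · rcases max_choice 0 (d + I.2) with h | h
    · exact ⟨p, Or.inl rfl, by simp only [shift]; rw [h, hp]⟩
    · exact ⟨b, Or.inr hb, by simp only [shift]; rw [h, hf b hb, hgb]⟩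
  · rintro _ ⟨v, rfl | hv, rfl⟩
    · exact hp.le.trans (le_max_left _ _)
    · refine le_trans ?_ (le_max_right _ _)
      rw [hf v hv]; linarith [hu ⟨v, hv, rfl⟩]

/-- A rounding of the enlarged tree amounts to a rounding of the old part and a natural number `k`
for the new edge. All errors from `p` are those from `u` plus the edge error, so it is enough to
bound the two extreme ones, which is `ShiftOK`. Positivity of `ε` serves the trivial path at `p`. -/
theorem ranges_insert {G : SimpleGraph V} (hG : G.IsTree) {A : Set V} (hfin : A.Finite)
    (hA : PathClosed G A) {p u : V} (hp : p ∉ A) (hu : u ∈ A) (h : G.Adj p u) (w : Sym2 V → ℝ≥0)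
    (ε : ℝ) (hε : 0 < ε) :
    ranges G w ε (insert p A) p = shiftSet ε (w s(p, u)) (ranges G w ε A u) := by
  have hcons := fun v hv => treeErr_cons hG hA hp hu (v := v) hv h w
  have hself := fun w' => treeErr_self hG.isAcyclic w w' p
  ext J
  constructor
  · rintro ⟨w', hw', hJ₁, hJ₂⟩
    obtain ⟨I, hI₁, hI₂⟩ := exists_isLeast_isGreatest hfin ⟨u, hu⟩ (treeErr G w w' u)
    obtain ⟨h₁, h₂⟩ := range_insert (f := treeErr G w w' p) (hself w')
      (fun v hv => hcons v hv w') hI₁ hI₂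
    refine ⟨I, ⟨w', fun a ha b hb => hw' a (Or.inr ha) b (Or.inr hb), hI₁, hI₂⟩, w' s(p, u), ?_,
      Prod.ext (hJ₁.unique h₁) (hJ₂.unique h₂)⟩
    obtain ⟨a, ha, hIa⟩ := hI₁.1
    obtain ⟨b, hb, hIb⟩ := hI₂.1
    have ha' := abs_lt.1 (hw' p (Or.inl rfl) a (Or.inr ha))
    have hb' := abs_lt.1 (hw' p (Or.inl rfl) b (Or.inr hb))
    rw [hcons a ha, hIa] at ha'
    rw [hcons b hb, hIb] at hb'
    exact ⟨ha'.1, hb'.2⟩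
  · rintro ⟨I, ⟨w₀, hw₀, hI₁, hI₂⟩, k, hok, rfl⟩
    classical
    let w' := Function.update w₀ s(p, u) k
    have hcongr : ∀ a ∈ A, ∀ b ∈ A, treeErr G w w' a b = treeErr G w w₀ a b := by
      intro a ha b hb
      refine treeErr_congr hG hA w (fun x hx y hy => ?_) ha hb
      refine Function.update_of_ne ?_ _ _
      intro he
      rcases Sym2.eq_iff.1 he with ⟨rfl, -⟩ | ⟨-, rfl⟩ <;> contradiction
    have hdist : ∀ v ∈ A, treeErr G w w' p v = (k - w s(p, u)) + treeErr G w w₀ u v := by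
      intro v hv
      rw [hcons v hv, hcongr u hu v hv, edgeError]
      simp [w']
    have hbd : ∀ v ∈ A, |treeErr G w w' p v| < ε := by
      intro v hv
      rw [hdist v hv, abs_lt]
      have h1 := hI₁.2 ⟨v, hv, rfl⟩
      have h2 := hI₂.2 ⟨v, hv, rfl⟩
      exact ⟨by linarith [hok.1], by linarith [hok.2]⟩
    obtain ⟨h₁, h₂⟩ := range_insert (f := treeErr G w w' p) (hself w') hdist hI₁ hI₂
    refine ⟨w', ?_, h₁, h₂⟩
    rintro a (rfl | ha) b (rfl | hb)
    · simpa [hself] using hε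
    · exact hbd b hb
    · rw [treeErr_comm hG]; exact hbd a ha
    · rw [hcongr a ha b hb]; exact hw₀ a ha b hb

/-- Least and greatest errors on a union. -/
theorem range_union {A B : Set V} {f : V → ℝ} {I J : ℝ × ℝ} (h : IsLeast (f '' A) I.1)
    (h' : IsGreatest (f '' A) I.2) (g : IsLeast (f '' B) J.1) (g' : IsGreatest (f '' B) J.2) :
    IsLeast (f '' (A ∪ B)) (hull I J).1 ∧ IsGreatest (f '' (A ∪ B)) (hull I J).2 := by
  rw [Set.image_union]
  exact ⟨h.union g, h'.union g'⟩

/-- An error across `r` is a sum of an error in `A` and an error in `B`, and the two can be chosen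
independently. The extreme cross errors are thus the sums of the end points, and `HullOK` bounds
exactly these. -/
theorem ranges_union {G : SimpleGraph V} (hG : G.IsTree) {A B : Set V} (hfA : A.Finite)
    (hfB : B.Finite) (hA : PathClosed G A) (hB : PathClosed G B) {r : V} (hAB : A ∩ B = {r})
    (w : Sym2 V → ℝ≥0) (ε : ℝ) :
    ranges G w ε (A ∪ B) r = hullSet ε (ranges G w ε A r) (ranges G w ε B r) := by
  have hr : r ∈ A ∩ B := by rw [hAB]; rfl
  have hcross := fun a ha b hb => treeErr_of_inter hG hA hB hAB (a := a) (b := b) ha hb w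
  ext K
  constructor
  · rintro ⟨w', hw', hK₁, hK₂⟩
    obtain ⟨I, hI₁, hI₂⟩ := exists_isLeast_isGreatest hfA ⟨r, hr.1⟩ (treeErr G w w' r)
    obtain ⟨J, hJ₁, hJ₂⟩ := exists_isLeast_isGreatest hfB ⟨r, hr.2⟩ (treeErr G w w' r)
    obtain ⟨h₁, h₂⟩ := range_union hI₁ hI₂ hJ₁ hJ₂
    refine ⟨I, ⟨w', fun a ha b hb => hw' a (Or.inl ha) b (Or.inl hb), hI₁, hI₂⟩,
      J, ⟨w', fun a ha b hb => hw' a (Or.inr ha) b (Or.inr hb), hJ₁, hJ₂⟩, ⟨?_, ?_⟩,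
      Prod.ext (hK₁.unique h₁) (hK₂.unique h₂)⟩
    · obtain ⟨a, ha, hIa⟩ := hI₁.1
      obtain ⟨b, hb, hJb⟩ := hJ₁.1
      have := (abs_lt.1 (hw' a (Or.inl ha) b (Or.inr hb))).1
      rwa [hcross a ha b hb, hIa, hJb] at this
    · obtain ⟨a, ha, hIa⟩ := hI₂.1
      obtain ⟨b, hb, hJb⟩ := hJ₂.1
      have := (abs_lt.1 (hw' a (Or.inl ha) b (Or.inr hb))).2
      rwa [hcross a ha b hb, hIa, hJb] at this
  · rintro ⟨I, ⟨w₁, hw₁, hI₁, hI₂⟩, J, ⟨w₂, hw₂, hJ₁, hJ₂⟩, hok, rfl⟩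
    classical
    -- Gluing is consistent because an edge has two distinct ends and `A ∩ B` has only one vertex:
    -- no edge of the `B` part lies inside `A`.
    let w' : Sym2 V → ℕ := fun e => if ∀ x ∈ e, x ∈ A then w₁ e else w₂ e
    have hcA : ∀ a ∈ A, ∀ b ∈ A, treeErr G w w' a b = treeErr G w w₁ a b := by
      intro a ha b hb
      refine treeErr_congr hG hA w (fun x hx y hy => ?_) ha hb
      simp [w', hx, hy]
    have hcB : ∀ a ∈ B, ∀ b ∈ B, treeErr G w w' a b = treeErr G w w₂ a b := by
      intro a ha b hb
      obtain ⟨p, hp⟩ := exists_isPath hG a b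
      rw [treeErr_eq hG.isAcyclic _ _ hp, treeErr_eq hG.isAcyclic _ _ hp, walkError_eq_sum,
        walkError_eq_sum]
      congr 1
      refine List.map_congr_left fun e he => ?_
      induction e with
      | _ x y =>
        have hx := hB a ha b hb p hp x (p.fst_mem_support_of_mem_edges he)
        have hy := hB a ha b hb p hp y (p.snd_mem_support_of_mem_edges he)
        have hne := (p.adj_of_mem_edges he).ne
        have : ¬ (x ∈ A ∧ y ∈ A) := by
          rintro ⟨hxA, hyA⟩
          have h1 : x ∈ A ∩ B := ⟨hxA, hx⟩
          have h2 : y ∈ A ∩ B := ⟨hyA, hy⟩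
          rw [hAB] at h1 h2
          exact hne (h1.trans h2.symm)
        simp [edgeError, w', this]
    have heA : treeErr G w w' r '' A = treeErr G w w₁ r '' A :=
      Set.image_congr fun v hv => hcA r hr.1 v hv
    have heB : treeErr G w w' r '' B = treeErr G w w₂ r '' B :=
      Set.image_congr fun v hv => hcB r hr.2 v hv
    rw [← heA] at hI₁ hI₂
    rw [← heB] at hJ₁ hJ₂
    obtain ⟨h₁, h₂⟩ := range_union hI₁ hI₂ hJ₁ hJ₂
    have hc : ∀ a ∈ A, ∀ b ∈ B, |treeErr G w w' a b| < ε := by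
      intro a ha b hb
      rw [hcross a ha b hb, abs_lt]
      have h1 := hI₁.2 ⟨a, ha, rfl⟩
      have h2 := hI₂.2 ⟨a, ha, rfl⟩
      have h3 := hJ₁.2 ⟨b, hb, rfl⟩
      have h4 := hJ₂.2 ⟨b, hb, rfl⟩
      exact ⟨by linarith [hok.1], by linarith [hok.2]⟩
    refine ⟨w', ?_, h₁, h₂⟩
    rintro a (ha | ha) b (hb | hb)
    · rw [hcA a ha b hb]; exact hw₁ a ha b hb
    · exact hc a ha b hb
    · rw [treeErr_comm hG]; exact hc b hb a ha
    · rw [hcB a ha b hb]; exact hw₂ a ha b hb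

theorem ranges_singleton {G : SimpleGraph V} (hG : G.IsTree) (w : Sym2 V → ℝ≥0) (ε : ℝ) (r : V) :
    ranges G w ε {r} r = {I | 0 < ε ∧ I = (0, 0)} := by
  ext I
  simp only [ranges, Set.mem_singleton_iff, forall_eq, treeErr_self hG.isAcyclic, abs_zero,
    Set.image_singleton, Set.mem_ofPred_eq, exists_const]
  refine and_congr_right fun _ => ⟨?_, ?_⟩
  · rintro ⟨h, h'⟩
    exact Prod.ext (h.unique isLeast_singleton) (h'.unique isGreatest_singleton)
  · rintro rfl
    exact ⟨isLeast_singleton, isGreatest_singleton⟩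

theorem ranges_eq_empty (G : SimpleGraph V) (w : Sym2 V → ℝ≥0) {ε : ℝ}
    (hε : ε ≤ 0) {A : Set V} {r : V} (hr : r ∈ A) : ranges G w ε A r = ∅ := by
  refine Set.eq_empty_of_forall_notMem ?_
  rintro I ⟨w', h, -⟩
  exact absurd (h r hr r hr) (not_lt.2 (hε.trans (abs_nonneg _)))

/-! ### Roundings from monotone functions of the depth -/

/-- Splitting a walk at its first vertex in `S`. -/
theorem exists_append_first {G : SimpleGraph V} (S : Set V) {a r : V} (p : G.Walk a r)
    (hr : r ∈ S) : ∃ c ∈ S, ∃ (p₁ : G.Walk a c) (p₂ : G.Walk c r), p = p₁.append p₂ ∧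
      ∀ x ∈ p₁.support, x ∈ S → x = c := by
  induction p with
  | nil => exact ⟨_, hr, .nil, .nil, rfl, by simp⟩
  | @cons a b r h p ih =>
    by_cases ha : a ∈ S
    · exact ⟨a, ha, .nil, .cons h p, rfl, by simp⟩
    · obtain ⟨c, hc, p₁, p₂, rfl, hp⟩ := ih hr
      refine ⟨c, hc, .cons h p₁, p₂, by simp, fun x hx hxS => ?_⟩
      rw [SimpleGraph.Walk.support_cons, List.mem_cons] at hx
      rcases hx with rfl | hx
      · exact absurd hxS ha
      · exact hp x hx hxS

/-- Here `c` is the branching vertex, the first vertex of the path from `a` to `r` that is on the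
path from `r` to `b`. The error up to `c` is counted twice on the right. As `c` depends only on the
tree, the identity holds for all roundings at once. -/
theorem exists_meet {G : SimpleGraph V} (hG : G.IsTree) (w : Sym2 V → ℝ≥0) (r a b : V) :
    ∃ c, ∀ w' : Sym2 V → ℕ, treeErr G w w' a b =
      treeErr G w w' r a + treeErr G w w' r b - 2 * treeErr G w w' r c := by
  obtain ⟨p, hp⟩ := exists_isPath hG a r
  obtain ⟨q, hq⟩ := exists_isPath hG r b
  obtain ⟨c, hc, p₁, p₂, rfl, hfirst⟩ := exists_append_first {x | x ∈ q.support} p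
    q.start_mem_support
  obtain ⟨q₁, q₂, rfl⟩ := SimpleGraph.Walk.mem_support_iff_exists_append.1 hc
  have hab : (p₁.append q₂).IsPath := isPath_append hp.of_append_left hq.of_append_right
    fun x hx hx' => hfirst x hx
      ((SimpleGraph.Walk.mem_support_append_iff _ _).2 (Or.inr hx'))
  refine ⟨c, fun w' => ?_⟩
  rw [treeErr_append hG.isAcyclic w w' hab, treeErr_append hG.isAcyclic w w' hq,
    treeErr_comm hG w w' r a, treeErr_append hG.isAcyclic w w' hp, treeErr_comm hG w w' c r]
  ring

/-- `h v` is the weighted depth of `v`. A monotone `g` with `g 0 = 0` yields a rounding by giving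
each edge the difference of the values of `g` at the depths of its ends: depths increase along a
root path, so these differences are nonnegative and telescope. -/
theorem exists_depth {G : SimpleGraph V} (hG : G.IsTree) (w : Sym2 V → ℝ≥0) (r : V) :
    ∃ h : V → ℝ≥0, (∀ w' v, ∃ k : ℕ, treeErr G w w' r v = k - h v) ∧
      ∀ g : ℝ≥0 → ℕ, Monotone g → g 0 = 0 → ∃ w', ∀ v, treeErr G w w' r v = g (h v) - h v := by
  choose P hP using exists_isPath hG r
  refine ⟨fun v => walkWeight w (P v), fun w' v => ⟨walkWeight w' (P v), ?_⟩, fun g hg hg0 => ?_⟩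
  · rw [treeErr_eq hG.isAcyclic w w' (hP v)]; rfl
  · let f : V → ℕ := fun v => g (walkWeight w (P v))
    -- The difference `max - min` is symmetric, as `Sym2` demands, and never truncated.
    let w' : Sym2 V → ℕ := Sym2.lift ⟨fun x y => max (f x) (f y) - min (f x) (f y),
      fun x y => by simp only [max_comm, min_comm]⟩
    -- The induction runs over final segments `q` of root paths; the condition on `q` says that it
    -- continues the path from `r` to `x`.
    have key : ∀ {x v : V} (q : G.Walk x v), (∀ p : G.Walk r x, p.IsPath → (p.append q).IsPath) →
        f x + walkWeight w' q = f v := by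
      intro x v q
      induction q with
      | nil => intro _; simp [walkWeight]
      | @cons x y v h q ih =>
        intro hpath
        have h1 := hpath (P x) (hP x)
        rw [← SimpleGraph.Walk.concat_append] at h1
        have hy : P y = (P x).concat h := isPath_unique hG.isAcyclic (hP y) h1.of_append_left
        have hle : f x ≤ f y := by
          refine hg ?_
          rw [hy]
          simp [walkWeight, SimpleGraph.Walk.edges_concat]
        have h2 := ih fun p hp => by
          rw [isPath_unique hG.isAcyclic hp h1.of_append_left]; exact h1
        have h3 : walkWeight w' (SimpleGraph.Walk.cons h q) = w' s(x, y) + walkWeight w' q := by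
          simp [walkWeight]
        have h4 : w' s(x, y) = f y - f x := by
          simp [w', max_eq_right hle, min_eq_left hle]
        omega
    refine ⟨w', fun v => ?_⟩
    have h := key (P v) fun p hp => by
      rw [(SimpleGraph.Walk.isPath_iff_nil.1 hp).eq_nil]; simpa using hP v
    have hr : f r = 0 := by
      have : P r = .nil := (SimpleGraph.Walk.isPath_iff_nil.1 (hP r)).eq_nil
      simp [f, this, walkWeight, hg0]
    rw [hr, zero_add] at h
    rw [treeErr_eq hG.isAcyclic w w' (hP v), walkError, h]

/-- Errors from the root have the form `k - h v` with `k < h v + ε`, which leaves finitely many. For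
`low` and `high` the depths are rounded by floor and by ceiling. -/
theorem admissible_ranges [Finite V] {G : SimpleGraph V} (hG : G.IsTree) (w : Sym2 V → ℝ≥0)
    (ε : ℝ) {A : Set V} {r : V} (hr : r ∈ A) : Admissible ε (ranges G w ε A r) := by
  obtain ⟨h, hk, hg⟩ := exists_depth hG w r
  have hbound : ∀ w' v, v ∈ A → (∀ a ∈ A, ∀ b ∈ A, |treeErr G w w' a b| < ε) →
      treeErr G w w' r v ∈ ⋃ v, (fun k : ℕ => (k : ℝ) - h v) '' Set.Iic ⌊(h v : ℝ) + ε⌋₊ := by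
    intro w' v hv hw'
    obtain ⟨k, hk⟩ := hk w' v
    have := (abs_lt.1 (hw' r hr v hv)).2
    refine Set.mem_iUnion.2 ⟨v, k, Nat.le_floor ?_, hk.symm⟩
    linarith
  have hround : 2 < ε → ∀ g : ℝ≥0 → ℕ, Monotone g → g 0 = 0 →
      ((∀ x, -1 < (g x : ℝ) - x ∧ (g x : ℝ) - x ≤ 0) ∨
        (∀ x, 0 ≤ (g x : ℝ) - x ∧ (g x : ℝ) - x < 1)) →
      ∃ I ∈ ranges G w ε A r, ∃ x y : ℝ≥0, I = ((g x : ℝ) - x, (g y : ℝ) - y) := by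
    intro hε g hmono h0 hlt
    obtain ⟨w', hw'⟩ := hg g hmono h0
    obtain ⟨I, h1, h2⟩ := exists_isLeast_isGreatest A.toFinite ⟨r, hr⟩ (treeErr G w w' r)
    refine ⟨I, ⟨w', fun a _ b _ => ?_, h1, h2⟩, ?_⟩
    -- If all root errors lie in `(-1, 0]`, or all in `[0, 1)`, then `e(a) + e(b) - 2 e(c)` lies in
    -- `(-2, 2)`. This is where the threshold `2 < ε` comes from.
    · obtain ⟨c, hc⟩ := exists_meet hG w r a b
      rw [hc, hw', hw', hw', abs_lt]
      rcases hlt with hlt | hlt <;>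
      · have ha := hlt (h a)
        have hb := hlt (h b)
        have hc := hlt (h c)
        constructor <;> linarith [ha.1, ha.2, hb.1, hb.2, hc.1, hc.2]
    · obtain ⟨a, -, ha⟩ := h1.1
      obtain ⟨b, -, hb⟩ := h2.1
      exact ⟨h a, h b, Prod.ext (by rw [← ha, hw']) (by rw [← hb, hw'])⟩
  have hfl : ∀ x : ℝ≥0, -1 < ((⌊x⌋₊ : ℕ) : ℝ) - x ∧ ((⌊x⌋₊ : ℕ) : ℝ) - x ≤ 0 := by
    intro x
    have h1 : ((⌊x⌋₊ : ℕ) : ℝ≥0) ≤ x := Nat.floor_le x.2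
    have h2 : x < ((⌊x⌋₊ : ℕ) : ℝ≥0) + 1 := Nat.lt_floor_add_one x
    have h1' : ((⌊x⌋₊ : ℕ) : ℝ) ≤ x := by exact_mod_cast h1
    have h2' : (x : ℝ) < ((⌊x⌋₊ : ℕ) : ℝ) + 1 := by exact_mod_cast h2
    constructor <;> linarith
  have hce : ∀ x : ℝ≥0, 0 ≤ ((⌈x⌉₊ : ℕ) : ℝ) - x ∧ ((⌈x⌉₊ : ℕ) : ℝ) - x < 1 := by
    intro x
    have h1 : x ≤ ((⌈x⌉₊ : ℕ) : ℝ≥0) := Nat.le_ceil x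
    have h2 : ((⌈x⌉₊ : ℕ) : ℝ≥0) < x + 1 := Nat.ceil_lt_add_one x.2
    have h1' : (x : ℝ) ≤ ((⌈x⌉₊ : ℕ) : ℝ) := by exact_mod_cast h1
    have h2' : ((⌈x⌉₊ : ℕ) : ℝ) < (x : ℝ) + 1 := by exact_mod_cast h2
    constructor <;> linarith
  refine ⟨?_, ?_, fun hε => ?_, fun hε => ?_⟩
  · have hF : (⋃ v, (fun k : ℕ => (k : ℝ) - h v) '' Set.Iic ⌊(h v : ℝ) + ε⌋₊).Finite :=
      Set.finite_iUnion fun v => (Set.finite_Iic _).image _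
    refine (hF.prod hF).subset ?_
    rintro I ⟨w', hw', ⟨⟨a, ha, ha'⟩, -⟩, ⟨⟨b, hb, hb'⟩, -⟩⟩
    exact ⟨ha' ▸ hbound w' a ha hw', hb' ▸ hbound w' b hb hw'⟩
  · rintro I ⟨w', hw', h1, h2⟩
    have hz : (0 : ℝ) ∈ treeErr G w w' r '' A := ⟨r, hr, treeErr_self hG.isAcyclic w w' r⟩
    obtain ⟨a, ha, ha'⟩ := h1.1
    obtain ⟨b, hb, hb'⟩ := h2.1
    exact ⟨ha' ▸ (abs_lt.1 (hw' r hr a ha)).1, h1.2 hz, h2.2 hz,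
      hb' ▸ (abs_lt.1 (hw' r hr b hb)).2⟩
  · obtain ⟨I, hI, x, y, rfl⟩ := hround hε (fun x => ⌊x⌋₊) Nat.floor_mono (by simp) (Or.inl hfl)
    exact ⟨_, hI, (hfl x).1, (hfl y).2⟩
  · obtain ⟨I, hI, x, y, rfl⟩ := hround hε (fun x => ⌈x⌉₊) Nat.ceil_mono (by simp) (Or.inr hce)
    exact ⟨_, hI, (hce x).1, (hce y).2⟩

/-- A minimal interval is determined by its lower bound, which lies in `(-2, 0]` and equals `k - h
v` for some `v ∈ A`. -/
theorem ncard_minimals_ranges_le [Finite V] {G : SimpleGraph V} (hG : G.IsTree)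
    (w : Sym2 V → ℝ≥0) (ε : ℝ) {A : Set V} {r : V} (hr : r ∈ A) :
    (minimals (ranges G w ε A r)).ncard ≤ 2 * A.ncard := by
  obtain ⟨h, hk, -⟩ := exists_depth hG w r
  have hadm := admissible_ranges hG w ε hr
  -- For fixed `v` only `k = ⌊h v⌋₊` and `k = ⌊h v⌋₊ - 1` put `k - h v` into `(-2, 0]`.
  let f : V × Fin 2 → ℝ := fun x => ⌊(h x.1 : ℝ)⌋₊ - (x.2 : ℕ) - h x.1
  have hsub : Prod.fst '' minimals (ranges G w ε A r) ⊆ f '' (A ×ˢ Set.univ) := by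
    rintro _ ⟨I, hI, rfl⟩
    have h1 := (hadm.minimal_bounds hI).1
    have h2 := (hadm.bounds I hI.1).2.1
    obtain ⟨w', -, ⟨⟨v, hvA, hv⟩, -⟩, -⟩ := hI.1
    obtain ⟨k, hk⟩ := hk w' v
    rw [← hv, hk] at h1 h2 ⊢
    have h3 := Nat.floor_le (h v).2
    have h4 := Nat.lt_floor_add_one (h v : ℝ)
    have h5 : ⌊(h v : ℝ)⌋₊ < k + 2 := by
      have : (⌊(h v : ℝ)⌋₊ : ℝ) < k + 2 := by
        have : (⌊(h v : ℝ)⌋₊ : ℝ) ≤ h v := h3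
        linarith
      exact_mod_cast this
    have h6 : k ≤ ⌊(h v : ℝ)⌋₊ := Nat.le_floor (by linarith)
    have h7 : k = ⌊(h v : ℝ)⌋₊ ∨ k + 1 = ⌊(h v : ℝ)⌋₊ := by omega
    rcases h7 with h7 | h7
    · exact ⟨(v, 0), ⟨hvA, trivial⟩, by simp [f, ← h7]⟩
    · exact ⟨(v, 1), ⟨hvA, trivial⟩, by simp only [f, ← h7]; push_cast; simp⟩
  rw [← (minimals_injOn _).ncard_image]
  refine (Set.ncard_le_ncard hsub (Set.toFinite _)).trans ((Set.ncard_image_le).trans ?_)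
  rw [Set.ncard_prod, Set.ncard_univ]
  simp [mul_comm]

end Rounding

/-! ### Extracting the minimal intervals of sorted lists with a stack. -/

namespace Rounding

/-! ### The pruning stack -/

/-- The stack `Z 0, …, Z (n - 1)` and the remaining candidates `R` represent the minimal elements
of `S`. -/
structure StackInv (S : Set (ℝ × ℝ)) (Z : ℕ → ℝ × ℝ) (n : ℕ) (R : Set (ℝ × ℝ)) : Prop where
  asc : ∀ i j, i < j → j < n → (Z i).1 < (Z j).1 ∧ (Z i).2 < (Z j).2
  mem : ∀ i < n, Z i ∈ S
  rem : R ⊆ S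
  low : ∀ i < n, ∀ c ∈ R, (Z i).1 ≤ c.1
  dom : ∀ I ∈ S, (∃ i < n, Sub (Z i) I) ∨ ∃ c ∈ R, Sub c I

namespace StackInv

variable {S R R' : Set (ℝ × ℝ)} {Z Z' : ℕ → ℝ × ℝ} {n : ℕ} {c : ℝ × ℝ}

/-- The candidate `c` starts no earlier than the top and ends no later, hence lies inside it and
makes it redundant. It stays among the candidates, as it may remove further entries. -/
theorem pop (h : StackInv S Z (n + 1) R) (hc : c ∈ R) (hle : c.2 ≤ (Z n).2) :
    StackInv S Z n R where
  asc i j hij hj := h.asc i j hij (by omega)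
  mem i hi := h.mem i (by omega)
  rem := h.rem
  low i hi := h.low i (by omega)
  dom I hI := by
    rcases h.dom I hI with ⟨i, hi, hs⟩ | h'
    · rcases Nat.lt_succ_iff_lt_or_eq.1 hi with hi | rfl
      · exact Or.inl ⟨i, hi, hs⟩
      · exact Or.inr ⟨c, hc, Sub.trans ⟨h.low i (by omega) c hc, hle⟩ hs⟩
    · exact Or.inr h'

/-- Here the candidate contains the top, so the top represents it. -/
theorem drop (h : StackInv S Z (n + 1) R) (hlt : (Z n).2 < c.2) (hle : c.1 ≤ (Z n).1)
    (h₁ : R' ⊆ R) (h₂ : R ⊆ insert c R') : StackInv S Z (n + 1) R' where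
  asc := h.asc
  mem := h.mem
  rem := h₁.trans h.rem
  low i hi d hd := h.low i hi d (h₁ hd)
  dom I hI := by
    rcases h.dom I hI with h' | ⟨d, hd, hs⟩
    · exact Or.inl h'
    · rcases h₂ hd with rfl | hd
      · exact Or.inl ⟨n, by omega, Sub.trans ⟨hle, hlt.le⟩ hs⟩
      · exact Or.inr ⟨d, hd, hs⟩

/-- Comparing with the top is enough, since both bounds increase along the stack. Minimality of
`c.1` among the remaining candidates keeps later ones from starting before the new top. -/
theorem push (h : StackInv S Z n R) (hc : c ∈ R) (hmin : ∀ d ∈ R, c.1 ≤ d.1)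
    (htop : ∀ k, n = k + 1 → (Z k).1 < c.1 ∧ (Z k).2 < c.2) (hZ : ∀ i < n, Z' i = Z i)
    (hZn : Z' n = c) (h₁ : R' ⊆ R) (h₂ : R ⊆ insert c R') : StackInv S Z' (n + 1) R' where
  asc i j hij hj := by
    rcases Nat.lt_succ_iff_lt_or_eq.1 hj with hj | rfl
    · rw [hZ i (hij.trans hj), hZ j hj]
      exact h.asc i j hij hj
    · rw [hZ i hij, hZn]
      obtain ⟨k, rfl⟩ : ∃ k, j = k + 1 := ⟨j - 1, by omega⟩
      have ht := htop k rfl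
      rcases Nat.lt_succ_iff_lt_or_eq.1 hij with hik | rfl
      · have := h.asc i k hik (by omega)
        exact ⟨this.1.trans ht.1, this.2.trans ht.2⟩
      · exact ht
  mem i hi := by
    rcases Nat.lt_succ_iff_lt_or_eq.1 hi with hi | rfl
    · rw [hZ i hi]; exact h.mem i hi
    · rw [hZn]; exact h.rem hc
  rem := h₁.trans h.rem
  low i hi d hd := by
    rcases Nat.lt_succ_iff_lt_or_eq.1 hi with hi | rfl
    · rw [hZ i hi]; exact h.low i hi d (h₁ hd)
    · rw [hZn]; exact hmin d (h₁ hd)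
  dom I hI := by
    rcases h.dom I hI with ⟨i, hi, hs⟩ | ⟨d, hd, hs⟩
    · exact Or.inl ⟨i, by omega, by rwa [hZ i hi]⟩
    · rcases h₂ hd with rfl | hd
      · exact Or.inl ⟨n, by omega, by rwa [hZn]⟩
      · exact Or.inr ⟨d, hd, hs⟩

/-- Both bounds increase strictly along the stack, so no entry contains another; with no candidates
left the entries dominate `S`. -/
theorem eq_minimals (h : StackInv S Z n ∅) : {I | ∃ i < n, I = Z i} = minimals S := by
  have hsub : {I | ∃ i < n, I = Z i} ⊆ S := by
    rintro I ⟨i, hi, rfl⟩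
    exact h.mem i hi
  rw [← minimals_eq_of_dominates hsub fun I hI => ?_]
  · refine Set.Subset.antisymm ?_ (minimals_subset _)
    rintro I ⟨i, hi, rfl⟩
    refine ⟨⟨i, hi, rfl⟩, ?_⟩
    rintro J ⟨j, hj, rfl⟩ ⟨h1, h2⟩
    rcases lt_trichotomy i j with hij | rfl | hij
    · exact absurd h2 (not_le.2 (h.asc i j hij hj).2)
    · rfl
    · exact absurd h1 (not_le.2 (h.asc j i hij hi).1)
  · rcases h.dom I hI with ⟨i, hi, hs⟩ | ⟨c, hc, -⟩
    · exact ⟨Z i, ⟨i, hi, rfl⟩, hs⟩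
    · exact absurd hc (Set.notMem_empty c)

end StackInv

end Rounding

/-! ### Copying and merging lists of intervals in memory. -/

namespace RealRAM

open Rounding

/-! ### Lists of intervals in memory -/

/-- The interval stored at position `i` of the real arrays `a` and `a + 1`. -/
def ivl (s : State) (a i : ℕ) : ℝ × ℝ := (s.ra a i, s.ra (a + 1) i)

/-- The set of the first `n` intervals stored in the real arrays `a` and `a + 1`. -/
def ivs (s : State) (a n : ℕ) : Set (ℝ × ℝ) := {I | ∃ i < n, I = ivl s a i}

/-- The lower bounds of the first `n` intervals are strictly ascending. -/
def Asc (s : State) (a n : ℕ) : Prop := ∀ i j, i < j → j < n → s.ra a i < s.ra a j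

/-- The lower bounds of the first `n` intervals are weakly ascending. -/
def WeakAsc (s : State) (a n : ℕ) : Prop := ∀ i j, i < j → j < n → s.ra a i ≤ s.ra a j

theorem Asc.weakAsc {s : State} {a n : ℕ} (h : Asc s a n) : WeakAsc s a n :=
  fun i j hij hj => (h i j hij hj).le

theorem WeakAsc.le {s : State} {a n i j : ℕ} (h : WeakAsc s a n) (hij : i ≤ j) (hj : j < n) :
    s.ra a i ≤ s.ra a j := by
  rcases hij.lt_or_eq with h' | rfl
  · exact h i j h' hj
  · exact le_rfl

theorem ivs_zero (s : State) (a : ℕ) : ivs s a 0 = ∅ := by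
  ext I; simp [ivs]

theorem ivs_succ (s : State) (a n : ℕ) : ivs s a (n + 1) = insert (ivl s a n) (ivs s a n) := by
  ext I
  constructor
  · rintro ⟨i, hi, rfl⟩
    rcases Nat.lt_succ_iff_lt_or_eq.1 hi with hi | rfl
    · exact Or.inr ⟨i, hi, rfl⟩
    · exact Or.inl rfl
  · rintro (rfl | ⟨i, hi, rfl⟩)
    · exact ⟨n, by omega, rfl⟩
    · exact ⟨i, by omega, rfl⟩

theorem ivs_congr {s s' : State} {a a' n : ℕ} (h : ∀ i < n, ivl s' a' i = ivl s a i) :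
    ivs s' a' n = ivs s a n := by
  ext I
  constructor
  · rintro ⟨i, hi, rfl⟩
    exact ⟨i, hi, h i hi⟩
  · rintro ⟨i, hi, rfl⟩
    exact ⟨i, hi, (h i hi).symm⟩

theorem Asc.congr {s s' : State} {a a' n : ℕ} (h : Asc s a n)
    (h' : ∀ i < n, ivl s' a' i = ivl s a i) : Asc s' a' n := by
  intro i j hij hj
  have h1 := congrArg Prod.fst (h' i (hij.trans hj))
  have h2 := congrArg Prod.fst (h' j hj)
  simp only [ivl] at h1 h2
  rw [h1, h2]
  exact h i j hij hj

theorem WeakAsc.congr {s s' : State} {a a' n : ℕ} (h : WeakAsc s a n)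
    (h' : ∀ i < n, ivl s' a' i = ivl s a i) : WeakAsc s' a' n := by
  intro i j hij hj
  have h1 := congrArg Prod.fst (h' i (hij.trans hj))
  have h2 := congrArg Prod.fst (h' j hj)
  simp only [ivl] at h1 h2
  rw [h1, h2]
  exact h i j hij hj

/-! ### Copying -/

/-- One step of copying an interval. -/
def copyStep (a b : ℕ) : Prog :=
  .seq (.putReal b (.add (.var 21) (.var 23)) (.get a (.add (.var 20) (.var 23)))) <|
  .seq (.putReal (b + 1) (.add (.var 21) (.var 23)) (.get (a + 1) (.add (.var 20) (.var 23)))) <|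
  .setNat 23 (.add (.var 23) (.const 1))

/-- Copy `cnt` intervals from arrays `a`, `a + 1` at offset `os` to arrays `b`, `b + 1` at offset
`od`. -/
def copy (a b : ℕ) (os od cnt : NExp) : Prog :=
  .seq (.setNat 20 os) <| .seq (.setNat 21 od) <| .seq (.setNat 22 cnt) <| .seq (.setNat 23 (.const 0)) <|
  .loop (.natLt (.var 23) (.var 22)) (copyStep a b)

/-- The effect of copying. -/
structure Copied (a b os od cnt : ℕ) (s s' : State) : Prop where
  new : ∀ i < cnt, ivl s' b (od + i) = ivl s a (os + i)
  old : ∀ j, j < od ∨ od + cnt ≤ j → ivl s' b j = ivl s b j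

/-- The value of an expression does not depend on the natural variables `20` to `23`. -/
def NExp.Stable (e : NExp) : Prop := ∀ s : State, ∀ x v, 20 ≤ x → x ≤ 23 →
  e.val (s.setNat x v) = e.val s

theorem NExp.stable_const (k : ℕ) : (NExp.const k).Stable := fun _ _ _ _ _ => rfl

theorem NExp.stable_var {x : ℕ} (hx : x < 20 ∨ 23 < x) : (NExp.var x).Stable := by
  intro s y v h1 h2
  have : x ≠ y := by omega
  simp [NExp.val, State.setNat, this]

theorem NExp.stable_get {a : ℕ} {e : NExp} (h : e.Stable) : (NExp.get a e).Stable := by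
  intro s y v h1 h2
  simp only [NExp.val, h s y v h1 h2]
  rfl

theorem lin_copyLoop (a b : ℕ) (h1 : a ≠ b) (h2 : a + 1 ≠ b) (h3 : a ≠ b + 1) :
    Lin (.loop (.natLt (.var 23) (.var 22)) (copyStep a b))
      (fun m s => s.nv 22 ≤ m ∧ s.nv 23 = 0)
      (fun _ s s' => Copied a b (s.nv 20) (s.nv 21) (s.nv 22) s s') := by
  refine Lin.loop rfl 1 (fun m s₀ k s => s.nv 20 = s₀.nv 20 ∧ s.nv 21 = s₀.nv 21 ∧
    s.nv 22 = s₀.nv 22 ∧ s.nv 23 + k = s.nv 22 ∧ s.ra a = s₀.ra a ∧ s.ra (a + 1) = s₀.ra (a + 1) ∧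
    (∀ i < s.nv 23, ivl s b (s₀.nv 21 + i) = ivl s₀ a (s₀.nv 20 + i)) ∧
    ∀ j, j < s₀.nv 21 ∨ s₀.nv 21 + s.nv 23 ≤ j → ivl s b j = ivl s₀ b j) ?_ ?_ ?_
  · rintro m s ⟨hm, h0⟩
    exact ⟨s.nv 22, by omega, rfl, rfl, rfl, by omega, rfl, rfl, by simp [h0], fun _ _ => rfl⟩
  · rintro m s₀ k s - ⟨e0, e1, e2, hk, ha, ha', hnew, hold⟩ hb
    simp only [Test.Holds, NExp.val] at hb
    refine ⟨k - 1, by omega, ?_⟩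
    simp only [copyStep, Prog.run, State.setNat, State.putReal, NExp.val, RExp.val]
    refine ⟨by simpa using e0, by simpa using e1, by simpa using e2, ?_, ?_, ?_, ?_, ?_⟩
    · simp; omega
    · simpa [h1, h3] using ha
    · simpa [h1, h2] using ha'
    · intro i hi
      simp only [Function.update_self] at hi
      rcases Nat.lt_succ_iff_lt_or_eq.1 hi with hi | rfl
      · have := hnew i hi
        simp only [ivl] at this ⊢
        have hne : s₀.nv 21 + i ≠ s.nv 21 + s.nv 23 := by omega
        simpa [hne] using this
      · simp [ivl, e0, e1, h2, ha, ha']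
    · intro j hj
      simp only [Function.update_self] at hj
      have := hold j (by omega)
      simp only [ivl] at this ⊢
      have hne : j ≠ s.nv 21 + s.nv 23 := by omega
      simpa [hne] using this
  · rintro m s₀ k s - ⟨e0, e1, e2, hk, ha, ha', hnew, hold⟩ hb
    simp only [Test.Holds, NExp.val, not_lt] at hb
    have : s.nv 23 = s₀.nv 22 := by omega
    exact ⟨fun i hi => hnew i (by omega), fun j hj => hold j (by omega)⟩

/-- `od` and `cnt` are evaluated after some of the variables `20` to `23` have been overwritten,
hence the stability assumptions. `os` is evaluated first and needs none. -/
theorem lin_copy (a b : ℕ) {os od cnt : NExp} (h1 : a ≠ b) (h2 : a + 1 ≠ b) (h3 : a ≠ b + 1)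
    (hod : od.Stable) (hcnt : cnt.Stable) :
    Lin (copy a b os od cnt) (fun m s => cnt.val s ≤ m)
      (fun _ s s' => Copied a b (os.val s) (od.val s) (cnt.val s) s s') := by
  have hrun := fun (x : ℕ) (e : NExp) (Pre : ℕ → State → Prop) =>
    Lin.of_run (P := .setNat x e) (Pre := Pre) (Post := fun _ s s' => s' = s.setNat x (e.val s)) rfl
      (fun _ _ _ => rfl)
  refine (Lin.seq (hrun 20 os fun m s => cnt.val s ≤ m) (Lin.seq
    (hrun 21 od fun m s => cnt.val s ≤ m) (Lin.seq (hrun 22 cnt fun m s => cnt.val s ≤ m)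
    (Lin.seq (hrun 23 (.const 0) fun m s => s.nv 22 ≤ m) (lin_copyLoop a b h1 h2 h3) ?_) ?_) ?_)
    ?_).mono (fun _ _ h => h) ?_
  · rintro m s _ hs - rfl
    exact ⟨by simpa [State.setNat] using hs, by simp [State.setNat, NExp.val]⟩
  · rintro m s _ hs - rfl
    simpa [State.setNat] using hs
  · rintro m s _ hs - rfl
    rwa [hcnt s 21 _ (by norm_num) (by norm_num)]
  · rintro m s _ hs - rfl
    rwa [hcnt s 20 _ (by norm_num) (by norm_num)]
  · rintro m s s' hs - ⟨_, -, rfl, -, _, -, rfl, -, _, -, rfl, -, _, -, rfl, -, h⟩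
    rw [hcnt _ 21 _ (by norm_num) (by norm_num), hcnt s 20 _ (by norm_num) (by norm_num),
      hod s 20 _ (by norm_num) (by norm_num)] at h
    obtain ⟨h, h'⟩ := h
    simp only [State.setNat, Function.update_self, NExp.val, ne_eq,
      Nat.reduceEqDiff, not_false_eq_true, Function.update_of_ne] at h h'
    exact ⟨h, h'⟩

/-! ### Merging with pruning -/

/-- Select the next candidate. -/
def mergeSelect : Prog :=
  .cond (.and (.natLt (.var 16) (.var 13))
      (.not (.and (.natLt (.var 15) (.var 12))
        (.not (.realLt (.get 22 (.var 16)) (.get 20 (.var 15)))))))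
    (.seq (.setNat 17 (.const 1)) <| .seq (.setReal 3 (.get 22 (.var 16))) <|
      .setReal 4 (.get 23 (.var 16)))
    (.seq (.setNat 17 (.const 0)) <| .seq (.setReal 3 (.get 20 (.var 15))) <|
      .setReal 4 (.get 21 (.var 15)))

/-- Remove the top of the stack, or treat the candidate. -/
def mergeTreat : Prog :=
  .cond (.and (.natLt (.const 0) (.var 14))
      (.not (.realLt (.get 25 (.sub (.var 14) (.const 1))) (.var 4))))
    (.setNat 14 (.sub (.var 14) (.const 1)))
    (.seq
      (.cond (.and (.natLt (.const 0) (.var 14))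
          (.not (.realLt (.get 24 (.sub (.var 14) (.const 1))) (.var 3))))
        .skip
        (.seq (.putReal 24 (.var 14) (.var 3)) <| .seq (.putReal 25 (.var 14) (.var 4)) <|
          .setNat 14 (.add (.var 14) (.const 1))))
      (.cond (.natLt (.var 17) (.const 1))
        (.setNat 15 (.add (.var 15) (.const 1)))
        (.setNat 16 (.add (.var 16) (.const 1)))))

/-- Some candidate remains. -/
def mergeTest : Test :=
  .not (.and (.not (.natLt (.var 15) (.var 12))) (.not (.natLt (.var 16) (.var 13))))

/-- Merge the ascending lists in arrays `20`, `21` and `22`, `23` into arrays `24`, `25`, keeping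
the minimal intervals only. -/
def merge : Prog :=
  .seq (.seq (.setNat 14 (.const 0)) <| .seq (.setNat 15 (.const 0)) (.setNat 16 (.const 0))) <|
  .loop mergeTest (.seq mergeSelect mergeTreat)

/-- The intervals from position `i` on. -/
def ivsFrom (s : State) (a i n : ℕ) : Set (ℝ × ℝ) := {I | ∃ t, i ≤ t ∧ t < n ∧ I = ivl s a t}

theorem ivsFrom_zero (s : State) (a n : ℕ) : ivsFrom s a 0 n = ivs s a n := by
  ext I; simp [ivsFrom, ivs]

theorem ivsFrom_subset_succ (s : State) (a i n : ℕ) : ivsFrom s a (i + 1) n ⊆ ivsFrom s a i n := by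
  rintro _ ⟨t, h, h', rfl⟩
  exact ⟨t, by omega, h', rfl⟩

theorem ivsFrom_subset_insert (s : State) (a i n : ℕ) :
    ivsFrom s a i n ⊆ insert (ivl s a i) (ivsFrom s a (i + 1) n) := by
  rintro _ ⟨t, h, h', rfl⟩
  rcases h.lt_or_eq with h | rfl
  · exact Or.inr ⟨t, h, h', rfl⟩
  · exact Or.inl rfl

/-- The memory contents relevant for merging, at the beginning and during the loop. -/
structure MergeInv (s₀ : State) (k : ℕ) (s : State) : Prop where
  nx : s.nv 12 = s₀.nv 12
  ny : s.nv 13 = s₀.nv 13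
  x : s.ra 20 = s₀.ra 20
  x' : s.ra 21 = s₀.ra 21
  y : s.ra 22 = s₀.ra 22
  y' : s.ra 23 = s₀.ra 23
  hi : s.nv 15 ≤ s₀.nv 12
  hj : s.nv 16 ≤ s₀.nv 13
  hz : s.nv 14 ≤ s.nv 15 + s.nv 16
  hk : k = 2 * ((s₀.nv 12 - s.nv 15) + (s₀.nv 13 - s.nv 16)) + s.nv 14
  inv : StackInv (ivs s₀ 20 (s₀.nv 12) ∪ ivs s₀ 22 (s₀.nv 13)) (ivl s 24) (s.nv 14)
    (ivsFrom s₀ 20 (s.nv 15) (s₀.nv 12) ∪ ivsFrom s₀ 22 (s.nv 16) (s₀.nv 13))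

/-- The smaller of the two list heads has the least lower bound of all remaining candidates, by
sortedness; on ties the first list is served. -/
theorem mergeSelect_run {s₀ s : State} {k : ℕ} (hX : WeakAsc s₀ 20 (s₀.nv 12))
    (hY : WeakAsc s₀ 22 (s₀.nv 13)) (h : MergeInv s₀ k s) (hb : mergeTest.Holds s) :
    ∃ (f : ℕ) (c : ℝ × ℝ), mergeSelect.run s = ((s.setNat 17 f).setReal 3 c.1).setReal 4 c.2 ∧
      (f = 0 ∧ s.nv 15 < s₀.nv 12 ∧ c = ivl s₀ 20 (s.nv 15) ∨
        f = 1 ∧ s.nv 16 < s₀.nv 13 ∧ c = ivl s₀ 22 (s.nv 16)) ∧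
      ∀ d ∈ ivsFrom s₀ 20 (s.nv 15) (s₀.nv 12) ∪ ivsFrom s₀ 22 (s.nv 16) (s₀.nv 13),
        c.1 ≤ d.1 := by
  obtain ⟨nx, ny, x, x', y, y', -⟩ := h
  simp only [mergeTest, Test.Holds, NExp.val] at hb
  simp only [mergeSelect, Prog.run, Test.Holds, NExp.val, RExp.val, x, y, nx, ny] at hb ⊢
  split_ifs with hc
  · refine ⟨1, ivl s₀ 22 (s.nv 16), ?_, Or.inr ⟨rfl, hc.1, rfl⟩, ?_⟩
    · simp [State.setNat, State.setReal, ivl, y, y']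
    · rintro _ (⟨t, ht, ht', rfl⟩ | ⟨t, ht, ht', rfl⟩)
      · have h2 : s₀.ra 22 (s.nv 16) < s₀.ra 20 (s.nv 15) := by
          by_contra h3
          exact hc.2 ⟨by omega, h3⟩
        exact h2.le.trans (hX.le ht ht')
      · exact hY.le ht ht'
  · have hlt : s.nv 15 < s₀.nv 12 := by
      by_contra h1
      refine hc ⟨?_, fun h2 => h1 h2.1⟩
      by_contra h2
      exact hb ⟨h1, h2⟩
    refine ⟨0, ivl s₀ 20 (s.nv 15), ?_, Or.inl ⟨rfl, hlt, rfl⟩, ?_⟩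
    · simp [State.setNat, State.setReal, ivl, x, x']
    · rintro _ (⟨t, ht, ht', rfl⟩ | ⟨t, ht, ht', rfl⟩)
      · exact hX.le ht ht'
      · have h2 : s₀.ra 20 (s.nv 15) ≤ s₀.ra 22 (s.nv 16) := by
          by_contra h3
          exact hc ⟨by omega, fun h4 => h4.2 (not_le.1 h3)⟩
        exact h2.trans (hY.le ht ht')

/-- An iteration either pops the stack or consumes a candidate, which pushes at most one entry.
Weighting an unread candidate by `2` and a stack entry by `1` therefore gives a decreasing measure,
and total time is linear although one candidate may cause many pops. -/
theorem mergeStep_run {s₀ s : State} {k : ℕ} (hX : WeakAsc s₀ 20 (s₀.nv 12))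
    (hY : WeakAsc s₀ 22 (s₀.nv 13)) (h : MergeInv s₀ k s) (hb : mergeTest.Holds s) :
    ∃ k' < k, MergeInv s₀ k' ((Prog.seq mergeSelect mergeTreat).run s) := by
  obtain ⟨f, c, hrun, hcase, hmin⟩ := mergeSelect_run hX hY h hb
  obtain ⟨nx, ny, x, x', y, y', hi, hj, hz, hk, inv⟩ := h
  have hcR : c ∈ ivsFrom s₀ 20 (s.nv 15) (s₀.nv 12) ∪ ivsFrom s₀ 22 (s.nv 16) (s₀.nv 13) := by
    rcases hcase with ⟨-, h, rfl⟩ | ⟨-, h, rfl⟩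
    · exact Or.inl ⟨_, le_rfl, h, rfl⟩
    · exact Or.inr ⟨_, le_rfl, h, rfl⟩
  rw [Prog.run, hrun]
  simp only [mergeTreat, Prog.run, Test.Holds, NExp.val, RExp.val, State.setNat, State.setReal,
    State.putReal, Function.update_self, ne_eq, Nat.reduceEqDiff,
    not_false_eq_true, Function.update_of_ne]
  by_cases hpop : 0 < s.nv 14 ∧ ¬ s.ra 25 (s.nv 14 - 1) < c.2
  · rw [if_pos hpop]
    obtain ⟨n, hn⟩ : ∃ n, s.nv 14 = n + 1 := ⟨s.nv 14 - 1, by omega⟩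
    rw [hn] at inv hpop hz hk
    refine ⟨k - 1, by omega, ⟨nx, ny, x, x', y, y', hi, hj, ?_, ?_, ?_⟩⟩
    · simp [hn]; omega
    · simp [hn]; omega
    · simp only [hn, Function.update_self, ne_eq, Nat.reduceEqDiff, not_false_eq_true,
        Function.update_of_ne, Nat.add_sub_cancel]
      exact inv.pop hcR (not_lt.1 hpop.2)
  rw [if_neg hpop]
  -- the remaining candidates after consuming `c`
  set i' := if f = 0 then s.nv 15 + 1 else s.nv 15 with hi'
  set j' := if f = 0 then s.nv 16 else s.nv 16 + 1 with hj'
  have hR₁ : ivsFrom s₀ 20 i' (s₀.nv 12) ∪ ivsFrom s₀ 22 j' (s₀.nv 13) ⊆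
      ivsFrom s₀ 20 (s.nv 15) (s₀.nv 12) ∪ ivsFrom s₀ 22 (s.nv 16) (s₀.nv 13) := by
    rcases hcase with ⟨rfl, -, -⟩ | ⟨rfl, -, -⟩
    · exact Set.union_subset_union_left _ (ivsFrom_subset_succ _ _ _ _)
    · exact Set.union_subset_union_right _ (ivsFrom_subset_succ _ _ _ _)
  have hR₂ : ivsFrom s₀ 20 (s.nv 15) (s₀.nv 12) ∪ ivsFrom s₀ 22 (s.nv 16) (s₀.nv 13) ⊆
      insert c (ivsFrom s₀ 20 i' (s₀.nv 12) ∪ ivsFrom s₀ 22 j' (s₀.nv 13)) := by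
    rcases hcase with ⟨rfl, -, rfl⟩ | ⟨rfl, -, rfl⟩
    · rw [← Set.insert_union]
      exact Set.union_subset_union_left _ (ivsFrom_subset_insert _ _ _ _)
    · rw [← Set.union_insert]
      exact Set.union_subset_union_right _ (ivsFrom_subset_insert _ _ _ _)
  have hi'j' : i' ≤ s₀.nv 12 ∧ j' ≤ s₀.nv 13 ∧ i' + j' = s.nv 15 + s.nv 16 + 1 := by
    rcases hcase with ⟨rfl, h, -⟩ | ⟨rfl, h, -⟩
    · simp only [hi', hj', if_true]; omega
    · simp only [hi', hj', one_ne_zero, if_false]; omega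
  by_cases hdrop : 0 < s.nv 14 ∧ ¬ s.ra 24 (s.nv 14 - 1) < c.1
  · rw [if_pos hdrop]
    obtain ⟨n, hn⟩ : ∃ n, s.nv 14 = n + 1 := ⟨s.nv 14 - 1, by omega⟩
    have hlt : (ivl s 24 n).2 < c.2 := by
      by_contra h2
      exact hpop ⟨by omega, by rw [hn]; exact h2⟩
    have hinv : StackInv (ivs s₀ 20 (s₀.nv 12) ∪ ivs s₀ 22 (s₀.nv 13)) (ivl s 24) (s.nv 14)
        (ivsFrom s₀ 20 i' (s₀.nv 12) ∪ ivsFrom s₀ 22 j' (s₀.nv 13)) := by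
      rw [hn] at inv hdrop ⊢
      exact inv.drop hlt (not_lt.1 hdrop.2) hR₁ hR₂
    refine ⟨2 * ((s₀.nv 12 - i') + (s₀.nv 13 - j')) + s.nv 14, by omega, ?_⟩
    rcases hcase with ⟨rfl, h, -⟩ | ⟨rfl, h, -⟩ <;>
    · simp only [if_true, if_false, one_ne_zero] at hi' hj'
      rw [hi', hj'] at hinv
      constructor <;>
        simp [hi', hj', nx, ny, x, x', y, y'] <;> first | omega | exact hinv
  · rw [if_neg hdrop]
    have hinv : ∀ Z' : ℕ → ℝ × ℝ, (∀ t < s.nv 14, Z' t = ivl s 24 t) → Z' (s.nv 14) = c →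
        StackInv (ivs s₀ 20 (s₀.nv 12) ∪ ivs s₀ 22 (s₀.nv 13)) Z' (s.nv 14 + 1)
          (ivsFrom s₀ 20 i' (s₀.nv 12) ∪ ivsFrom s₀ 22 j' (s₀.nv 13)) := by
      intro Z' hZ' hZn
      refine inv.push hcR hmin (fun n hn => ?_) hZ' hZn hR₁ hR₂
      constructor
      · by_contra h2
        exact hdrop ⟨by omega, by rw [hn]; exact h2⟩
      · by_contra h2
        exact hpop ⟨by omega, by rw [hn]; exact h2⟩
    refine ⟨2 * ((s₀.nv 12 - i') + (s₀.nv 13 - j')) + (s.nv 14 + 1), by omega, ?_⟩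
    rcases hcase with ⟨rfl, h, -⟩ | ⟨rfl, h, -⟩ <;>
    · simp only [if_true, if_false, one_ne_zero] at hi' hj'
      rw [hi', hj'] at hinv
      constructor <;>
        simp [hi', hj', nx, ny, x, x', y, y'] <;> first | omega | skip
      apply hinv
      · intro t ht
        simp [ivl, ht.ne]
      · simp [ivl]

theorem lin_merge : Lin merge
    (fun m s => WeakAsc s 20 (s.nv 12) ∧ WeakAsc s 22 (s.nv 13) ∧ s.nv 12 + s.nv 13 ≤ m)
    (fun _ s s' => Asc s' 24 (s'.nv 14) ∧ s'.nv 14 ≤ s.nv 12 + s.nv 13 ∧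
      ivs s' 24 (s'.nv 14) = minimals (ivs s 20 (s.nv 12) ∪ ivs s 22 (s.nv 13))) := by
  have h1 : Lin (.seq (.setNat 14 (.const 0)) <| .seq (.setNat 15 (.const 0))
      (.setNat 16 (.const 0)))
      (fun m s => WeakAsc s 20 (s.nv 12) ∧ WeakAsc s 22 (s.nv 13) ∧ s.nv 12 + s.nv 13 ≤ m)
      (fun _ _ s' => s'.nv 14 = 0 ∧ s'.nv 15 = 0 ∧ s'.nv 16 = 0) :=
    Lin.of_run rfl fun m s _ => by simp [Prog.run, State.setNat, NExp.val]
  have h2 : Lin (.loop mergeTest (.seq mergeSelect mergeTreat))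
      (fun m s => WeakAsc s 20 (s.nv 12) ∧ WeakAsc s 22 (s.nv 13) ∧ s.nv 12 + s.nv 13 ≤ m ∧
        s.nv 14 = 0 ∧ s.nv 15 = 0 ∧ s.nv 16 = 0)
      (fun _ s s' => Asc s' 24 (s'.nv 14) ∧ s'.nv 14 ≤ s.nv 12 + s.nv 13 ∧
        ivs s' 24 (s'.nv 14) = minimals (ivs s 20 (s.nv 12) ∪ ivs s 22 (s.nv 13))) := by
    refine Lin.loop rfl 2 (fun _ s₀ k s => MergeInv s₀ k s) ?_ ?_ ?_
    · rintro m s ⟨hX, hY, hm, hz, hi, hj⟩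
      refine ⟨2 * (s.nv 12 + s.nv 13), by omega, ⟨rfl, rfl, rfl, rfl, rfl, rfl, by omega, by omega,
        by omega, by omega, ?_⟩⟩
      rw [hz, hi, hj, ivsFrom_zero, ivsFrom_zero]
      exact ⟨by simp, by simp, subset_rfl, by simp, fun I hI => Or.inr ⟨I, hI, Sub.refl I⟩⟩
    · rintro m s₀ k s ⟨hX, hY, -⟩ h hb
      exact mergeStep_run hX hY h hb
    · rintro m s₀ k s - h hb
      simp only [mergeTest, Test.Holds, NExp.val, not_not, not_lt] at hb
      have hi := h.hi
      have hj := h.hj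
      have hz := h.hz
      rw [h.nx, h.ny] at hb
      have hinv := h.inv
      have hR : ivsFrom s₀ 20 (s.nv 15) (s₀.nv 12) ∪ ivsFrom s₀ 22 (s.nv 16) (s₀.nv 13) = ∅ := by
        refine Set.eq_empty_of_forall_notMem ?_
        rintro _ (⟨t, h1, h2, -⟩ | ⟨t, h1, h2, -⟩) <;> omega
      rw [hR] at hinv
      exact ⟨fun i j hij hj => (hinv.asc i j hij hj).1, by omega, hinv.eq_minimals⟩
  refine (Lin.seq h1 h2 ?_).mono (fun _ _ h => h) ?_
  · rintro m s s' ⟨hX, hY, hm⟩ hf ⟨h14, h15, h16⟩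
    have e12 := hf.nv 12 (by decide)
    have e13 := hf.nv 13 (by decide)
    rw [WeakAsc, WeakAsc, e12, e13, hf.ra 20 (by decide), hf.ra 22 (by decide)]
    exact ⟨hX, hY, hm, h14, h15, h16⟩
  · rintro m s s'' ⟨hX, hY, hm⟩ - ⟨s', hf, -, -, h⟩
    have e12 := hf.nv 12 (by decide)
    have e13 := hf.nv 13 (by decide)
    have h20 : ivs s' 20 (s.nv 12) = ivs s 20 (s.nv 12) := ivs_congr fun i _ => by
      simp only [ivl, hf.ra 20 (by decide), hf.ra (20 + 1) (by decide)]
    have h22 : ivs s' 22 (s.nv 13) = ivs s 22 (s.nv 13) := ivs_congr fun i _ => by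
      simp only [ivl, hf.ra 22 (by decide), hf.ra (22 + 1) (by decide)]
    rwa [e12, e13, h20, h22] at h

end RealRAM

/-! ### The linear-time program for a new root edge. -/

namespace RealRAM

open Rounding

/-! ### Auxiliary facts on stored lists -/

theorem ivs_eq_of_ra {s s' : State} {a n : ℕ} (h : s'.ra a = s.ra a)
    (h' : s'.ra (a + 1) = s.ra (a + 1)) : ivs s' a n = ivs s a n :=
  ivs_congr fun i _ => by simp only [ivl, h, h']

theorem Asc.of_ra {s s' : State} {a n : ℕ} (hA : Asc s a n) (h : s'.ra a = s.ra a) :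
    Asc s' a n := fun i j hij hj => by rw [h]; exact hA i j hij hj

theorem WeakAsc.of_ra {s s' : State} {a n : ℕ} (hA : WeakAsc s a n) (h : s'.ra a = s.ra a) :
    WeakAsc s' a n := fun i j hij hj => by rw [h]; exact hA i j hij hj

theorem ivs_push {s s' : State} {a n : ℕ} {c : ℝ × ℝ} (hold : ∀ i < n, ivl s' a i = ivl s a i)
    (hnew : ivl s' a n = c) : ivs s' a (n + 1) = insert c (ivs s a n) := by
  rw [ivs_succ, hnew, ivs_congr hold]

theorem WeakAsc.push {s s' : State} {a n : ℕ} {c : ℝ × ℝ} (h : WeakAsc s a n)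
    (hold : ∀ i < n, ivl s' a i = ivl s a i) (hnew : ivl s' a n = c)
    (hc : ∀ i < n, s.ra a i ≤ c.1) : WeakAsc s' a (n + 1) := by
  intro i j hij hj
  rcases Nat.lt_succ_iff_lt_or_eq.1 hj with hj | rfl
  · exact h.congr hold i j hij hj
  · have h1 : s'.ra a i = s.ra a i := congrArg Prod.fst (hold i hij)
    have h2 : s'.ra a j = c.1 := congrArg Prod.fst hnew
    rw [h1, h2]
    exact hc i hij

theorem Copied.ivs_eq {a b n : ℕ} {s s' : State} (h : Copied a b 0 0 n s s') :
    ivs s' b n = ivs s a n :=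
  ivs_congr fun i hi => by simpa using h.new i hi

theorem Copied.asc {a b n : ℕ} {s s' : State} (h : Copied a b 0 0 n s s') (hA : Asc s a n) :
    Asc s' b n :=
  hA.congr fun i hi => by simpa using h.new i hi

/-- Store the smaller one of two numbers. -/
def putMin (a : ℕ) (i : NExp) (e f : RExp) : Prog :=
  .cond (.realLt e f) (.putReal a i e) (.putReal a i f)

/-- Store the larger one of two numbers. -/
def putMax (a : ℕ) (i : NExp) (e f : RExp) : Prog :=
  .cond (.realLt e f) (.putReal a i f) (.putReal a i e)

theorem putMin_run (a : ℕ) (i : NExp) (e f : RExp) (s : State) :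
    (putMin a i e f).run s = s.putReal a (i.val s) (min (e.val s) (f.val s)) := by
  by_cases h : e.val s < f.val s
  · rw [min_eq_left h.le]
    exact if_pos h
  · rw [min_eq_right (not_lt.1 h)]
    exact if_neg h

theorem putMax_run (a : ℕ) (i : NExp) (e f : RExp) (s : State) :
    (putMax a i e f).run s = s.putReal a (i.val s) (max (e.val s) (f.val s)) := by
  by_cases h : e.val s < f.val s
  · rw [max_eq_right h.le]
    exact if_pos h
  · rw [max_eq_left (not_lt.1 h)]
    exact if_neg h

/-! ### Adding a root edge -/

/-- The shifted interval is admissible. -/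
def shiftTest : Test :=
  .and (.not (.realLt (.add (.var 2) (.var 1)) (.ofNat (.const 0)))) <|
  .and (.realLt (.sub (.ofNat (.const 0)) (.var 0)) (.add (.var 2) (.get 10 (.var 15))))
    (.realLt (.add (.var 2) (.get 11 (.var 15))) (.var 0))

/-- Store one shifted interval. -/
def shiftPush : Prog :=
  .seq (putMin 22 (.var 13) (.ofNat (.const 0)) (.add (.var 2) (.get 10 (.var 15)))) <|
  .seq (putMax 23 (.var 13) (.ofNat (.const 0)) (.add (.var 2) (.get 11 (.var 15)))) <|
  .setNat 13 (.add (.var 13) (.const 1))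

/-- Shift all intervals in arrays `10`, `11` by the real variable `2`, into arrays `22`, `23`. -/
def shiftGen : Prog :=
  .seq (.seq (.setNat 13 (.const 0)) (.setNat 15 (.const 0))) <|
  .loop (.natLt (.var 15) (.var 10)) <|
  .seq (.cond shiftTest shiftPush .skip) (.setNat 15 (.add (.var 15) (.const 1)))

theorem shiftPush_run (s : State) : shiftPush.run s =
    { nv := Function.update s.nv 13 (s.nv 13 + 1)
      rv := s.rv
      na := s.na
      ra := Function.update (Function.update s.ra 22 (Function.update (s.ra 22) (s.nv 13)
        (shift (s.rv 2) (ivl s 10 (s.nv 15))).1)) 23 (Function.update (s.ra 23) (s.nv 13)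
        (shift (s.rv 2) (ivl s 10 (s.nv 15))).2) } := by
  simp [shiftPush, Prog.run, putMin_run, putMax_run, NExp.val, RExp.val, State.setNat,
    State.putReal, shift, ivl]

theorem shiftTest_holds (s : State) : shiftTest.Holds s ↔
    0 ≤ s.rv 2 + s.rv 1 ∧ ShiftOK (s.rv 0) (s.rv 2) (ivl s 10 (s.nv 15)) := by
  simp [shiftTest, Test.Holds, RExp.val, NExp.val, ShiftOK, ivl]

/-- The invariant of the shifting loop. -/
structure ShiftInv (s₀ : State) (k : ℕ) (s : State) : Prop where
  n : s.nv 10 = s₀.nv 10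
  rv : s.rv = s₀.rv
  p : s.ra 10 = s₀.ra 10
  p' : s.ra 11 = s₀.ra 11
  hk : s.nv 15 + k = s₀.nv 10
  hn : s.nv 13 ≤ s.nv 15
  asc : WeakAsc s 22 (s.nv 13)
  low : ∀ t < s.nv 13, ∀ i, s.nv 15 ≤ i → i < s₀.nv 10 →
    s.ra 22 t ≤ (shift (s₀.rv 2) (ivl s₀ 10 i)).1
  set : ivs s 22 (s.nv 13) = shiftCands (s₀.rv 0) (s₀.rv 1) (s₀.rv 2) (ivs s₀ 10 (s.nv 15))

theorem shiftCands_insert (ε x d : ℝ) (I : ℝ × ℝ) (L : Set (ℝ × ℝ)) :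
    shiftCands ε x d (insert I L) =
      {J | (0 ≤ d + x ∧ ShiftOK ε d I) ∧ J = shift d I} ∪ shiftCands ε x d L := by
  ext J
  constructor
  · rintro ⟨h, I', rfl | hI', hok, rfl⟩
    · exact Or.inl ⟨⟨h, hok⟩, rfl⟩
    · exact Or.inr ⟨h, I', hI', hok, rfl⟩
  · rintro (⟨⟨h, hok⟩, rfl⟩ | ⟨h, I', hI', hok, rfl⟩)
    · exact ⟨h, I, Or.inl rfl, hok, rfl⟩
    · exact ⟨h, I', Or.inr hI', hok, rfl⟩

/-- For a fixed edge error, shifting is monotone in the lower bound, so the output is produced in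
sorted order. It is sorted only weakly, because the minimum with `0` can identify different lower
bounds. -/
theorem shiftStep_run {s₀ s : State} {k : ℕ} (hP : Asc s₀ 10 (s₀.nv 10)) (h : ShiftInv s₀ k s)
    (hb : s.nv 15 < s.nv 10) : ∃ k' < k, ShiftInv s₀ k'
      ((Prog.seq (.cond shiftTest shiftPush .skip) (.setNat 15 (.add (.var 15) (.const 1)))).run s) := by
  obtain ⟨n, rv, p, p', hk, hn, asc, low, set⟩ := h
  have hivl : ivl s 10 (s.nv 15) = ivl s₀ 10 (s.nv 15) := by simp only [ivl, p, p']
  have hmono : ∀ i, s.nv 15 + 1 ≤ i → i < s₀.nv 10 →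
      (shift (s₀.rv 2) (ivl s₀ 10 (s.nv 15))).1 ≤ (shift (s₀.rv 2) (ivl s₀ 10 i)).1 := by
    intro i hi hi'
    have := hP (s.nv 15) i (by omega) hi'
    exact min_le_min le_rfl (by simp only [ivl]; linarith)
  refine ⟨k - 1, by omega, ?_⟩
  have hcands := shiftCands_insert (s₀.rv 0) (s₀.rv 1) (s₀.rv 2) (ivl s₀ 10 (s.nv 15))
    (ivs s₀ 10 (s.nv 15))
  have htest := shiftTest_holds s
  simp only [hivl, rv] at htest
  simp only [Prog.run, shiftPush_run, hivl, rv]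
  split_ifs with hc <;> rw [htest] at hc
  · have hset : shiftCands (s₀.rv 0) (s₀.rv 1) (s₀.rv 2) (ivs s₀ 10 (s.nv 15 + 1)) =
        insert (shift (s₀.rv 2) (ivl s₀ 10 (s.nv 15))) (ivs s 22 (s.nv 13)) := by
      rw [ivs_succ, hcands, set, Set.insert_eq]
      congr 1
      ext J
      simp [hc.1, hc.2]
    simp only [State.setNat, NExp.val, ne_eq, Nat.reduceEqDiff, not_false_eq_true,
      Function.update_of_ne]
    set s' : State := State.mk _ _ _ _ with hs'
    have hold : ∀ i < s.nv 13, ivl s' 22 i = ivl s 22 i := by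
      intro i hi
      simp [hs', ivl, hi.ne]
    have hnew : ivl s' 22 (s.nv 13) = shift (s₀.rv 2) (ivl s₀ 10 (s.nv 15)) := by
      simp [hs', ivl]
    have e13 : s'.nv 13 = s.nv 13 + 1 := by simp [hs']
    have e15 : s'.nv 15 = s.nv 15 + 1 := by simp [hs']
    constructor
    · simpa [hs'] using n
    · rfl
    · simpa [hs'] using p
    · simpa [hs'] using p'
    · omega
    · omega
    · rw [e13]
      exact asc.push hold hnew fun i hi => low i hi _ le_rfl (by omega)
    · rw [e13, e15]
      intro t ht i hi hi'
      rcases Nat.lt_succ_iff_lt_or_eq.1 ht with ht | rfl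
      · have : s'.ra 22 t = s.ra 22 t := congrArg Prod.fst (hold t ht)
        rw [this]
        exact low t ht i (by omega) hi'
      · have : s'.ra 22 (s.nv 13) = _ := congrArg Prod.fst hnew
        rw [this]
        exact hmono i hi hi'
    · rw [e13, e15, hset]
      exact ivs_push hold hnew
  · have hset : shiftCands (s₀.rv 0) (s₀.rv 1) (s₀.rv 2) (ivs s₀ 10 (s.nv 15 + 1)) =
        ivs s 22 (s.nv 13) := by
      rw [ivs_succ, hcands, set]
      convert Set.empty_union _
      ext J
      exact iff_of_false (fun h => hc h.1) (Set.notMem_empty J)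
    simp only [State.setNat, NExp.val]
    constructor <;> simp only [Function.update_self, ne_eq, Nat.reduceEqDiff, not_false_eq_true,
      Function.update_of_ne]
    · exact n
    · exact rv
    · exact p
    · exact p'
    · omega
    · omega
    · exact asc
    · exact fun t ht i hi hi' => low t ht i (by omega) hi'
    · exact hset.symm

theorem lin_shiftGen : Lin shiftGen
    (fun m s => Asc s 10 (s.nv 10) ∧ s.nv 10 ≤ m)
    (fun _ s s' => WeakAsc s' 22 (s'.nv 13) ∧ s'.nv 13 ≤ s.nv 10 ∧
      ivs s' 22 (s'.nv 13) = shiftCands (s.rv 0) (s.rv 1) (s.rv 2) (ivs s 10 (s.nv 10))) := by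
  have h1 : Lin (.seq (.setNat 13 (.const 0)) (.setNat 15 (.const 0)))
      (fun m s => Asc s 10 (s.nv 10) ∧ s.nv 10 ≤ m)
      (fun _ _ s' => s'.nv 13 = 0 ∧ s'.nv 15 = 0) :=
    Lin.of_run rfl fun m s _ => by simp [Prog.run, State.setNat, NExp.val]
  have h2 : Lin (.loop (.natLt (.var 15) (.var 10)) <|
      .seq (.cond shiftTest shiftPush .skip) (.setNat 15 (.add (.var 15) (.const 1))))
      (fun m s => Asc s 10 (s.nv 10) ∧ s.nv 10 ≤ m ∧ s.nv 13 = 0 ∧ s.nv 15 = 0)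
      (fun _ s s' => WeakAsc s' 22 (s'.nv 13) ∧ s'.nv 13 ≤ s.nv 10 ∧
        ivs s' 22 (s'.nv 13) = shiftCands (s.rv 0) (s.rv 1) (s.rv 2) (ivs s 10 (s.nv 10))) := by
    refine Lin.loop rfl 1 (fun _ s₀ k s => ShiftInv s₀ k s) ?_ ?_ ?_
    · rintro m s ⟨hP, hm, h13, h15⟩
      refine ⟨s.nv 10, by omega, ⟨rfl, rfl, rfl, rfl, by omega, by omega, ?_, ?_, ?_⟩⟩
      · rw [h13]; intro i j _ hj; omega
      · rw [h13]; intro t ht; omega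
      · rw [h13, h15, ivs_zero, ivs_zero]
        ext J; simp [shiftCands]
    · rintro m s₀ k s ⟨hP, -⟩ h hb
      exact shiftStep_run hP h hb
    · rintro m s₀ k s - h hb
      simp only [Test.Holds, NExp.val, not_lt, h.n] at hb
      have hk := h.hk
      have hn := h.hn
      have h15 : s.nv 15 = s₀.nv 10 := by omega
      exact ⟨h.asc, by omega, h15 ▸ h.set⟩
  refine (Lin.seq h1 h2 ?_).mono (fun _ _ h => h) ?_
  · rintro m s s' ⟨hP, hm⟩ hf ⟨h13, h15⟩
    have e10 := hf.nv 10 (by decide)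
    rw [e10]
    exact ⟨hP.of_ra (hf.ra 10 (by decide)), hm, h13, h15⟩
  · rintro m s s'' - - ⟨s', hf, -, -, h⟩
    rwa [hf.nv 10 (by decide), hf.rv 0 (by decide), hf.rv 1 (by decide), hf.rv 2 (by decide),
      ivs_eq_of_ra (hf.ra 10 (by decide)) (hf.ra (10 + 1) (by decide))] at h

/-- Add the intervals for one edge error to the list in arrays `20`, `21`. -/
def shiftRound : Prog :=
  .seq shiftGen <| .seq merge <| .seq (copy 24 20 (.const 0) (.const 0) (.var 14)) <|
  .seq (.setNat 12 (.var 14)) (.setReal 2 (.add (.var 2) (.ofNat (.const 1))))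

theorem lin_shiftRound : Lin shiftRound
    (fun m s => Asc s 10 (s.nv 10) ∧ Asc s 20 (s.nv 12) ∧ s.nv 10 + s.nv 12 ≤ m)
    (fun _ s s' => Asc s' 20 (s'.nv 12) ∧ s'.nv 12 ≤ s.nv 12 + s.nv 10 ∧
      ivs s' 20 (s'.nv 12) = minimals (ivs s 20 (s.nv 12) ∪
        shiftCands (s.rv 0) (s.rv 1) (s.rv 2) (ivs s 10 (s.nv 10))) ∧
      s'.rv 2 = s.rv 2 + 1) := by
  have hlast : Lin (.seq (.setNat 12 (.var 14)) (.setReal 2 (.add (.var 2) (.ofNat (.const 1)))))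
      (fun _ _ => True) (fun _ s s' => s'.nv 12 = s.nv 14 ∧ s'.rv 2 = s.rv 2 + 1) :=
    Lin.of_run rfl fun m s _ => by
      simp [Prog.run, State.setNat, State.setReal, NExp.val, RExp.val]
  refine (Lin.seq (lin_shiftGen.mono (Post' := fun _ s s' => WeakAsc s' 22 (s'.nv 13) ∧
      s'.nv 13 ≤ s.nv 10 ∧ ivs s' 22 (s'.nv 13) =
        shiftCands (s.rv 0) (s.rv 1) (s.rv 2) (ivs s 10 (s.nv 10))) (Pre' := fun m s =>
      Asc s 10 (s.nv 10) ∧ Asc s 20 (s.nv 12) ∧ s.nv 10 + s.nv 12 ≤ m)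
      (fun m s h => ⟨h.1, by omega⟩) (fun _ _ _ _ _ h => h))
    (Lin.seq lin_merge (Lin.seq (lin_copy 24 20 (os := .const 0) (od := .const 0) (cnt := .var 14)
      (by norm_num) (by norm_num) (by norm_num) (NExp.stable_const 0)
      (NExp.stable_var (by norm_num))) hlast ?_) ?_) ?_).mono (fun _ _ h => h) ?_
  · exact fun _ _ _ _ _ _ => trivial
  · rintro m s s' ⟨h1, h2, h3⟩ hf ⟨-, h, -⟩
    simp only [NExp.val]
    omega
  · rintro m s s' ⟨h1, h2, h3⟩ hf ⟨g1, g2, g3⟩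
    have e12 := hf.nv 12 (by decide)
    rw [e12]
    exact ⟨h2.weakAsc.of_ra (hf.ra 20 (by decide)), g1, by omega⟩
  · rintro m s s₄ ⟨h1, h2, h3⟩ - ⟨s₁, f₁, ⟨g1, g2, g3⟩, -, s₂, f₂, ⟨k1, k2, k3⟩, -, s₃, f₃, hc, f₄,
      l1, l2⟩
    have e14 : s₃.nv 14 = s₂.nv 14 := f₃.nv 14 (by decide)
    have e12 : s₁.nv 12 = s.nv 12 := f₁.nv 12 (by decide)
    have hc' : Copied 24 20 0 0 (s₂.nv 14) s₂ s₃ := hc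
    rw [l1, e14, l2, f₃.rv 2 (by decide), f₂.rv 2 (by decide), f₁.rv 2 (by decide),
      ivs_eq_of_ra (f₄.ra 20 (by decide)) (f₄.ra (20 + 1) (by decide)), hc'.ivs_eq, k3, g3, e12,
      ivs_eq_of_ra (f₁.ra 20 (by decide)) (f₁.ra (20 + 1) (by decide))]
    exact ⟨(hc'.asc k1).of_ra (f₄.ra 20 (by decide)), by omega, rfl, rfl⟩

/-- Compute the error range set, into arrays `20`, `21`, after adding to a tree with error range
set in arrays `10`, `11` a new root edge with weight in the real variable `1`. -/
def shiftCore : Prog :=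
  .seq (.seq (.floor 30 (.var 1)) <| .seq (.setReal 2 (.sub (.sub (.ofNat (.var 30))
    (.ofNat (.const 1))) (.var 1))) (.setNat 12 (.const 0))) <|
  .seq shiftRound <| .seq shiftRound <| .seq shiftRound shiftRound

theorem shiftCands_finite (ε x d : ℝ) {L : Set (ℝ × ℝ)} (hL : L.Finite) :
    (shiftCands ε x d L).Finite := by
  refine (hL.image (shift d)).subset ?_
  rintro J ⟨-, I, hI, -, rfl⟩
  exact ⟨I, hI, rfl⟩

theorem lin_shiftCore : Lin shiftCore
    (fun m s => Asc s 10 (s.nv 10) ∧ s.nv 10 ≤ m)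
    (fun _ s s' => Asc s' 20 (s'.nv 12) ∧ s'.nv 12 ≤ 4 * s.nv 10 ∧
      ∀ R, 0 ≤ s.rv 1 → Admissible (s.rv 0) R → Admissible (s.rv 0) (shiftSet (s.rv 0) (s.rv 1) R) →
        ivs s 10 (s.nv 10) = minimals R →
        ivs s' 20 (s'.nv 12) = minimals (shiftSet (s.rv 0) (s.rv 1) R)) := by
  have h1 : Lin (.seq (.floor 30 (.var 1)) <| .seq (.setReal 2 (.sub (.sub (.ofNat (.var 30))
      (.ofNat (.const 1))) (.var 1))) (.setNat 12 (.const 0)))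
      (fun m s => Asc s 10 (s.nv 10) ∧ 4 * s.nv 10 ≤ 4 * m)
      (fun _ s s' => s'.rv 2 = ⌊s.rv 1⌋₊ - 1 - s.rv 1 ∧ s'.nv 12 = 0) :=
    Lin.of_run rfl fun m s _ => by
      simp [Prog.run, State.setNat, State.setReal, NExp.val, RExp.val]
  -- Each of the four rounds adds at most `s.nv 10` intervals, so before every round the two lists
  -- together have at most `4 * s.nv 10` elements.
  have h4 := lin_shiftRound.scale 4
  refine (Lin.seq h1 (Lin.seq (h4.mono (Pre' := fun m s => Asc s 10 (s.nv 10) ∧ s.nv 12 = 0 ∧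
    4 * s.nv 10 ≤ 4 * m) ?_ fun _ _ _ _ _ h => h) (Lin.seq (h4.mono (Pre' := fun m s =>
    Asc s 10 (s.nv 10) ∧ Asc s 20 (s.nv 12) ∧ s.nv 12 ≤ s.nv 10 ∧ 4 * s.nv 10 ≤ 4 * m) ?_
    fun _ _ _ _ _ h => h) (Lin.seq (h4.mono (Pre' := fun m s => Asc s 10 (s.nv 10) ∧
    Asc s 20 (s.nv 12) ∧ s.nv 12 ≤ 2 * s.nv 10 ∧ 4 * s.nv 10 ≤ 4 * m) ?_ fun _ _ _ _ _ h => h)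
    h4 ?_) ?_) ?_) ?_).mono (fun m s h => ⟨h.1, by omega⟩) ?_
  · rintro m s ⟨h1, h2, h3⟩
    refine ⟨h1, ?_, by omega⟩
    rw [h2]; intro i j _ hj; omega
  · rintro m s ⟨h1, h2, h3, h4⟩
    exact ⟨h1, h2, by omega⟩
  · rintro m s ⟨h1, h2, h3, h4⟩
    exact ⟨h1, h2, by omega⟩
  · rintro m s s' ⟨h1, h2, h3, h4⟩ hf ⟨g1, g2, -⟩
    have e10 := hf.nv 10 (by decide)
    rw [e10]
    exact ⟨h1.of_ra (hf.ra 10 (by decide)), g1, by omega⟩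
  · rintro m s s' ⟨h1, h2, h3, h4⟩ hf ⟨g1, g2, -⟩
    have e10 := hf.nv 10 (by decide)
    rw [e10]
    exact ⟨h1.of_ra (hf.ra 10 (by decide)), g1, by omega, by omega⟩
  · rintro m s s' ⟨h1, h2, h3⟩ hf ⟨g1, g2, -⟩
    have e10 := hf.nv 10 (by decide)
    rw [e10]
    exact ⟨h1.of_ra (hf.ra 10 (by decide)), g1, by omega, by omega⟩
  · rintro m s s' ⟨h1, h2⟩ hf ⟨-, g⟩
    have e10 := hf.nv 10 (by decide)
    rw [e10]
    exact ⟨h1.of_ra (hf.ra 10 (by decide)), g, by omega⟩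
  · rintro m s s₅ ⟨hP, -⟩ - ⟨s₁, f₁, ⟨a1, a2⟩, -, s₂, f₂, ⟨b1, b2, b3, b4⟩, -, s₃, f₃,
      ⟨c1, c2, c3, c4⟩, -, s₄, f₄, ⟨d1, d2, d3, d4⟩, -, e1, e2, e3, -⟩
    have k1 := f₁.nv 10 (by decide)
    have k2 := (f₂.nv 10 (by decide)).trans k1
    have k3 := (f₃.nv 10 (by decide)).trans k2
    have k4 := (f₄.nv 10 (by decide)).trans k3
    refine ⟨e1, by omega, fun R hx hR hR' hs => ?_⟩
    have x1 := f₁.rv 1 (by decide)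
    have x2 := (f₂.rv 1 (by decide)).trans x1
    have x3 := (f₃.rv 1 (by decide)).trans x2
    have x4 := (f₄.rv 1 (by decide)).trans x3
    have y1 := f₁.rv 0 (by decide)
    have y2 := (f₂.rv 0 (by decide)).trans y1
    have y3 := (f₃.rv 0 (by decide)).trans y2
    have y4 := (f₄.rv 0 (by decide)).trans y3
    have z1 : ivs s₁ 10 (s.nv 10) = minimals R := by
      rw [← hs]; exact ivs_eq_of_ra (f₁.ra 10 (by decide)) (f₁.ra (10 + 1) (by decide))
    have z2 : ivs s₂ 10 (s.nv 10) = minimals R := by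
      rw [← z1]; exact ivs_eq_of_ra (f₂.ra 10 (by decide)) (f₂.ra (10 + 1) (by decide))
    have z3 : ivs s₃ 10 (s.nv 10) = minimals R := by
      rw [← z2]; exact ivs_eq_of_ra (f₃.ra 10 (by decide)) (f₃.ra (10 + 1) (by decide))
    have z4 : ivs s₄ 10 (s.nv 10) = minimals R := by
      rw [← z3]; exact ivs_eq_of_ra (f₄.ra 10 (by decide)) (f₄.ra (10 + 1) (by decide))
    have hfin : (minimals R).Finite := hR.finite.subset (minimals_subset R)
    have hC := fun d => shiftCands_finite (s.rv 0) (s.rv 1) d hfin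
    -- The nested pruning of the four rounds collapses to the minimal elements of the union of the
    -- four candidate sets.
    rw [e3, d3, c3, b3, a2, ivs_zero, Set.empty_union, k1, k2, k3, k4, x1, x2, x3, x4, y1, y2, y3,
      y4, z1, z2, z3, z4, d4, c4, b4, minimals_minimals_union (hC _),
      minimals_minimals_union ((hC _).union (hC _)),
      minimals_minimals_union (((hC _).union (hC _)).union (hC _))]
    exact minimals_shiftSet hx hR hR' _ a1

end RealRAM

/-! ### The linear-time program for a union of two trees. -/

namespace RealRAM

open Rounding

/-! ### Merging two trees at the root -/

/-- One step of `upPass`. -/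
def upStep : Prog :=
  .cond (.and (.natLt (.var 16) (.var 11)) (.realLt (.get 12 (.var 16)) (.get 10 (.var 15))))
    (.setNat 16 (.add (.var 16) (.const 1)))
    (.seq (.putNat 10 (.var 15) (.var 16)) (.setNat 15 (.add (.var 15) (.const 1))))

/-- For each interval in arrays `10`, `11`, count the intervals in arrays `12`, `13` with smaller
lower bound. -/
def upPass : Prog :=
  .seq (.seq (.setNat 15 (.const 0)) (.setNat 16 (.const 0))) <|
  .loop (.natLt (.var 15) (.var 10)) upStep

/-- The result of `upPass`. -/
def UpCount (s : State) (lo : ℕ) (hi : ℕ) : Prop :=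
  ∀ i, lo ≤ i → i < hi → ∀ t < s.nv 11, t < s.na 10 i ↔ s.ra 12 t < s.ra 10 i

/-- The result of `downPass`. -/
def DownCount (s : State) (lo : ℕ) (hi : ℕ) : Prop :=
  ∀ i, lo ≤ i → i < hi → ∀ t < s.nv 11, t < s.na 11 i ↔ s.ra 12 t ≤ -s.rv 0 - s.ra 10 i

/-- As the lower bounds in the first list grow, so do the counts, and the pointer `16` into the
second list never moves back. Each iteration advances one of the two pointers. -/
theorem lin_upPass : Lin upPass
    (fun m s => Asc s 10 (s.nv 10) ∧ Asc s 12 (s.nv 11) ∧ s.nv 10 + s.nv 11 ≤ m)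
    (fun _ _ s' => UpCount s' 0 (s'.nv 10)) := by
  have h1 : Lin (.seq (.setNat 15 (.const 0)) (.setNat 16 (.const 0)))
      (fun m s => Asc s 10 (s.nv 10) ∧ Asc s 12 (s.nv 11) ∧ s.nv 10 + s.nv 11 ≤ m)
      (fun m _ s => Asc s 10 (s.nv 10) ∧ Asc s 12 (s.nv 11) ∧ s.nv 10 + s.nv 11 ≤ m ∧
        s.nv 15 = 0 ∧ s.nv 16 = 0) :=
    Lin.of_run rfl fun m s h => by simpa [Prog.run, State.setNat, NExp.val, Asc] using h
  have h2 : Lin (.loop (.natLt (.var 15) (.var 10)) upStep)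
      (fun m s => Asc s 10 (s.nv 10) ∧ Asc s 12 (s.nv 11) ∧ s.nv 10 + s.nv 11 ≤ m ∧
        s.nv 15 = 0 ∧ s.nv 16 = 0)
      (fun _ _ s' => UpCount s' 0 (s'.nv 10)) := by
    refine Lin.loop rfl 1 (fun _ s₀ k s => Asc s 10 (s.nv 10) ∧ Asc s 12 (s.nv 11) ∧
      s.nv 15 ≤ s.nv 10 ∧ s.nv 16 ≤ s.nv 11 ∧ k = (s.nv 10 - s.nv 15) + (s.nv 11 - s.nv 16) ∧
      (∀ t < s.nv 16, ∀ i, s.nv 15 ≤ i → i < s.nv 10 → s.ra 12 t < s.ra 10 i) ∧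
      UpCount s 0 (s.nv 15)) ?_ ?_ ?_
    · rintro m s ⟨hP, hQ, hm, h15, h16⟩
      refine ⟨_, ?_, hP, hQ, by omega, by omega, rfl, ?_, ?_⟩
      · omega
      · rw [h16]; intro t ht; omega
      · rw [h15]; intro i _ hi; omega
    · rintro m s₀ k s - ⟨hP, hQ, hi, hj, hk, hlow, hup⟩ hb
      simp only [Test.Holds, NExp.val] at hb
      refine ⟨k - 1, by omega, ?_⟩
      by_cases hc : s.nv 16 < s.nv 11 ∧ s.ra 12 (s.nv 16) < s.ra 10 (s.nv 15)
      · have hrun : upStep.run s = s.setNat 16 (s.nv 16 + 1) := if_pos hc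
        rw [hrun]
        simp only [State.setNat, Asc, UpCount, Function.update_self, ne_eq, Nat.reduceEqDiff,
          not_false_eq_true, Function.update_of_ne]
        refine ⟨hP, hQ, hi, by omega, by omega, ?_, hup⟩
        intro t ht i hi hi'
        have h1 : s.ra 12 t ≤ s.ra 12 (s.nv 16) := hQ.weakAsc.le (by omega) hc.1
        have h2 : s.ra 10 (s.nv 15) ≤ s.ra 10 i := hP.weakAsc.le hi hi'
        exact (h1.trans_lt hc.2).trans_le h2
      · have hrun : upStep.run s = (s.putNat 10 (s.nv 15) (s.nv 16)).setNat 15 (s.nv 15 + 1) :=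
          if_neg hc
        rw [hrun]
        simp only [State.setNat, State.putNat, Asc, UpCount, Function.update_self, ne_eq,
          Nat.reduceEqDiff, not_false_eq_true, Function.update_of_ne]
        refine ⟨hP, hQ, by omega, hj, by omega, fun t ht i hi hi' => hlow t ht i (by omega) hi', ?_⟩
        intro i _ hi' t ht
        rcases Nat.lt_succ_iff_lt_or_eq.1 hi' with hi' | rfl
        · rw [Function.update_of_ne hi'.ne]
          exact hup i (Nat.zero_le _) hi' t ht
        · rw [Function.update_self]
          refine ⟨fun h => hlow t h _ le_rfl hb, fun h => ?_⟩
          by_contra h3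
          have h4 : s.ra 12 (s.nv 16) ≤ s.ra 12 t := hQ.weakAsc.le (by omega) ht
          exact hc ⟨by omega, h4.trans_lt h⟩
    · rintro m s₀ k s - ⟨hP, hQ, hi, hj, hk, hlow, hup⟩ hb
      simp only [Test.Holds, NExp.val] at hb
      rwa [show s.nv 15 = s.nv 10 by omega] at hup
  refine (Lin.seq h1 h2 fun _ _ _ _ _ h => h).mono (fun _ _ h => h) ?_
  rintro m s s' - - ⟨_, -, -, -, h⟩
  exact h

/-- One step of `downPass`. -/
def downStep : Prog :=
  .cond (.and (.natLt (.var 16) (.var 11)) (.not (.realLt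
      (.sub (.sub (.ofNat (.const 0)) (.var 0)) (.get 10 (.sub (.var 15) (.const 1))))
      (.get 12 (.var 16)))))
    (.setNat 16 (.add (.var 16) (.const 1)))
    (.seq (.putNat 11 (.sub (.var 15) (.const 1)) (.var 16))
      (.setNat 15 (.sub (.var 15) (.const 1))))

/-- For each interval in arrays `10`, `11`, count the intervals in arrays `12`, `13` with too small
sum of lower bounds. -/
def downPass : Prog :=
  .seq (.seq (.setNat 15 (.var 10)) (.setNat 16 (.const 0))) <|
  .loop (.natLt (.const 0) (.var 15)) downStep

/-- The threshold `-ε - I.1` decreases in `I.1`. The first list is therefore traversed from its end,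
which again lets the pointer into the second list only move forward. -/
theorem lin_downPass : Lin downPass
    (fun m s => Asc s 10 (s.nv 10) ∧ Asc s 12 (s.nv 11) ∧ s.nv 10 + s.nv 11 ≤ m)
    (fun _ _ s' => DownCount s' 0 (s'.nv 10)) := by
  have h1 : Lin (.seq (.setNat 15 (.var 10)) (.setNat 16 (.const 0)))
      (fun m s => Asc s 10 (s.nv 10) ∧ Asc s 12 (s.nv 11) ∧ s.nv 10 + s.nv 11 ≤ m)
      (fun m _ s => Asc s 10 (s.nv 10) ∧ Asc s 12 (s.nv 11) ∧ s.nv 10 + s.nv 11 ≤ m ∧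
        s.nv 15 = s.nv 10 ∧ s.nv 16 = 0) :=
    Lin.of_run rfl fun m s h => by simpa [Prog.run, State.setNat, NExp.val, Asc] using h
  have h2 : Lin (.loop (.natLt (.const 0) (.var 15)) downStep)
      (fun m s => Asc s 10 (s.nv 10) ∧ Asc s 12 (s.nv 11) ∧ s.nv 10 + s.nv 11 ≤ m ∧
        s.nv 15 = s.nv 10 ∧ s.nv 16 = 0)
      (fun _ _ s' => DownCount s' 0 (s'.nv 10)) := by
    refine Lin.loop rfl 1 (fun _ s₀ k s => Asc s 10 (s.nv 10) ∧ Asc s 12 (s.nv 11) ∧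
      s.nv 15 ≤ s.nv 10 ∧ s.nv 16 ≤ s.nv 11 ∧ k = s.nv 15 + (s.nv 11 - s.nv 16) ∧
      (∀ t < s.nv 16, ∀ i < s.nv 15, s.ra 12 t ≤ -s.rv 0 - s.ra 10 i) ∧
      DownCount s (s.nv 15) (s.nv 10)) ?_ ?_ ?_
    · rintro m s ⟨hP, hQ, hm, h15, h16⟩
      refine ⟨_, ?_, hP, hQ, by omega, by omega, rfl, ?_, ?_⟩
      · omega
      · rw [h16]; intro t ht; omega
      · rw [h15]; intro i h hi; omega
    · rintro m s₀ k s - ⟨hP, hQ, hi, hj, hk, hlow, hdown⟩ hb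
      simp only [Test.Holds, NExp.val] at hb
      refine ⟨k - 1, by omega, ?_⟩
      obtain ⟨n, hn⟩ : ∃ n, s.nv 15 = n + 1 := ⟨s.nv 15 - 1, by omega⟩
      by_cases hc : s.nv 16 < s.nv 11 ∧
          ¬ (((0 : ℕ) : ℝ) - s.rv 0) - s.ra 10 (s.nv 15 - 1) < s.ra 12 (s.nv 16)
      · have hrun : downStep.run s = s.setNat 16 (s.nv 16 + 1) := if_pos hc
        have hc2 := not_lt.1 hc.2
        rw [Nat.cast_zero, zero_sub, hn, Nat.add_sub_cancel] at hc2
        rw [hrun]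
        simp only [State.setNat, Asc, DownCount, Function.update_self, ne_eq, Nat.reduceEqDiff,
          not_false_eq_true, Function.update_of_ne]
        refine ⟨hP, hQ, hi, by omega, by omega, ?_, hdown⟩
        intro t ht i hi'
        have h1 : s.ra 12 t ≤ s.ra 12 (s.nv 16) := hQ.weakAsc.le (by omega) hc.1
        have h2 : s.ra 10 i ≤ s.ra 10 n := hP.weakAsc.le (by omega) (by omega)
        linarith
      · have hrun : downStep.run s =
            (s.putNat 11 (s.nv 15 - 1) (s.nv 16)).setNat 15 (s.nv 15 - 1) := if_neg hc
        rw [hrun]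
        simp only [State.setNat, State.putNat, Asc, DownCount, Function.update_self, ne_eq,
          Nat.reduceEqDiff, not_false_eq_true, Function.update_of_ne]
        refine ⟨hP, hQ, by omega, hj, by omega, fun t ht i hi' => hlow t ht i (by omega), ?_⟩
        intro i hi1 hi' t ht
        by_cases hin : i = n
        · subst hin
          rw [show s.nv 15 - 1 = i by omega, Function.update_self]
          refine ⟨fun h => hlow t h _ (by omega), fun h => ?_⟩
          by_contra h3
          have h4 : s.ra 12 (s.nv 16) ≤ s.ra 12 t := hQ.weakAsc.le (by omega) ht
          refine hc ⟨by omega, ?_⟩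
          rw [Nat.cast_zero, zero_sub, hn, Nat.add_sub_cancel, not_lt]
          exact h4.trans h
        · rw [Function.update_of_ne (by omega)]
          exact hdown i (by omega) hi' t ht
    · rintro m s₀ k s - ⟨hP, hQ, hi, hj, hk, hlow, hdown⟩ hb
      simp only [Test.Holds, NExp.val] at hb
      rwa [show s.nv 15 = 0 by omega] at hdown
  refine (Lin.seq h1 h2 fun _ _ _ _ _ h => h).mono (fun _ _ h => h) ?_
  rintro m s s' - - ⟨_, -, -, -, h⟩
  exact h

/-- The larger one of the two counts. -/
def joinIndex : Prog :=
  .cond (.natLt (.get 10 (.var 15)) (.get 11 (.var 15)))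
    (.setNat 16 (.get 11 (.var 15))) (.setNat 16 (.get 10 (.var 15)))

/-- The candidate is admissible. -/
def joinTest : Test :=
  .and (.natLt (.var 16) (.var 11)) (.realLt (.add (.get 11 (.var 15)) (.get 13 (.var 16))) (.var 0))

/-- Store a candidate. -/
def joinPush : Prog :=
  .seq (.putReal 22 (.var 13) (.get 10 (.var 15))) <|
  .seq (putMax 23 (.var 13) (.get 11 (.var 15)) (.get 13 (.var 16))) <|
  .setNat 13 (.add (.var 13) (.const 1))

/-- Store all candidates in arrays `22`, `23`. -/
def joinPass : Prog :=
  .seq (.seq (.setNat 13 (.const 0)) (.setNat 15 (.const 0))) <|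
  .loop (.natLt (.var 15) (.var 10)) <|
  .seq joinIndex <| .seq (.cond joinTest joinPush .skip) (.setNat 15 (.add (.var 15) (.const 1)))

theorem joinIndex_run (s : State) : joinIndex.run s =
    s.setNat 16 (max (s.na 10 (s.nv 15)) (s.na 11 (s.nv 15))) := by
  by_cases h : s.na 10 (s.nv 15) < s.na 11 (s.nv 15)
  · rw [max_eq_right h.le]
    exact if_pos h
  · rw [max_eq_left (not_lt.1 h)]
    exact if_neg h

theorem joinPush_run (s : State) : joinPush.run s =
    { nv := Function.update s.nv 13 (s.nv 13 + 1)
      rv := s.rv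
      na := s.na
      ra := Function.update (Function.update s.ra 22 (Function.update (s.ra 22) (s.nv 13)
        (s.ra 10 (s.nv 15)))) 23 (Function.update (s.ra 23) (s.nv 13)
        (max (s.ra 11 (s.nv 15)) (s.ra 13 (s.nv 16)))) } := by
  simp [joinPush, Prog.run, putMax_run, NExp.val, RExp.val, State.setNat, State.putReal]

/-- The candidates that belong to the interval `I` of the first list. -/
def hullCandsOf (ε : ℝ) (I : ℝ × ℝ) (M : Set (ℝ × ℝ)) : Set (ℝ × ℝ) :=
  {K | ∃ J ∈ M, (I.1 ≤ J.1 ∧ -ε < I.1 + J.1) ∧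
    (∀ J' ∈ M, I.1 ≤ J'.1 → -ε < I.1 + J'.1 → J.1 ≤ J'.1) ∧ I.2 + J.2 < ε ∧
    K = (I.1, max I.2 J.2)}

theorem hullCands_insert (ε : ℝ) (I : ℝ × ℝ) (L M : Set (ℝ × ℝ)) :
    hullCands ε (insert I L) M = hullCandsOf ε I M ∪ hullCands ε L M := by
  ext K
  constructor
  · rintro ⟨I', rfl | hI', h⟩
    · exact Or.inl h
    · exact Or.inr ⟨I', hI', h⟩
  · rintro (h | ⟨I', hI', h⟩)
    · exact ⟨I, Or.inl rfl, h⟩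
    · exact ⟨I', Or.inr hI', h⟩

/-- The invariant of the loop in `joinPass`. -/
structure JoinInv (s₀ : State) (k : ℕ) (s : State) : Prop where
  n : s.nv 10 = s₀.nv 10
  n' : s.nv 11 = s₀.nv 11
  rv : s.rv = s₀.rv
  na : s.na = s₀.na
  p : s.ra 10 = s₀.ra 10
  p' : s.ra 11 = s₀.ra 11
  q : s.ra 12 = s₀.ra 12
  q' : s.ra 13 = s₀.ra 13
  hk : s.nv 15 + k = s₀.nv 10
  hn : s.nv 13 ≤ s.nv 15
  asc : WeakAsc s 22 (s.nv 13)
  low : ∀ t < s.nv 13, ∀ i, s.nv 15 ≤ i → i < s₀.nv 10 → s.ra 22 t ≤ s₀.ra 10 i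
  set : ivs s 22 (s.nv 13) = hullCands (s₀.rv 0) (ivs s₀ 10 (s.nv 15)) (ivs s₀ 12 (s₀.nv 11))

/-- The first interval that satisfies both constraints. -/
theorem hullCandsOf_eq {s : State} (hQ : Asc s 12 (s.nv 11)) (hu : UpCount s 0 (s.nv 10))
    (hd : DownCount s 0 (s.nv 10)) {i : ℕ} (hi : i < s.nv 10) :
    hullCandsOf (s.rv 0) (ivl s 10 i) (ivs s 12 (s.nv 11)) =
      {K | (max (s.na 10 i) (s.na 11 i) < s.nv 11 ∧
        s.ra 11 i + s.ra 13 (max (s.na 10 i) (s.na 11 i)) < s.rv 0) ∧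
        K = (s.ra 10 i, max (s.ra 11 i) (s.ra 13 (max (s.na 10 i) (s.na 11 i))))} := by
  set j := max (s.na 10 i) (s.na 11 i) with hj
  -- Each of the two constraints holds on a final segment of the sorted second list, starting at the
  -- respective count. Both hold from the larger count on, and its position carries the least
  -- admissible lower bound.
  have hiff : ∀ t < s.nv 11, j ≤ t ↔ s.ra 10 i ≤ s.ra 12 t ∧ -s.rv 0 < s.ra 10 i + s.ra 12 t := by
    intro t ht
    have h1 := hu i (Nat.zero_le _) hi t ht
    have h2 := hd i (Nat.zero_le _) hi t ht
    rw [hj, max_le_iff, ← not_lt, ← not_lt, h1, h2, not_lt, not_le]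
    exact and_congr_right fun _ => ⟨fun h => by linarith, fun h => by linarith⟩
  ext K
  constructor
  · rintro ⟨J, ⟨t, ht, rfl⟩, hc, hmin, hok, rfl⟩
    have hjt := (hiff t ht).2 hc
    have hjn : j < s.nv 11 := by omega
    have hcj := (hiff j hjn).1 le_rfl
    have hle := hmin _ ⟨j, hjn, rfl⟩ hcj.1 hcj.2
    have : j = t := by
      rcases hjt.lt_or_eq with h | h
      · exact absurd (hQ j t h ht) (not_lt.2 hle)
      · exact h
    subst this
    exact ⟨⟨hjn, hok⟩, rfl⟩
  · rintro ⟨⟨hjn, hok⟩, rfl⟩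
    refine ⟨_, ⟨j, hjn, rfl⟩, (hiff j hjn).1 le_rfl, ?_, hok, rfl⟩
    rintro _ ⟨t, ht, rfl⟩ h1 h2
    exact hQ.weakAsc.le ((hiff t ht).2 ⟨h1, h2⟩) ht

theorem joinStep_run {s₀ s : State} {k : ℕ} (hP : Asc s₀ 10 (s₀.nv 10)) (hQ : Asc s₀ 12 (s₀.nv 11))
    (hu : UpCount s₀ 0 (s₀.nv 10)) (hd : DownCount s₀ 0 (s₀.nv 10)) (h : JoinInv s₀ k s)
    (hb : s.nv 15 < s.nv 10) : ∃ k' < k, JoinInv s₀ k'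
      ((Prog.seq joinIndex <| .seq (.cond joinTest joinPush .skip)
        (.setNat 15 (.add (.var 15) (.const 1)))).run s) := by
  obtain ⟨n, n', rv, na, p, p', q, q', hk, hn, asc, low, set⟩ := h
  refine ⟨k - 1, by omega, ?_⟩
  have hcands := hullCands_insert (s₀.rv 0) (ivl s₀ 10 (s.nv 15)) (ivs s₀ 10 (s.nv 15))
    (ivs s₀ 12 (s₀.nv 11))
  rw [← ivs_succ, hullCandsOf_eq hQ hu hd (by omega), ← set] at hcands
  have hindex := joinIndex_run s
  rw [na] at hindex
  simp only [Prog.run]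
  rw [hindex]
  set j := max (s₀.na 10 (s.nv 15)) (s₀.na 11 (s.nv 15)) with hj
  have htest : joinTest.Holds (s.setNat 16 j) ↔
      j < s₀.nv 11 ∧ s₀.ra 11 (s.nv 15) + s₀.ra 13 j < s₀.rv 0 := by
    simp [joinTest, Test.Holds, NExp.val, RExp.val, State.setNat, n', p', q', rv]
  split_ifs with hc <;> rw [htest] at hc
  · have hset : hullCands (s₀.rv 0) (ivs s₀ 10 (s.nv 15 + 1)) (ivs s₀ 12 (s₀.nv 11)) =
        insert (s₀.ra 10 (s.nv 15), max (s₀.ra 11 (s.nv 15)) (s₀.ra 13 j))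
          (ivs s 22 (s.nv 13)) := by
      rw [hcands, Set.insert_eq]
      congr 1
      ext K
      simp [hc.1, hc.2]
    simp only [joinPush_run, State.setNat, NExp.val, ne_eq, Nat.reduceEqDiff, not_false_eq_true,
      Function.update_of_ne, Function.update_self]
    set s' : State := State.mk _ _ _ _ with hs'
    have hold : ∀ i < s.nv 13, ivl s' 22 i = ivl s 22 i := by
      intro i hi
      simp [hs', ivl, hi.ne]
    have hnew : ivl s' 22 (s.nv 13) =
        (s₀.ra 10 (s.nv 15), max (s₀.ra 11 (s.nv 15)) (s₀.ra 13 j)) := by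
      simp [hs', ivl, p, p', q']
    have e13 : s'.nv 13 = s.nv 13 + 1 := by simp [hs']
    have e15 : s'.nv 15 = s.nv 15 + 1 := by simp [hs']
    constructor
    · simpa [hs'] using n
    · simpa [hs'] using n'
    · exact rv
    · exact na
    · simpa [hs'] using p
    · simpa [hs'] using p'
    · simpa [hs'] using q
    · simpa [hs'] using q'
    · omega
    · omega
    · rw [e13]
      exact asc.push hold hnew fun i hi => low i hi _ le_rfl (by omega)
    · rw [e13, e15]
      intro t ht i hi hi'
      rcases Nat.lt_succ_iff_lt_or_eq.1 ht with ht | rfl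
      · have : s'.ra 22 t = s.ra 22 t := congrArg Prod.fst (hold t ht)
        rw [this]
        exact low t ht i (by omega) hi'
      · have : s'.ra 22 (s.nv 13) = _ := congrArg Prod.fst hnew
        rw [this]
        exact (hP (s.nv 15) i (by omega) hi').le
    · rw [e13, e15, hset]
      exact ivs_push hold hnew
  · have hset : hullCands (s₀.rv 0) (ivs s₀ 10 (s.nv 15 + 1)) (ivs s₀ 12 (s₀.nv 11)) =
        ivs s 22 (s.nv 13) := by
      rw [hcands]
      convert Set.empty_union _
      ext K
      exact iff_of_false (fun h => hc h.1) (Set.notMem_empty K)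
    simp only [State.setNat, NExp.val]
    constructor <;> simp only [Function.update_self, ne_eq, Nat.reduceEqDiff, not_false_eq_true,
      Function.update_of_ne]
    · exact n
    · exact n'
    · exact rv
    · exact na
    · exact p
    · exact p'
    · exact q
    · exact q'
    · omega
    · omega
    · exact asc
    · exact fun t ht i hi hi' => low t ht i (by omega) hi'
    · exact hset.symm

theorem lin_joinPass : Lin joinPass
    (fun m s => Asc s 10 (s.nv 10) ∧ Asc s 12 (s.nv 11) ∧ s.nv 10 + s.nv 11 ≤ m ∧
      UpCount s 0 (s.nv 10) ∧ DownCount s 0 (s.nv 10))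
    (fun _ s s' => WeakAsc s' 22 (s'.nv 13) ∧ s'.nv 13 ≤ s.nv 10 ∧
      ivs s' 22 (s'.nv 13) = hullCands (s.rv 0) (ivs s 10 (s.nv 10)) (ivs s 12 (s.nv 11))) := by
  have h1 : Lin (.seq (.setNat 13 (.const 0)) (.setNat 15 (.const 0)))
      (fun m s => Asc s 10 (s.nv 10) ∧ Asc s 12 (s.nv 11) ∧ s.nv 10 + s.nv 11 ≤ m ∧
        UpCount s 0 (s.nv 10) ∧ DownCount s 0 (s.nv 10))
      (fun m _ s => (Asc s 10 (s.nv 10) ∧ Asc s 12 (s.nv 11) ∧ s.nv 10 + s.nv 11 ≤ m ∧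
        UpCount s 0 (s.nv 10) ∧ DownCount s 0 (s.nv 10)) ∧ s.nv 13 = 0 ∧ s.nv 15 = 0) :=
    Lin.of_run rfl fun m s h => by
      refine ⟨?_, by simp [Prog.run, State.setNat, NExp.val]⟩
      simpa [Prog.run, State.setNat, NExp.val, Asc, UpCount, DownCount] using h
  have h2 : Lin (.loop (.natLt (.var 15) (.var 10)) <|
      .seq joinIndex <| .seq (.cond joinTest joinPush .skip)
        (.setNat 15 (.add (.var 15) (.const 1))))
      (fun m s => (Asc s 10 (s.nv 10) ∧ Asc s 12 (s.nv 11) ∧ s.nv 10 + s.nv 11 ≤ m ∧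
        UpCount s 0 (s.nv 10) ∧ DownCount s 0 (s.nv 10)) ∧ s.nv 13 = 0 ∧ s.nv 15 = 0)
      (fun _ s s' => WeakAsc s' 22 (s'.nv 13) ∧ s'.nv 13 ≤ s.nv 10 ∧
        ivs s' 22 (s'.nv 13) = hullCands (s.rv 0) (ivs s 10 (s.nv 10)) (ivs s 12 (s.nv 11))) := by
    refine Lin.loop rfl 1 (fun _ s₀ k s => JoinInv s₀ k s) ?_ ?_ ?_
    · rintro m s ⟨⟨hP, hQ, hm, -⟩, h13, h15⟩
      refine ⟨s.nv 10, by omega, ⟨rfl, rfl, rfl, rfl, rfl, rfl, rfl, rfl, by omega, by omega, ?_, ?_, ?_⟩⟩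
      · rw [h13]; intro i j _ hj; omega
      · rw [h13]; intro t ht; omega
      · rw [h13, h15, ivs_zero, ivs_zero]
        ext J; simp [hullCands]
    · rintro m s₀ k s ⟨⟨hP, hQ, hm, hu, hd⟩, -⟩ h hb
      exact joinStep_run hP hQ hu hd h hb
    · rintro m s₀ k s - h hb
      simp only [Test.Holds, NExp.val, not_lt, h.n] at hb
      have hk := h.hk
      have hn := h.hn
      have h15 : s.nv 15 = s₀.nv 10 := by omega
      exact ⟨h.asc, by omega, h15 ▸ h.set⟩
  refine (Lin.seq h1 h2 fun _ _ _ _ _ h => h).mono (fun _ _ h => h) ?_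
  rintro m s s'' - - ⟨s', hf, -, -, h⟩
  rwa [hf.nv 10 (by decide), hf.nv 11 (by decide), hf.rv 0 (by decide),
    ivs_eq_of_ra (hf.ra 10 (by decide)) (hf.ra (10 + 1) (by decide)),
    ivs_eq_of_ra (hf.ra 12 (by decide)) (hf.ra (12 + 1) (by decide))] at h

/-- Compute the candidates for the lists in arrays `10`, `11` and `12`, `13`. -/
def hullGen : Prog := .seq upPass <| .seq downPass joinPass

/-- Two ascending lists of intervals of total length at most `m`. -/
def TwoLists (m : ℕ) (s : State) : Prop :=
  Asc s 10 (s.nv 10) ∧ Asc s 12 (s.nv 11) ∧ s.nv 10 + s.nv 11 ≤ m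

theorem TwoLists.congr {m : ℕ} {s s' : State} (h : TwoLists m s) (h1 : s'.nv 10 = s.nv 10)
    (h2 : s'.nv 11 = s.nv 11) (h3 : s'.ra 10 = s.ra 10) (h4 : s'.ra 12 = s.ra 12) :
    TwoLists m s' := by
  rw [TwoLists, h1, h2]
  exact ⟨h.1.of_ra h3, h.2.1.of_ra h4, h.2.2⟩

theorem lin_hullGen : Lin hullGen TwoLists
    (fun _ s s' => WeakAsc s' 22 (s'.nv 13) ∧ s'.nv 13 ≤ s.nv 10 ∧
      ivs s' 22 (s'.nv 13) = hullCands (s.rv 0) (ivs s 10 (s.nv 10)) (ivs s 12 (s.nv 11))) := by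
  refine (Lin.seq lin_upPass (Lin.seq (lin_downPass.mono (Pre' := fun m s => TwoLists m s ∧
    UpCount s 0 (s.nv 10)) (fun _ _ h => h.1) fun _ _ _ _ _ h => h) lin_joinPass ?_) ?_).mono
    (fun _ _ h => h) ?_
  · rintro m s s' ⟨h, hu⟩ hf hd
    have e10 := hf.nv 10 (by decide)
    have e11 := hf.nv 11 (by decide)
    have r10 := hf.ra 10 (by decide)
    have r12 := hf.ra 12 (by decide)
    obtain ⟨h1, h2, h3⟩ := h.congr e10 e11 r10 r12
    refine ⟨h1, h2, h3, ?_, hd⟩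
    rwa [UpCount, e10, e11, r10, r12, hf.na 10 (by decide)]
  · rintro m s s' h hf hu
    exact ⟨TwoLists.congr h (hf.nv 10 (by decide)) (hf.nv 11 (by decide)) (hf.ra 10 (by decide))
      (hf.ra 12 (by decide)), hu⟩
  · rintro m s s₃ - - ⟨s₁, f₁, -, -, s₂, f₂, -, -, h⟩
    rwa [f₂.nv 10 (by decide), f₂.nv 11 (by decide), f₂.rv 0 (by decide),
      ivs_eq_of_ra (f₂.ra 10 (by decide)) (f₂.ra (10 + 1) (by decide)),
      ivs_eq_of_ra (f₂.ra 12 (by decide)) (f₂.ra (12 + 1) (by decide)),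
      f₁.nv 10 (by decide), f₁.nv 11 (by decide), f₁.rv 0 (by decide),
      ivs_eq_of_ra (f₁.ra 10 (by decide)) (f₁.ra (10 + 1) (by decide)),
      ivs_eq_of_ra (f₁.ra 12 (by decide)) (f₁.ra (12 + 1) (by decide))] at h

/-- Exchange the two input lists. -/
def swapLists : Prog :=
  .seq (copy 10 24 (.const 0) (.const 0) (.var 10)) <|
  .seq (copy 12 10 (.const 0) (.const 0) (.var 11)) <|
  .seq (copy 24 12 (.const 0) (.const 0) (.var 10)) <|
  .seq (.setNat 14 (.var 10)) <| .seq (.setNat 10 (.var 11)) (.setNat 11 (.var 14))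

theorem lin_copy_zero (a b x : ℕ) (h1 : a ≠ b) (h2 : a + 1 ≠ b) (h3 : a ≠ b + 1)
    (hx : x < 20 ∨ 23 < x) : Lin (copy a b (.const 0) (.const 0) (.var x))
      (fun m s => s.nv x ≤ m) (fun _ s s' => Copied a b 0 0 (s.nv x) s s') :=
  lin_copy a b h1 h2 h3 (NExp.stable_const 0) (NExp.stable_var hx)

/-- With the lists exchanged, the same generator yields the second family of hull candidates. -/
theorem lin_swapLists : Lin swapLists TwoLists
    (fun m s s' => TwoLists m s' ∧ s'.nv 10 = s.nv 11 ∧ s'.nv 11 = s.nv 10 ∧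
      ivs s' 10 (s'.nv 10) = ivs s 12 (s.nv 11) ∧ ivs s' 12 (s'.nv 11) = ivs s 10 (s.nv 10)) := by
  have hlast : Lin (.seq (.setNat 14 (.var 10)) <| .seq (.setNat 10 (.var 11))
      (.setNat 11 (.var 14))) (fun _ _ => True)
      (fun _ s s' => s'.nv 10 = s.nv 11 ∧ s'.nv 11 = s.nv 10) :=
    Lin.of_run rfl fun m s _ => by simp [Prog.run, State.setNat, NExp.val]
  have c1 := lin_copy_zero 10 24 10 (by norm_num) (by norm_num) (by norm_num) (by norm_num)
  have c2 := lin_copy_zero 12 10 11 (by norm_num) (by norm_num) (by norm_num) (by norm_num)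
  have c3 := lin_copy_zero 24 12 10 (by norm_num) (by norm_num) (by norm_num) (by norm_num)
  refine (Lin.seq (c1.mono (Pre' := fun m s => s.nv 10 + s.nv 11 ≤ m)
    (fun _ _ _ => by omega) fun _ _ _ _ _ h => h) (Lin.seq (c2.mono (Pre' := fun m s =>
    s.nv 10 + s.nv 11 ≤ m) (fun _ _ _ => by omega) fun _ _ _ _ _ h => h) (Lin.seq c3 hlast fun _ _ _ _ _ _ => trivial)
    ?_) ?_).mono (fun m s h => h.2.2) ?_
  · rintro m s s' h hf -
    rw [hf.nv 10 (by decide)]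
    omega
  · rintro m s s' h hf -
    rwa [hf.nv 10 (by decide), hf.nv 11 (by decide)]
  · rintro m s s₄ ⟨hP, hQ, hm⟩ - ⟨s₁, f₁, k1, -, s₂, f₂, k2, -, s₃, f₃, k3, f₄, l1, l2⟩
    have e10 : s₂.nv 10 = s.nv 10 := (f₂.nv 10 (by decide)).trans (f₁.nv 10 (by decide))
    have e11 : s₁.nv 11 = s.nv 11 := f₁.nv 11 (by decide)
    have e11' : s₃.nv 11 = s.nv 11 :=
      ((f₃.nv 11 (by decide)).trans (f₂.nv 11 (by decide))).trans e11
    have e10' : s₃.nv 10 = s.nv 10 := (f₃.nv 10 (by decide)).trans e10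
    rw [e11] at k2
    rw [e10] at k3
    have q12 : Asc s₁ 12 (s.nv 11) := hQ.of_ra (f₁.ra 12 (by decide))
    have p24 : Asc s₂ 24 (s.nv 10) := (k1.asc hP).of_ra (f₂.ra 24 (by decide))
    have i10 : ivs s₄ 10 (s.nv 11) = ivs s 12 (s.nv 11) := by
      rw [ivs_eq_of_ra (f₄.ra 10 (by decide)) (f₄.ra (10 + 1) (by decide)),
        ivs_eq_of_ra (f₃.ra 10 (by decide)) (f₃.ra (10 + 1) (by decide)), k2.ivs_eq,
        ivs_eq_of_ra (f₁.ra 12 (by decide)) (f₁.ra (12 + 1) (by decide))]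
    have i12 : ivs s₄ 12 (s.nv 10) = ivs s 10 (s.nv 10) := by
      rw [ivs_eq_of_ra (f₄.ra 12 (by decide)) (f₄.ra (12 + 1) (by decide)), k3.ivs_eq,
        ivs_eq_of_ra (f₂.ra 24 (by decide)) (f₂.ra (24 + 1) (by decide)), k1.ivs_eq]
    rw [TwoLists, l1, l2, e10', e11', i10, i12]
    exact ⟨⟨((k2.asc q12).of_ra (f₃.ra 10 (by decide))).of_ra (f₄.ra 10 (by decide)),
      (k3.asc p24).of_ra (f₄.ra 12 (by decide)), by omega⟩, rfl, rfl, rfl, rfl⟩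

/-- Compute the error range set, into arrays `24`, `25`, of the union of two trees with error range
sets in arrays `10`, `11` and `12`, `13`. -/
def hullCore : Prog :=
  .seq hullGen <| .seq (copy 22 20 (.const 0) (.const 0) (.var 13)) <|
  .seq (.setNat 12 (.var 13)) <| .seq swapLists <| .seq hullGen merge

/-- The first family of candidates is parked in arrays `20`, `21`, which the exchange and the second
generation leave alone, while the second family arrives in `22`, `23`. These are the inputs of
`merge`, and `minimals_hullSet` identifies the result. -/
theorem lin_hullCore : Lin hullCore TwoLists
    (fun _ s s' => Asc s' 24 (s'.nv 14) ∧ s'.nv 14 ≤ s.nv 10 + s.nv 11 ∧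
      ∀ R S : Set (ℝ × ℝ), R.Finite → S.Finite → ivs s 10 (s.nv 10) = minimals R →
        ivs s 12 (s.nv 11) = minimals S →
        ivs s' 24 (s'.nv 14) = minimals (hullSet (s.rv 0) R S)) := by
  have hset : Lin (.setNat 12 (.var 13)) (fun _ _ => True)
      (fun _ s s' => s'.nv 12 = s.nv 13) :=
    Lin.of_run rfl fun m s _ => by simp [Prog.run, State.setNat, NExp.val]
  have c1 := lin_copy_zero 22 20 13 (by norm_num) (by norm_num) (by norm_num) (by norm_num)
  have g1 := lin_hullGen.mono (Pre' := TwoLists) (fun _ _ h => h)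
    (Post' := fun m s s' => TwoLists m s' ∧ s'.nv 10 = s.nv 10 ∧ s'.nv 11 = s.nv 11 ∧
      WeakAsc s' 22 (s'.nv 13) ∧ s'.nv 13 ≤ s.nv 10 ∧ ivs s' 22 (s'.nv 13) =
        hullCands (s.rv 0) (ivs s 10 (s.nv 10)) (ivs s 12 (s.nv 11)))
    (fun m s s' h hf h' => ⟨h.congr (hf.nv 10 (by decide)) (hf.nv 11 (by decide))
      (hf.ra 10 (by decide)) (hf.ra 12 (by decide)), hf.nv 10 (by decide), hf.nv 11 (by decide),
      h'⟩)
  refine (Lin.seq g1 (Lin.seq (c1.mono (Pre' := fun m s => TwoLists m s ∧ s.nv 13 ≤ s.nv 10 ∧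
    WeakAsc s 22 (s.nv 13)) ?_ fun _ _ _ _ _ h => h) (Lin.seq (hset.mono (Pre' := fun m s =>
    TwoLists m s ∧ s.nv 13 ≤ s.nv 10 ∧ WeakAsc s 20 (s.nv 13)) (fun _ _ _ => trivial)
    fun _ _ _ _ _ h => h) (Lin.seq (lin_swapLists.mono (Pre' := fun m s => TwoLists m s ∧
    s.nv 12 ≤ s.nv 10 ∧ WeakAsc s 20 (s.nv 12)) (fun _ _ h => h.1) fun _ _ _ _ _ h => h)
    (Lin.seq (g1.mono (Pre' := fun m s => TwoLists m s ∧ s.nv 12 ≤ s.nv 11 ∧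
    WeakAsc s 20 (s.nv 12)) (fun _ _ h => h.1) fun _ _ _ _ _ h => h) lin_merge
    ?_) ?_) ?_) ?_) ?_).mono (fun _ _ h => h) ?_
  · rintro m s ⟨h, h1, -⟩
    have := h.2.2
    omega
  · rintro m s s' ⟨h, h1, h2⟩ hf ⟨k1, k2, k3, k4, k5, -⟩
    have e12 := hf.nv 12 (by decide)
    have := h.2.2
    rw [e12]
    exact ⟨h2.of_ra (hf.ra 20 (by decide)), k4, by omega⟩
  · rintro m s s' ⟨h, h1, h2⟩ hf ⟨k1, k2, k3, -⟩
    have e12 := hf.nv 12 (by decide)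
    rw [e12]
    exact ⟨k1, by omega, h2.of_ra (hf.ra 20 (by decide))⟩
  · rintro m s s' ⟨h, h1, h2⟩ hf k
    rw [k, hf.nv 10 (by decide)]
    exact ⟨h.congr (hf.nv 10 (by decide)) (hf.nv 11 (by decide)) (hf.ra 10 (by decide))
      (hf.ra 12 (by decide)), h1, h2.of_ra (hf.ra 20 (by decide))⟩
  · rintro m s s' ⟨h, h1, h2⟩ hf k
    rw [hf.nv 13 (by decide), hf.nv 10 (by decide)]
    exact ⟨h.congr (hf.nv 10 (by decide)) (hf.nv 11 (by decide)) (hf.ra 10 (by decide))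
      (hf.ra 12 (by decide)), h1, h2.congr fun i hi => by simpa using k.new i hi⟩
  · rintro m s s' h hf ⟨k1, k2, k3, k4, k5, -⟩
    exact ⟨k1, by omega, k4⟩
  · rintro m s s₆ h - ⟨s₁, f₁, ⟨-, a10, a11, -, a13, aset⟩, -, s₂, f₂, hc, -, s₃, f₃, h12, -, s₄, f₄,
      ⟨-, b10, b11, bset, bset'⟩, -, s₅, f₅, ⟨-, -, -, -, d13, dset⟩, -, m1, m2, m3⟩
    have e12 : s₅.nv 12 = s₁.nv 13 := by
      rw [f₅.nv 12 (by decide), f₄.nv 12 (by decide), h12, f₂.nv 13 (by decide)]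
    have e10 : s₃.nv 10 = s.nv 10 := by
      rw [f₃.nv 10 (by decide), f₂.nv 10 (by decide), a10]
    have e11 : s₃.nv 11 = s.nv 11 := by
      rw [f₃.nv 11 (by decide), f₂.nv 11 (by decide), a11]
    refine ⟨m1, by omega, fun R S hR hS hsR hsS => ?_⟩
    have r0 : s₄.rv 0 = s.rv 0 := by
      rw [f₄.rv 0 (by decide), f₃.rv 0 (by decide), f₂.rv 0 (by decide), f₁.rv 0 (by decide)]
    have i10 : ivs s₃ 10 (s.nv 10) = minimals R := by
      rw [ivs_eq_of_ra (f₃.ra 10 (by decide)) (f₃.ra (10 + 1) (by decide)),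
        ivs_eq_of_ra (f₂.ra 10 (by decide)) (f₂.ra (10 + 1) (by decide)),
        ivs_eq_of_ra (f₁.ra 10 (by decide)) (f₁.ra (10 + 1) (by decide)), hsR]
    have i12 : ivs s₃ 12 (s.nv 11) = minimals S := by
      rw [ivs_eq_of_ra (f₃.ra 12 (by decide)) (f₃.ra (12 + 1) (by decide)),
        ivs_eq_of_ra (f₂.ra 12 (by decide)) (f₂.ra (12 + 1) (by decide)),
        ivs_eq_of_ra (f₁.ra 12 (by decide)) (f₁.ra (12 + 1) (by decide)), hsS]
    have x20 : ivs s₅ 20 (s₁.nv 13) = hullCands (s.rv 0) (minimals R) (minimals S) := by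
      rw [ivs_eq_of_ra (f₅.ra 20 (by decide)) (f₅.ra (20 + 1) (by decide)),
        ivs_eq_of_ra (f₄.ra 20 (by decide)) (f₄.ra (20 + 1) (by decide)),
        ivs_eq_of_ra (f₃.ra 20 (by decide)) (f₃.ra (20 + 1) (by decide)), hc.ivs_eq, aset, hsR,
        hsS]
    rw [m3, e12, x20, dset, bset, bset', e10, e11, i10, i12, r0]
    exact minimals_hullSet hR hS

end RealRAM

/-! ### From the programs on lists to the algorithms on trees. -/

namespace Rounding

variable {V : Type u}

theorem shiftSet_empty (ε x : ℝ) : shiftSet ε x ∅ = ∅ := by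
  ext J; simp [shiftSet]

theorem ranges_insert_eq_shiftSet {G : SimpleGraph V} (hG : G.IsTree) {A : Set V} (hfin : A.Finite)
    (hA : PathClosed G A) {p u : V} (hp : p ∉ A) (hu : u ∈ A) (h : G.Adj p u) (w : Sym2 V → ℝ≥0)
    (ε : ℝ) : ranges G w ε (insert p A) p = shiftSet ε (w s(p, u)) (ranges G w ε A u) := by
  rcases le_or_gt ε 0 with hε | hε
  · rw [ranges_eq_empty G w hε (Set.mem_insert p A), ranges_eq_empty G w hε hu, shiftSet_empty]
  · exact ranges_insert hG hfin hA hp hu h w ε hε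

/-- A path through `p` with both ends different from `p` would visit its only neighbour `u` both
before and after `p`. -/
theorem pathClosed_compl_singleton {G : SimpleGraph V} {p u : V} (h : ∀ v, G.Adj p v ↔ v = u) :
    PathClosed G {p}ᶜ := by
  have key : ∀ {c : V} (q : G.Walk p c), c ≠ p → u ∈ q.support.tail := by
    intro c q hc
    cases q with
    | nil => exact absurd rfl hc
    | cons h' q =>
      obtain rfl := (h _).1 h'
      simp
  intro a ha b hb q hq x hx hxp
  obtain rfl : x = p := hxp
  obtain ⟨q₁, q₂, rfl⟩ := SimpleGraph.Walk.mem_support_iff_exists_append.1 hx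
  rw [SimpleGraph.Walk.isPath_def, SimpleGraph.Walk.support_append, List.nodup_append] at hq
  have h1 : u ∈ q₁.support := by
    have := List.mem_of_mem_tail (key q₁.reverse ha)
    rwa [SimpleGraph.Walk.support_reverse, List.mem_reverse] at this
  exact hq.2.2 u h1 u (key q₂ hb) rfl

end Rounding

namespace RealRAM

open Rounding

/-! ### The algorithms for composite trees -/

/-- The algorithm for adding a root edge. -/
def shiftProg : Prog :=
  .seq (copy 0 10 (.const 0) (.const 0) (.var 0)) <| .seq (.setNat 10 (.var 0)) <|
  .seq shiftCore <| .seq (copy 20 0 (.const 0) (.const 0) (.var 12)) <| .setNat 0 (.var 12)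

theorem lin_shiftProg : Lin shiftProg (fun m s => Asc s 0 (s.nv 0) ∧ s.nv 0 ≤ m)
    (fun _ s s' => Asc s' 0 (s'.nv 0) ∧ ∀ R, 0 ≤ s.rv 1 → Admissible (s.rv 0) R →
      Admissible (s.rv 0) (shiftSet (s.rv 0) (s.rv 1) R) → ivs s 0 (s.nv 0) = minimals R →
      ivs s' 0 (s'.nv 0) = minimals (shiftSet (s.rv 0) (s.rv 1) R)) := by
  have hset : ∀ x y, Lin (.setNat x (.var y)) (fun _ _ => True)
      (fun _ s s' => s'.nv x = s.nv y) := fun x y =>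
    Lin.of_run rfl fun m s _ => by simp [Prog.run, State.setNat, NExp.val]
  have c1 := lin_copy_zero 0 10 0 (by norm_num) (by norm_num) (by norm_num) (by norm_num)
  have c2 := lin_copy_zero 20 0 12 (by norm_num) (by norm_num) (by norm_num) (by norm_num)
  refine (Lin.seq (c1.mono (Pre' := fun m s => Asc s 0 (s.nv 0) ∧ s.nv 0 ≤ m) (fun _ _ h => h.2)
    fun _ _ _ _ _ h => h) (Lin.seq ((hset 10 0).mono (Pre' := fun m s => Asc s 10 (s.nv 0) ∧
    s.nv 0 ≤ m) (fun _ _ _ => trivial) fun _ _ _ _ _ h => h) (Lin.seq lin_shiftCore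
    (Lin.seq ((c2.scale 4).mono (Pre' := fun m s => s.nv 12 ≤ 4 * m) (fun _ _ h => h)
    fun _ _ _ _ _ h => h) (hset 0 12) fun _ _ _ _ _ _ => trivial) ?_) ?_) ?_).mono
    (fun _ _ h => h) ?_
  · rintro m s s' ⟨h1, h2⟩ - ⟨-, h3, -⟩
    omega
  · rintro m s s' ⟨h1, h2⟩ hf h
    rw [h]
    exact ⟨h1.of_ra (hf.ra 10 (by decide)), h2⟩
  · rintro m s s' ⟨h1, h2⟩ hf h
    rw [hf.nv 0 (by decide)]
    exact ⟨h.asc h1, h2⟩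
  · rintro m s s₅ ⟨h1, h2⟩ - ⟨s₁, f₁, k1, -, s₂, f₂, k2, -, s₃, f₃, ⟨a1, -, a2⟩, -, s₄, f₄, k4, f₅, k5⟩
    have e0 : s₁.nv 0 = s.nv 0 := f₁.nv 0 (by decide)
    have e12 : s₄.nv 12 = s₃.nv 12 := f₄.nv 12 (by decide)
    rw [k5, e12]
    refine ⟨(k4.asc a1).of_ra (f₅.ra 0 (by decide)), fun R hx hR hR' hs => ?_⟩
    rw [f₂.rv 0 (by decide), f₁.rv 0 (by decide), f₂.rv 1 (by decide), f₁.rv 1 (by decide), k2,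
      e0, ivs_eq_of_ra (f₂.ra 10 (by decide)) (f₂.ra (10 + 1) (by decide)), k1.ivs_eq] at a2
    rw [ivs_eq_of_ra (f₅.ra 0 (by decide)) (f₅.ra (0 + 1) (by decide)), k4.ivs_eq]
    exact a2 R hx hR hR' hs

/-- The algorithm for merging two trees at the root. -/
def hullProg : Prog :=
  .seq (copy 0 10 (.const 0) (.const 0) (.var 0)) <| .seq (.setNat 10 (.var 0)) <|
  .seq (copy 2 12 (.const 0) (.const 0) (.var 1)) <| .seq (.setNat 11 (.var 1)) <|
  .seq hullCore <| .seq (copy 24 0 (.const 0) (.const 0) (.var 14)) <| .setNat 0 (.var 14)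

theorem lin_hullProg : Lin hullProg
    (fun m s => Asc s 0 (s.nv 0) ∧ Asc s 2 (s.nv 1) ∧ s.nv 0 + s.nv 1 ≤ m)
    (fun _ s s' => Asc s' 0 (s'.nv 0) ∧ ∀ R S : Set (ℝ × ℝ), R.Finite → S.Finite →
      ivs s 0 (s.nv 0) = minimals R → ivs s 2 (s.nv 1) = minimals S →
      ivs s' 0 (s'.nv 0) = minimals (hullSet (s.rv 0) R S)) := by
  have hset : ∀ x y, Lin (.setNat x (.var y)) (fun _ _ => True)
      (fun _ s s' => s'.nv x = s.nv y) := fun x y =>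
    Lin.of_run rfl fun m s _ => by simp [Prog.run, State.setNat, NExp.val]
  have c1 := lin_copy_zero 0 10 0 (by norm_num) (by norm_num) (by norm_num) (by norm_num)
  have c2 := lin_copy_zero 2 12 1 (by norm_num) (by norm_num) (by norm_num) (by norm_num)
  have c3 := lin_copy_zero 24 0 14 (by norm_num) (by norm_num) (by norm_num) (by norm_num)
  refine (Lin.seq (c1.mono (Pre' := fun m s => Asc s 0 (s.nv 0) ∧ Asc s 2 (s.nv 1) ∧
    s.nv 0 + s.nv 1 ≤ m) (fun _ _ h => by omega) fun _ _ _ _ _ h => h)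
    (Lin.seq ((hset 10 0).mono (Pre' := fun m s => Asc s 10 (s.nv 0) ∧ Asc s 2 (s.nv 1) ∧
    s.nv 0 + s.nv 1 ≤ m) (fun _ _ _ => trivial) fun _ _ _ _ _ h => h)
    (Lin.seq (c2.mono (Pre' := fun m s => Asc s 10 (s.nv 10) ∧ Asc s 2 (s.nv 1) ∧
    s.nv 10 + s.nv 1 ≤ m) (fun _ _ h => by omega) fun _ _ _ _ _ h => h)
    (Lin.seq ((hset 11 1).mono (Pre' := fun m s => Asc s 10 (s.nv 10) ∧ Asc s 12 (s.nv 1) ∧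
    s.nv 10 + s.nv 1 ≤ m) (fun _ _ _ => trivial) fun _ _ _ _ _ h => h)
    (Lin.seq lin_hullCore (Lin.seq c3 (hset 0 14) fun _ _ _ _ _ _ => trivial)
    ?_) ?_) ?_) ?_) ?_).mono (fun _ _ h => h) ?_
  · rintro m s s' ⟨h1, h2, h3⟩ - ⟨-, h4, -⟩
    omega
  · rintro m s s' ⟨h1, h2, h3⟩ hf h
    have e10 := hf.nv 10 (by decide)
    rw [TwoLists, h, e10]
    exact ⟨h1.of_ra (hf.ra 10 (by decide)), h2.of_ra (hf.ra 12 (by decide)), h3⟩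
  · rintro m s s' ⟨h1, h2, h3⟩ hf h
    have e10 := hf.nv 10 (by decide)
    have e1 := hf.nv 1 (by decide)
    rw [e10, e1]
    exact ⟨h1.of_ra (hf.ra 10 (by decide)), h.asc h2, h3⟩
  · rintro m s s' ⟨h1, h2, h3⟩ hf h
    rw [h, hf.nv 1 (by decide)]
    exact ⟨h1.of_ra (hf.ra 10 (by decide)), h2.of_ra (hf.ra 2 (by decide)), h3⟩
  · rintro m s s' ⟨h1, h2, h3⟩ hf h
    rw [hf.nv 0 (by decide), hf.nv 1 (by decide)]
    exact ⟨h.asc h1, h2.of_ra (hf.ra 2 (by decide)), h3⟩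
  · rintro m s s₇ - - ⟨s₁, f₁, k1, -, s₂, f₂, k2, -, s₃, f₃, k3, -, s₄, f₄, k4, -, s₅, f₅,
      ⟨a1, -, a2⟩, -, s₆, f₆, k6, f₇, k7⟩
    have e14 : s₆.nv 14 = s₅.nv 14 := f₆.nv 14 (by decide)
    rw [k7, e14]
    refine ⟨(k6.asc a1).of_ra (f₇.ra 0 (by decide)), fun R S hR hS hsR hsS => ?_⟩
    have e0 : s₄.nv 10 = s.nv 0 := by
      rw [f₄.nv 10 (by decide), f₃.nv 10 (by decide), k2, f₁.nv 0 (by decide)]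
    have e2 : s₂.nv 1 = s.nv 1 := (f₂.nv 1 (by decide)).trans (f₁.nv 1 (by decide))
    have e1 : s₄.nv 11 = s.nv 1 := by rw [k4, f₃.nv 1 (by decide), e2]
    have r0 : s₄.rv 0 = s.rv 0 := by
      rw [f₄.rv 0 (by decide), f₃.rv 0 (by decide), f₂.rv 0 (by decide), f₁.rv 0 (by decide)]
    have i10 : ivs s₄ 10 (s.nv 0) = ivs s 0 (s.nv 0) := by
      rw [ivs_eq_of_ra (f₄.ra 10 (by decide)) (f₄.ra (10 + 1) (by decide)),
        ivs_eq_of_ra (f₃.ra 10 (by decide)) (f₃.ra (10 + 1) (by decide)),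
        ivs_eq_of_ra (f₂.ra 10 (by decide)) (f₂.ra (10 + 1) (by decide)), k1.ivs_eq]
    rw [e2] at k3
    have i12 : ivs s₄ 12 (s.nv 1) = ivs s 2 (s.nv 1) := by
      rw [ivs_eq_of_ra (f₄.ra 12 (by decide)) (f₄.ra (12 + 1) (by decide)), k3.ivs_eq,
        ivs_eq_of_ra (f₂.ra 2 (by decide)) (f₂.ra (2 + 1) (by decide)),
        ivs_eq_of_ra (f₁.ra 2 (by decide)) (f₁.ra (2 + 1) (by decide))]
    rw [e0, e1, r0, i10, i12] at a2
    rw [ivs_eq_of_ra (f₇.ra 0 (by decide)) (f₇.ra (0 + 1) (by decide)), k6.ivs_eq]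
    exact a2 R S hR hS hsR hsS

/-! ### Input and output -/

/-- The length of a strictly sorted list is a cardinality. With the bound on minimal intervals, time
linear in the lengths of lists becomes time linear in the numbers of vertices. -/
theorem Asc.ncard_eq {s : State} {a n : ℕ} (h : Asc s a n) : (ivs s a n).ncard = n := by
  have him : ivs s a n = ivl s a '' (Finset.range n : Set ℕ) := by
    ext I
    constructor
    · rintro ⟨i, hi, rfl⟩
      exact ⟨i, by simpa using hi, rfl⟩
    · rintro ⟨i, hi, rfl⟩
      exact ⟨i, by simpa using hi, rfl⟩
  have hinj : Set.InjOn (ivl s a) (Finset.range n : Set ℕ) := by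
    intro i hi j hj hij
    have h' : s.ra a i = s.ra a j := congrArg Prod.fst hij
    simp only [Finset.coe_range, Set.mem_Iio] at hi hj
    rcases lt_trichotomy i j with hl | hl | hl
    · exact absurd h' (h i j hl hj).ne
    · exact hl
    · exact absurd h' (h j i hl hi).ne'
  rw [him, hinj.ncard_image, Set.ncard_coe_finset, Finset.card_range]

theorem asc_of_isAscendingListOf {L : List (ℝ × ℝ)} {S : Set (ℝ × ℝ)} (h : IsAscendingListOf L S)
    {s : State} {a : ℕ} (hs : ∀ (i : ℕ) (hi : i < L.length), ivl s a i = L[i]) :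
    Asc s a L.length ∧ ivs s a L.length = S := by
  constructor
  · intro i j hij hj
    have h1 := List.pairwise_iff_getElem.1 h.1 i j (hij.trans hj) hj hij
    rw [← hs i, ← hs j] at h1
    exact h1
  · ext I
    rw [← h.2 I, List.mem_iff_getElem]
    constructor
    · rintro ⟨i, hi, rfl⟩
      exact ⟨i, hi, (hs i hi).symm⟩
    · rintro ⟨i, hi, rfl⟩
      exact ⟨i, hi, (hs i hi).symm⟩

theorem exists_outputs {s : State} (h : Asc s 0 (s.nv 0)) :
    ∃ L, OutputsIntervals s L ∧ IsAscendingListOf L (ivs s 0 (s.nv 0)) := by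
  refine ⟨List.ofFn fun i : Fin (s.nv 0) => ivl s 0 i, ⟨by simp, fun i hi => ?_⟩, ?_, fun I => ?_⟩
  · simp [ivl]
  · rw [List.pairwise_ofFn]
    intro i j hij
    exact h i j hij j.2
  · rw [List.mem_ofFn]
    constructor
    · rintro ⟨i, rfl⟩
      exact ⟨i, i.2, rfl⟩
    · rintro ⟨i, hi, rfl⟩
      exact ⟨⟨i, hi⟩, rfl⟩

theorem ivl_intervalInput (L M : List (ℝ × ℝ)) (ε x : ℝ) :
    (∀ (i : ℕ) (hi : i < L.length), ivl (intervalInput L M ε x) 0 i = L[i]) ∧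
      ∀ (i : ℕ) (hi : i < M.length), ivl (intervalInput L M ε x) 2 i = M[i] := by
  constructor <;> intro i hi <;> simp [ivl, intervalInput, hi]

/-- Adding a root edge in linear time. -/
theorem exists_shift_algorithm : ∃ (P : Prog) (C : ℕ),
    ∀ (V : Type u) [Finite V] (T' : SimpleGraph V), T'.IsTree →
    ∀ (w : Sym2 V → ℝ≥0) (ε : ℝ) (p u : V) (hu : u ∈ ({p}ᶜ : Set V)),
      (∀ v, T'.Adj p v ↔ v = u) →
      ∀ L : List (ℝ × ℝ),
        IsAscendingListOf L
          (errorRangeSet (T'.induce {p}ᶜ) (restrictWeight w {p}ᶜ) ε ⟨u, hu⟩) →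
        ∃ (t : ℕ) (s : State) (L' : List (ℝ × ℝ)),
          Runs P (intervalInput L [] ε (w s(p, u))) t s ∧
          t ≤ C * ({p}ᶜ : Set V).ncard ∧
          OutputsIntervals s L' ∧
          IsAscendingListOf L' (errorRangeSet T' w ε p) := by
  obtain ⟨C, hC⟩ := lin_shiftProg
  -- The time is at most `C * (L.length + 1)`, where the length is at most twice the number of
  -- vertices of the old tree, which is at least `1`.
  refine ⟨shiftProg, 3 * C, fun V _ T' hT w ε p u hu hadj L hL => ?_⟩
  have hclosed := pathClosed_compl_singleton hadj
  rw [errorRangeSet_induce hT (hclosed.isTree_induce hT ⟨u, hu⟩)] at hL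
  obtain ⟨hasc, hivs⟩ := asc_of_isAscendingListOf hL (ivl_intervalInput L [] ε (w s(p, u))).1
  have hlen : L.length ≤ 2 * ({p}ᶜ : Set V).ncard := by
    rw [← hasc.ncard_eq, hivs]
    exact ncard_minimals_ranges_le hT w ε hu
  have hpos : 0 < ({p}ᶜ : Set V).ncard := (Set.ncard_pos (Set.toFinite _)).2 ⟨u, hu⟩
  obtain ⟨t, s, hrun, ht, hs, hset⟩ := hC L.length (intervalInput L [] ε (w s(p, u)))
    ⟨hasc, le_rfl⟩
  obtain ⟨L', ho, hL'⟩ := exists_outputs hs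
  refine ⟨t, s, L', hrun, ht.trans ?_, ho, ?_⟩
  · rw [mul_comm 3 C, mul_assoc]
    exact Nat.mul_le_mul_left _ (by omega)
  · have hins : insert p ({p}ᶜ : Set V) = Set.univ := by
      rw [Set.insert_eq, Set.union_compl_self]
    have hsh := ranges_insert_eq_shiftSet hT (Set.toFinite _) hclosed (by simp) hu
      ((hadj u).2 rfl) w ε
    rw [hins] at hsh
    have := hset (ranges T' w ε {p}ᶜ u) (w s(p, u)).2 (admissible_ranges hT w ε hu)
      (hsh ▸ admissible_ranges hT w ε (Set.mem_univ p)) hivs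
    rw [this] at hL'
    rw [errorRangeSet_eq_minimals hT, hsh]
    exact hL'

/-- Merging two trees at the root in linear time. -/
theorem exists_hull_algorithm : ∃ (P : Prog) (C : ℕ),
    ∀ (V : Type u) [Finite V] (T : SimpleGraph V), T.IsTree →
    ∀ (w : Sym2 V → ℝ≥0) (ε : ℝ) (r : V) (A B : Set V) (hA : r ∈ A) (hB : r ∈ B),
      A ∪ B = Set.univ → A ∩ B = {r} → (T.induce A).IsTree → (T.induce B).IsTree →
      ∀ L₁ L₂ : List (ℝ × ℝ),
        IsAscendingListOf L₁ (errorRangeSet (T.induce A) (restrictWeight w A) ε ⟨r, hA⟩) →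
        IsAscendingListOf L₂ (errorRangeSet (T.induce B) (restrictWeight w B) ε ⟨r, hB⟩) →
        ∃ (t : ℕ) (s : State) (L : List (ℝ × ℝ)),
          Runs P (intervalInput L₁ L₂ ε 0) t s ∧
          t ≤ C * (A.ncard + B.ncard) ∧
          OutputsIntervals s L ∧
          IsAscendingListOf L (errorRangeSet T w ε r) := by
  obtain ⟨C, hC⟩ := lin_hullProg
  refine ⟨hullProg, 3 * C, fun V _ T hT w ε r A B hA hB hAB hAB' hTA hTB L₁ L₂ hL₁ hL₂ => ?_⟩
  rw [errorRangeSet_induce hT hTA] at hL₁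
  rw [errorRangeSet_induce hT hTB] at hL₂
  obtain ⟨hasc₁, hivs₁⟩ := asc_of_isAscendingListOf hL₁ (ivl_intervalInput L₁ L₂ ε 0).1
  obtain ⟨hasc₂, hivs₂⟩ := asc_of_isAscendingListOf hL₂ (ivl_intervalInput L₁ L₂ ε 0).2
  have hlen₁ : L₁.length ≤ 2 * A.ncard := by
    rw [← hasc₁.ncard_eq, hivs₁]
    exact ncard_minimals_ranges_le hT w ε hA
  have hlen₂ : L₂.length ≤ 2 * B.ncard := by
    rw [← hasc₂.ncard_eq, hivs₂]
    exact ncard_minimals_ranges_le hT w ε hB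
  have hpos : 0 < A.ncard := (Set.ncard_pos (Set.toFinite _)).2 ⟨r, hA⟩
  obtain ⟨t, s, hrun, ht, hs, hset⟩ := hC (L₁.length + L₂.length) (intervalInput L₁ L₂ ε 0)
    ⟨hasc₁, hasc₂, le_rfl⟩
  obtain ⟨L', ho, hL'⟩ := exists_outputs hs
  refine ⟨t, s, L', hrun, ht.trans ?_, ho, ?_⟩
  · rw [mul_comm 3 C, mul_assoc]
    exact Nat.mul_le_mul_left _ (by omega)
  · have hun := ranges_union hT (Set.toFinite A) (Set.toFinite B)
      (pathClosed_of_isTree_induce hT hTA) (pathClosed_of_isTree_induce hT hTB) hAB' w ε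
    have := hset (ranges T w ε A r) (ranges T w ε B r) (admissible_ranges hT w ε hA).finite
      (admissible_ranges hT w ε hB).finite hivs₁ hivs₂
    rw [this] at hL'
    rw [errorRangeSet_eq_minimals hT, ← hAB, hun]
    exact hL'

end RealRAM

/-! ### The decision algorithm: an ordering of the vertices in quadratic time. -/

namespace RealRAM

open Rounding

/-! ### Ordering the vertices of a tree -/

/-- Examine one edge; an edge with exactly one visited end point is stored in the natural variables
`54` (new vertex), `55` (visited vertex) and in the real variable `50` (weight). -/
def scanStep : Prog :=
  .seq
    (.cond (.natLt (.get 50 (.get 0 (.var 53))) (.get 50 (.get 1 (.var 53))))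
      (.seq (.setNat 54 (.get 0 (.var 53))) <| .seq (.setNat 55 (.get 1 (.var 53))) <|
        .setReal 50 (.get 50 (.var 53)))
      (.cond (.natLt (.get 50 (.get 1 (.var 53))) (.get 50 (.get 0 (.var 53))))
        (.seq (.setNat 54 (.get 1 (.var 53))) <| .seq (.setNat 55 (.get 0 (.var 53))) <|
          .setReal 50 (.get 50 (.var 53)))
        .skip))
    (.setNat 53 (.add (.var 53) (.const 1)))

/-- Examine all edges. -/
def scan : Prog := .seq (.setNat 53 (.const 0)) <| .loop (.natLt (.var 53) (.var 51)) scanStep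

/-- An edge with exactly one visited end point is stored in the variables. -/
def Found (s : State) : Prop :=
  ∃ i < s.nv 51, (s.nv 54 = s.na 0 i ∧ s.nv 55 = s.na 1 i ∨ s.nv 54 = s.na 1 i ∧ s.nv 55 = s.na 0 i) ∧
    s.na 50 (s.nv 54) < s.na 50 (s.nv 55) ∧ s.rv 50 = s.ra 50 i

/-- Later finds overwrite earlier ones, so the loop keeps the last edge whose ends have different
marks. The mark is smaller at the new vertex. -/
theorem lin_scan : Lin scan (fun m s => s.nv 51 ≤ m)
    (fun _ _ s' => (∃ i < s'.nv 51, s'.na 50 (s'.na 0 i) ≠ s'.na 50 (s'.na 1 i)) → Found s') := by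
  have h1 : Lin (.setNat 53 (.const 0)) (fun m s => s.nv 51 ≤ m)
      (fun m _ s => s.nv 51 ≤ m ∧ s.nv 53 = 0) :=
    Lin.of_run rfl fun m s h => by simpa [Prog.run, State.setNat, NExp.val] using h
  have h2 : Lin (.loop (.natLt (.var 53) (.var 51)) scanStep)
      (fun m s => s.nv 51 ≤ m ∧ s.nv 53 = 0)
      (fun _ _ s' => (∃ i < s'.nv 51, s'.na 50 (s'.na 0 i) ≠ s'.na 50 (s'.na 1 i)) →
        Found s') := by
    refine Lin.loop rfl 1 (fun _ s₀ k s => s.nv 53 + k = s.nv 51 ∧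
      ((∃ i < s.nv 53, s.na 50 (s.na 0 i) ≠ s.na 50 (s.na 1 i)) → Found s)) ?_ ?_ ?_
    · rintro m s ⟨hm, h53⟩
      refine ⟨s.nv 51, by omega, by omega, ?_⟩
      rintro ⟨i, hi, -⟩
      omega
    · rintro m s₀ k s - ⟨hk, hinv⟩ hb
      simp only [Test.Holds, NExp.val] at hb
      refine ⟨k - 1, by omega, ?_⟩
      by_cases hc : s.na 50 (s.na 0 (s.nv 53)) < s.na 50 (s.na 1 (s.nv 53))
      · have hrun : scanStep.run s = (((s.setNat 54 (s.na 0 (s.nv 53))).setNat 55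
            (s.na 1 (s.nv 53))).setReal 50 (s.ra 50 (s.nv 53))).setNat 53 (s.nv 53 + 1) := by
          simp [scanStep, Prog.run, Test.Holds, NExp.val, RExp.val, hc, State.setNat,
            State.setReal]
        rw [hrun]
        simp only [State.setNat, State.setReal, Found, Function.update_self, ne_eq,
          Nat.reduceEqDiff, not_false_eq_true, Function.update_of_ne]
        exact ⟨by omega, fun _ => ⟨s.nv 53, hb, Or.inl ⟨rfl, rfl⟩, hc, rfl⟩⟩
      by_cases hc' : s.na 50 (s.na 1 (s.nv 53)) < s.na 50 (s.na 0 (s.nv 53))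
      · have hrun : scanStep.run s = (((s.setNat 54 (s.na 1 (s.nv 53))).setNat 55
            (s.na 0 (s.nv 53))).setReal 50 (s.ra 50 (s.nv 53))).setNat 53 (s.nv 53 + 1) := by
          simp [scanStep, Prog.run, Test.Holds, NExp.val, RExp.val, hc, hc', State.setNat,
            State.setReal]
        rw [hrun]
        simp only [State.setNat, State.setReal, Found, Function.update_self, ne_eq,
          Nat.reduceEqDiff, not_false_eq_true, Function.update_of_ne]
        exact ⟨by omega, fun _ => ⟨s.nv 53, hb, Or.inr ⟨rfl, rfl⟩, hc', rfl⟩⟩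
      · have hrun : scanStep.run s = s.setNat 53 (s.nv 53 + 1) := by
          simp [scanStep, Prog.run, Test.Holds, NExp.val, hc, hc', State.setNat]
        rw [hrun]
        simp only [State.setNat, Found, Function.update_self, ne_eq,
          Nat.reduceEqDiff, not_false_eq_true, Function.update_of_ne]
        refine ⟨by omega, ?_⟩
        rintro ⟨i, hi, hne⟩
        rcases Nat.lt_succ_iff_lt_or_eq.1 hi with hi | rfl
        · exact hinv ⟨i, hi, hne⟩
        · omega
    · rintro m s₀ k s - ⟨hk, hinv⟩ hb
      simp only [Test.Holds, NExp.val] at hb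
      rwa [show s.nv 53 = s.nv 51 by omega] at hinv
  refine (Lin.seq h1 h2 fun _ _ _ _ _ h => h).mono (fun _ _ h => h) ?_
  rintro m s s' - - ⟨_, -, -, -, h⟩
  exact h

/-- Record the edge that was found. -/
def record : Prog :=
  .seq (.putNat 51 (.var 52) (.var 54)) <| .seq (.putNat 52 (.var 52) (.var 55)) <|
  .seq (.putReal 54 (.var 52) (.var 50)) <| .seq (.putNat 50 (.var 54) (.const 1)) <|
  .setNat 52 (.add (.var 52) (.const 1))

/-- Visit one more vertex. -/
def growStep : Prog := .seq scan record

/-- The effect of `record`. -/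
structure Recorded (s s' : State) : Prop where
  k : s'.nv 52 = s.nv 52 + 1
  child : s'.na 51 = Function.update (s.na 51) (s.nv 52) (s'.nv 54)
  parent : s'.na 52 = Function.update (s.na 52) (s.nv 52) (s'.nv 55)
  weight : s'.ra 54 = Function.update (s.ra 54) (s.nv 52) (s'.rv 50)
  visited : s'.na 50 = Function.update (s.na 50) (s'.nv 54) 1
  found : (∃ i < s.nv 51, s.na 50 (s.na 0 i) ≠ s.na 50 (s.na 1 i)) →
    ∃ i < s.nv 51, (s'.nv 54 = s.na 0 i ∧ s'.nv 55 = s.na 1 i ∨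
      s'.nv 54 = s.na 1 i ∧ s'.nv 55 = s.na 0 i) ∧
      s.na 50 (s'.nv 54) < s.na 50 (s'.nv 55) ∧ s'.rv 50 = s.ra 50 i

theorem lin_growStep : Lin growStep (fun m s => s.nv 51 ≤ m) (fun _ s s' => Recorded s s') := by
  have h2 : Lin record (fun _ _ => True) (fun _ s s' => s' = record.run s) :=
    Lin.of_run rfl fun _ _ _ => rfl
  refine (Lin.seq lin_scan h2 fun _ _ _ _ _ _ => trivial).mono (fun _ _ h => h) ?_
  rintro m s s'' - - ⟨s', f, hfound, -, rfl⟩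
  have e51 := f.nv 51 (by decide)
  have e52 := f.nv 52 (by decide)
  have a0 := f.na 0 (by decide)
  have a1 := f.na 1 (by decide)
  have a50 := f.na 50 (by decide)
  have a51 := f.na 51 (by decide)
  have a52 := f.na 52 (by decide)
  have r54 := f.ra 54 (by decide)
  have r50 := f.ra 50 (by decide)
  rw [Found, e51, a0, a1, a50, r50] at hfound
  constructor <;>
    simp [record, Prog.run, NExp.val, RExp.val, State.setNat, State.putNat, State.putReal, e52,
      a50, a51, a52, r54]
  intro i hi hne
  exact hfound ⟨i, hi, hne⟩

/-- Visit all vertices. -/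
def grow : Prog := .loop (.natLt (.add (.var 52) (.const 1)) (.var 50)) growStep

section Order

variable {n : ℕ}

/-- The vertex `0` and the first `k` vertices listed by `c`. -/
def reached (n : ℕ) (c : ℕ → ℕ) (k : ℕ) : Set (Fin n) := {v | (v : ℕ) = 0 ∨ ∃ j < k, c j = v}

theorem reached_succ {c : ℕ → ℕ} {k : ℕ} {x : Fin n} (h : c k = x) :
    reached n c (k + 1) = insert x (reached n c k) := by
  ext v
  constructor
  · rintro (hv | ⟨j, hj, hv⟩)
    · exact Or.inr (Or.inl hv)
    · rcases Nat.lt_succ_iff_lt_or_eq.1 hj with hj | rfl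
      · exact Or.inr (Or.inr ⟨j, hj, hv⟩)
      · exact Or.inl (Fin.ext (hv.symm.trans h))
  · rintro (rfl | hv | ⟨j, hj, hv⟩)
    · exact Or.inr ⟨k, by omega, h⟩
    · exact Or.inl hv
    · exact Or.inr ⟨j, by omega, hv⟩

theorem reached_congr {c c' : ℕ → ℕ} {k : ℕ} (h : ∀ j < k, c' j = c j) :
    reached n c' k = reached n c k := by
  ext v
  refine or_congr_right (exists_congr fun j => and_congr_right fun hj => ?_)
  rw [h j hj]

/-- The first `k` listed vertices and their parents are obtained by growing a subtree. -/
def Grown (T : SimpleGraph (Fin n)) (w : Sym2 (Fin n) → ℝ≥0) (c p : ℕ → ℕ) (wt : ℕ → ℝ) (k : ℕ) :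
    Prop :=
  ∀ j < k, ∃ x y : Fin n, c j = x ∧ p j = y ∧ wt j = w s(x, y) ∧ T.Adj x y ∧
    x ∉ reached n c j ∧ y ∈ reached n c j

/-- Every listed vertex is new when it is listed. Counting thus tells whether vertices are missing:
all are reached exactly when `k + 1 = n`. -/
theorem Grown.ncard_reached {T : SimpleGraph (Fin n)} {w : Sym2 (Fin n) → ℝ≥0} {c p : ℕ → ℕ}
    {wt : ℕ → ℝ} {k : ℕ} (hn : 0 < n) (h : Grown T w c p wt k) :
    (reached n c k).ncard = k + 1 := by
  induction k with
  | zero =>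
    have : reached n c 0 = {⟨0, hn⟩} := by
      ext v; simp [reached, Fin.ext_iff]
    rw [this, Set.ncard_singleton]
  | succ k ih =>
    obtain ⟨x, y, hx, -, -, -, hxn, -⟩ := h k (by omega)
    rw [reached_succ hx, Set.ncard_insert_of_notMem hxn (Set.toFinite _),
      ih fun j hj => h j (by omega)]

theorem Grown.succ {T : SimpleGraph (Fin n)} {w : Sym2 (Fin n) → ℝ≥0} {c p : ℕ → ℕ}
    {wt : ℕ → ℝ} {k : ℕ} (h : Grown T w c p wt k) {x y : Fin n} (hadj : T.Adj x y)
    (hx : x ∉ reached n c k) (hy : y ∈ reached n c k) :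
    Grown T w (Function.update c k x) (Function.update p k y)
      (Function.update wt k (w s(x, y))) (k + 1) := by
  intro j hj
  have hr : reached n (Function.update c k x) j = reached n c j :=
    reached_congr fun i hi => Function.update_of_ne (by omega) _ _
  rw [hr]
  rcases Nat.lt_succ_iff_lt_or_eq.1 hj with hj | rfl
  · simp only [Function.update_of_ne hj.ne]
    exact h j hj
  · exact ⟨x, y, by simp, by simp, by simp, hadj, hx, hy⟩

/-- The state during the growing phase. -/
structure GrowInv (T : SimpleGraph (Fin n)) (w : Sym2 (Fin n) → ℝ≥0) (s₀ s : State) : Prop where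
  size : s.nv 50 = n
  m : s.nv 51 = s₀.nv 51
  e : s.na 0 = s₀.na 0
  e' : s.na 1 = s₀.na 1
  wts : s.ra 50 = s₀.ra 50
  ε : s.rv 0 = s₀.rv 0
  lt : s.nv 52 < n
  grown : Grown T w (s.na 51) (s.na 52) (s.ra 54) (s.nv 52)
  mem : ∀ v : Fin n, v ∈ reached n (s.na 51) (s.nv 52) → s.na 50 v = 1
  notMem : ∀ v : Fin n, v ∉ reached n (s.na 51) (s.nv 52) → s.na 50 v = 0

/-- The edge list in memory. -/
structure EdgesIn (T : SimpleGraph (Fin n)) (w : Sym2 (Fin n) → ℝ≥0) (s : State) : Prop where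
  edge : ∀ i < s.nv 51, ∃ a b : Fin n, s.na 0 i = a ∧ s.na 1 i = b ∧ T.Adj a b ∧
    s.ra 50 i = w s(a, b)
  all : ∀ a b : Fin n, T.Adj a b → ∃ i < s.nv 51, s.na 0 i = a ∧ s.na 1 i = b ∨
    s.na 0 i = b ∧ s.na 1 i = a

/-- While vertices are missing, connectedness provides an edge that leaves the reached set, so the
scan finds one; its unreached end is appended with the reached end as parent. -/
theorem GrowInv.step {T : SimpleGraph (Fin n)} (hT : T.IsTree) {w : Sym2 (Fin n) → ℝ≥0}
    {s₀ s s' : State} (he : EdgesIn T w s₀) (h : GrowInv T w s₀ s) (hlt : s.nv 52 + 1 < n)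
    (hf : SameOutside growStep s s') (hr : Recorded s s') : GrowInv T w s₀ s' := by
  obtain ⟨hn, hm, e, e', wts, hε, -, grown, mem, notMem⟩ := h
  have hcross : ∃ i < s.nv 51, s.na 50 (s.na 0 i) ≠ s.na 50 (s.na 1 i) := by
    obtain ⟨v, hv⟩ : ∃ v, v ∉ reached n (s.na 51) (s.nv 52) := by
      by_contra hall
      push Not at hall
      have h1 := grown.ncard_reached (by omega)
      rw [Set.eq_univ_of_forall hall, Set.ncard_univ, Nat.card_fin] at h1
      omega
    obtain ⟨q⟩ := hT.connected (⟨0, by omega⟩ : Fin n) v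
    -- A walk from vertex `0` to an unreached vertex must cross the boundary.
    obtain ⟨d, -, hd1, hd2⟩ := q.exists_boundary_dart _ (Or.inl rfl) hv
    obtain ⟨i, hi, hab⟩ := he.all _ _ d.adj
    refine ⟨i, by omega, ?_⟩
    rw [e, e']
    have h1 := mem _ hd1
    have h2 := notMem _ hd2
    rcases hab with ⟨ha, hb⟩ | ⟨ha, hb⟩ <;> rw [ha, hb, h1, h2] <;> norm_num
  obtain ⟨i, hi, hcase, hvis, hwt⟩ := hr.found hcross
  obtain ⟨a, b, ha, hb, hadj, hw⟩ := he.edge i (by omega)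
  rw [e, e', ha, hb] at hcase
  obtain ⟨x, y, hx, hy, hxy, hwxy⟩ : ∃ x y : Fin n, s'.nv 54 = x ∧ s'.nv 55 = y ∧ T.Adj x y ∧
      s'.rv 50 = w s(x, y) := by
    rcases hcase with ⟨h1, h2⟩ | ⟨h1, h2⟩
    · exact ⟨a, b, h1, h2, hadj, by rw [hwt, wts, hw]⟩
    · exact ⟨b, a, h1, h2, hadj.symm, by rw [hwt, wts, hw, Sym2.eq_swap]⟩
  rw [hx, hy] at hvis
  have hxn : x ∉ reached n (s.na 51) (s.nv 52) := by
    intro hx'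
    rw [mem x hx'] at hvis
    by_cases hy' : y ∈ reached n (s.na 51) (s.nv 52)
    · rw [mem y hy'] at hvis; omega
    · rw [notMem y hy'] at hvis; omega
  have hyr : y ∈ reached n (s.na 51) (s.nv 52) := by
    by_contra hy'
    rw [notMem y hy'] at hvis
    omega
  have hreach : reached n (s'.na 51) (s'.nv 52) = insert x (reached n (s.na 51) (s.nv 52)) := by
    rw [hr.k, reached_succ (x := x) (by rw [hr.child, Function.update_self, hx])]
    congr 1
    exact reached_congr fun j hj => by rw [hr.child, Function.update_of_ne hj.ne]
  refine ⟨(hf.nv 50 (by decide)).trans hn, (hf.nv 51 (by decide)).trans hm,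
    (hf.na 0 (by decide)).trans e, (hf.na 1 (by decide)).trans e', (hf.ra 50 (by decide)).trans wts,
    (hf.rv 0 (by decide)).trans hε, by rw [hr.k]; exact hlt, ?_, ?_, ?_⟩
  · rw [hr.k, hr.child, hr.parent, hr.weight, hx, hy, hwxy]
    exact grown.succ hxy hxn hyr
  · intro v hv
    rw [hreach] at hv
    rw [hr.visited, hx, Function.update_apply]
    split_ifs with hvx
    · rfl
    · rcases hv with rfl | hv
      · exact absurd rfl hvx
      · exact mem v hv
  · intro v hv
    rw [hreach, Set.mem_insert_iff, not_or] at hv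
    rw [hr.visited, hx, Function.update_of_ne fun h => hv.1 (Fin.ext h)]
    exact notMem v hv.2

/-- The measure is the number of unreached vertices, and each costs one scan of at most `n` edges.
-/
theorem exists_runs_grow : ∃ C, ∀ (n : ℕ) (T : SimpleGraph (Fin n)), T.IsTree →
    ∀ (w : Sym2 (Fin n) → ℝ≥0) (s : State), EdgesIn T w s → s.nv 51 ≤ n → GrowInv T w s s →
    ∃ t s', Runs grow s t s' ∧ t ≤ C * n ^ 2 ∧ GrowInv T w s s' ∧ s'.nv 52 + 1 = n := by
  obtain ⟨C, hC⟩ := lin_growStep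
  let b : Test := .natLt (.add (.var 52) (.const 1)) (.var 50)
  refine ⟨2 * C + 2 * (b.cost + 1), fun n T hT w s he hm hinv => ?_⟩
  obtain ⟨t, s', hrun, ht, ⟨k', hk', hinv'⟩, hnb⟩ := exists_runs_loop (b := b) (P := growStep)
    (fun k s' => s'.nv 52 + 1 + k = n ∧ GrowInv T w s s') (C * (n + 1)) (by
      rintro k s₁ ⟨hk, h⟩ hb
      simp only [b, Test.Holds, NExp.val, h.size] at hb
      obtain ⟨t, s₂, hrun, ht, hrec⟩ := hC n s₁ (h.m.le.trans hm)
      have h2 := h.step hT he hb hrun.sameOutside hrec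
      refine ⟨t, s₂, hrun, ht, k - 1, by omega, ?_, h2⟩
      rw [hrec.k]; omega) (n - (s.nv 52 + 1)) s ⟨by have := hinv.lt; omega, hinv⟩
  refine ⟨t, s', hrun, ht.trans ?_, hinv', ?_⟩
  · have hn := hinv.lt
    have h1 : (C * (n + 1) + b.cost + 1) * (n - (s.nv 52 + 1)) ≤
        (C * (n + 1) + b.cost + 1) * n := Nat.mul_le_mul_left _ (by omega)
    have h2 : 1 ≤ n := by omega
    have h3 : n ≤ n ^ 2 := by nlinarith
    nlinarith [Nat.mul_le_mul_left C h3, Nat.mul_le_mul_left (b.cost + 1) h3,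
      Nat.mul_le_mul_left (b.cost + 1) (h2.trans h3)]
  · simp only [b, Test.Holds, NExp.val, hinv'.size] at hnb
    have := hinv'.lt
    omega

end Order

end RealRAM

/-! ### The decision algorithm: a table of interval lists, one for each remaining subtree. -/

namespace RealRAM

open Rounding

/-! ### A table of lists of intervals -/

/-- The set of the intervals at the positions `o, …, o + n - 1` of the real arrays `a`, `a + 1`. -/
def ivsAt (s : State) (a o n : ℕ) : Set (ℝ × ℝ) := {I | ∃ i < n, I = ivl s a (o + i)}

/-- The lower bounds at the positions `o, …, o + n - 1` are strictly ascending. -/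
def AscAt (s : State) (a o n : ℕ) : Prop :=
  ∀ i j, i < j → j < n → s.ra a (o + i) < s.ra a (o + j)

theorem Copied.asc_of_ascAt {a b o n : ℕ} {s s' : State} (h : Copied a b o 0 n s s')
    (hA : AscAt s a o n) : Asc s' b n := by
  intro i j hij hj
  have h1 := congrArg Prod.fst (h.new i (hij.trans hj))
  have h2 := congrArg Prod.fst (h.new j hj)
  simp only [ivl, zero_add] at h1 h2
  rw [h1, h2]
  exact hA i j hij hj

theorem Copied.ascAt {a b o n : ℕ} {s s' : State} (h : Copied a b 0 o n s s')
    (hA : Asc s a n) : AscAt s' b o n := by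
  intro i j hij hj
  have h1 := congrArg Prod.fst (h.new i (hij.trans hj))
  have h2 := congrArg Prod.fst (h.new j hj)
  simp only [ivl, zero_add] at h1 h2
  rw [h1, h2]
  exact hA i j hij hj

theorem Copied.ivs_eq_ivsAt {a b o n : ℕ} {s s' : State} (h : Copied a b o 0 n s s') :
    ivs s' b n = ivsAt s a o n := by
  ext I
  refine exists_congr fun i => and_congr_right fun hi => ?_
  rw [← h.new i hi, zero_add]

theorem Copied.ivsAt_eq {a b o n : ℕ} {s s' : State} (h : Copied a b 0 o n s s') :
    ivsAt s' b o n = ivs s a n := by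
  ext I
  refine exists_congr fun i => and_congr_right fun hi => ?_
  rw [h.new i hi, zero_add]

theorem AscAt.congr {a o n : ℕ} {s s' : State} (hA : AscAt s a o n)
    (h : ∀ i < n, ivl s' a (o + i) = ivl s a (o + i)) : AscAt s' a o n := by
  intro i j hij hj
  have h1 := congrArg Prod.fst (h i (hij.trans hj))
  have h2 := congrArg Prod.fst (h j hj)
  simp only [ivl] at h1 h2
  rw [h1, h2]
  exact hA i j hij hj

theorem ivsAt_congr {a o n : ℕ} {s s' : State}
    (h : ∀ i < n, ivl s' a (o + i) = ivl s a (o + i)) : ivsAt s' a o n = ivsAt s a o n := by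
  ext I
  refine exists_congr fun i => and_congr_right fun hi => ?_
  rw [h i hi]

theorem AscAt.ncard_eq {a o n : ℕ} {s : State} (hA : AscAt s a o n) :
    (ivsAt s a o n).ncard = n :=
  -- A list at offset `o` is a list at offset `0` in a memory with shifted addresses.
  Asc.ncard_eq (s := { s with ra := fun b i => s.ra b (o + i) }) (a := a) hA

/-- Load the list of the child and add the edge to the parent. -/
def absorbShift : Prog :=
  .seq (.seq (.setNat 52 (.sub (.var 52) (.const 1))) <| .seq (.setNat 54 (.get 51 (.var 52))) <|
    .seq (.setNat 55 (.get 52 (.var 52))) <| .seq (.setNat 10 (.get 54 (.var 54)))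
    (.setReal 1 (.get 54 (.var 52)))) <|
  .seq (copy 52 10 (.get 53 (.var 54)) (.const 0) (.var 10)) <|
  .seq shiftCore <| .seq (copy 20 10 (.const 0) (.const 0) (.var 12)) <|
  .seq (.setNat 10 (.var 12)) (.setNat 11 (.get 54 (.var 55)))

/-- Load the list of the parent, merge, and store the result. -/
def absorbHull : Prog :=
  .seq (copy 52 12 (.get 53 (.var 55)) (.const 0) (.var 11)) <|
  .seq hullCore <| .seq (copy 24 52 (.const 0) (.get 53 (.var 55)) (.var 14))
  (.putNat 54 (.var 55) (.var 14))

theorem lin_absorbShift : Lin absorbShift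
    (fun m s => AscAt s 52 (s.na 53 (s.na 51 (s.nv 52 - 1))) (s.na 54 (s.na 51 (s.nv 52 - 1))) ∧
      s.na 54 (s.na 51 (s.nv 52 - 1)) ≤ m)
    (fun m s s' => s'.nv 52 = s.nv 52 - 1 ∧ s'.nv 55 = s.na 52 (s.nv 52 - 1) ∧
      s'.nv 11 = s.na 54 (s.na 52 (s.nv 52 - 1)) ∧ Asc s' 10 (s'.nv 10) ∧ s'.nv 10 ≤ 4 * m ∧
      ∀ R, 0 ≤ s.ra 54 (s.nv 52 - 1) → Admissible (s.rv 0) R →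
        Admissible (s.rv 0) (shiftSet (s.rv 0) (s.ra 54 (s.nv 52 - 1)) R) →
        ivsAt s 52 (s.na 53 (s.na 51 (s.nv 52 - 1))) (s.na 54 (s.na 51 (s.nv 52 - 1))) =
          minimals R →
        ivs s' 10 (s'.nv 10) = minimals (shiftSet (s.rv 0) (s.ra 54 (s.nv 52 - 1)) R)) := by
  have h1 : Lin (.seq (.setNat 52 (.sub (.var 52) (.const 1))) <| .seq (.setNat 54 (.get 51 (.var 52))) <|
      .seq (.setNat 55 (.get 52 (.var 52))) <| .seq (.setNat 10 (.get 54 (.var 54)))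
      (.setReal 1 (.get 54 (.var 52))))
      (fun m s => AscAt s 52 (s.na 53 (s.na 51 (s.nv 52 - 1))) (s.na 54 (s.na 51 (s.nv 52 - 1))) ∧
        s.na 54 (s.na 51 (s.nv 52 - 1)) ≤ m)
      (fun _ s s' => s'.nv 52 = s.nv 52 - 1 ∧ s'.nv 54 = s.na 51 (s.nv 52 - 1) ∧
        s'.nv 55 = s.na 52 (s.nv 52 - 1) ∧ s'.nv 10 = s.na 54 (s.na 51 (s.nv 52 - 1)) ∧
        s'.rv 1 = s.ra 54 (s.nv 52 - 1)) :=
    Lin.of_run rfl fun m s _ => by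
      simp [Prog.run, State.setNat, State.setReal, NExp.val, RExp.val]
  have hlast : Lin (.seq (.setNat 10 (.var 12)) (.setNat 11 (.get 54 (.var 55)))) (fun _ _ => True)
      (fun _ s s' => s'.nv 10 = s.nv 12 ∧ s'.nv 11 = s.na 54 (s.nv 55)) :=
    Lin.of_run rfl fun m s _ => by simp [Prog.run, State.setNat, NExp.val]
  have c1 : Lin (copy 52 10 (.get 53 (.var 54)) (.const 0) (.var 10)) (fun m s => s.nv 10 ≤ m)
      (fun _ s s' => Copied 52 10 (s.na 53 (s.nv 54)) 0 (s.nv 10) s s') :=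
    lin_copy 52 10 (by norm_num) (by norm_num) (by norm_num) (NExp.stable_const 0)
      (NExp.stable_var (by norm_num))
  have c2 := lin_copy_zero 20 10 12 (by norm_num) (by norm_num) (by norm_num) (by norm_num)
  refine (Lin.seq h1 (Lin.seq (c1.mono (Pre' := fun m s => s.nv 10 ≤ m ∧
    AscAt s 52 (s.na 53 (s.nv 54)) (s.nv 10)) (fun _ _ h => h.1) fun _ _ _ _ _ h => h)
    (Lin.seq lin_shiftCore (Lin.seq ((c2.scale 4).mono (Pre' := fun m s => s.nv 12 ≤ 4 * m)
    (fun _ _ h => h) fun _ _ _ _ _ h => h) hlast fun _ _ _ _ _ _ => trivial) ?_) ?_) ?_).mono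
    (fun _ _ h => h) ?_
  · rintro m s s' ⟨h1, h2⟩ - ⟨-, h3, -⟩
    omega
  · rintro m s s' ⟨h1, h2⟩ hf h
    rw [hf.nv 10 (by decide)]
    exact ⟨h.asc_of_ascAt h2, h1⟩
  · rintro m s s' ⟨h1, h2⟩ hf ⟨-, k2, -, k4, -⟩
    rw [k4, k2, hf.na 53 (by decide)]
    refine ⟨h2, h1.congr fun i _ => ?_⟩
    simp only [ivl, hf.ra 52 (by decide), hf.ra (52 + 1) (by decide)]
  · rintro m s s₅ ⟨-, hm⟩ - ⟨s₁, f₁, ⟨k1, k2, k3, k4, k5⟩, -, s₂, f₂, hc, -, s₃, f₃, ⟨a1, a2, a3⟩, -,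
      s₄, f₄, hc', f₅, l1, l2⟩
    have e12 : s₄.nv 12 = s₃.nv 12 := f₄.nv 12 (by decide)
    have e10 : s₂.nv 10 = s₁.nv 10 := f₂.nv 10 (by decide)
    have e55 : s₄.nv 55 = s.na 52 (s.nv 52 - 1) := by
      rw [f₄.nv 55 (by decide), f₃.nv 55 (by decide), f₂.nv 55 (by decide), k3]
    refine ⟨?_, ?_, ?_, ?_, by omega, fun R hx hR hR' hs => ?_⟩
    · rw [f₅.nv 52 (by decide), f₄.nv 52 (by decide), f₃.nv 52 (by decide), f₂.nv 52 (by decide),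
        k1]
    · rw [f₅.nv 55 (by decide), e55]
    · rw [l2, e55, f₄.na 54 (by decide), f₃.na 54 (by decide), f₂.na 54 (by decide),
        f₁.na 54 (by decide)]
    · rw [l1, e12]
      exact (hc'.asc a1).of_ra (f₅.ra 10 (by decide))
    · have hi : ivs s₂ 10 (s₂.nv 10) = minimals R := by
        rw [e10, hc.ivs_eq_ivsAt, k2, k4, f₁.na 53 (by decide), ← hs]
        refine ivsAt_congr fun i _ => ?_
        simp only [ivl, f₁.ra 52 (by decide), f₁.ra (52 + 1) (by decide)]
      rw [f₂.rv 0 (by decide), f₁.rv 0 (by decide), f₂.rv 1 (by decide), k5] at a3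
      rw [l1, e12, ivs_eq_of_ra (f₅.ra 10 (by decide)) (f₅.ra (10 + 1) (by decide)), hc'.ivs_eq]
      exact a3 R hx hR hR' hi

theorem lin_absorbHull : Lin absorbHull
    (fun m s => AscAt s 52 (s.na 53 (s.nv 55)) (s.nv 11) ∧ Asc s 10 (s.nv 10) ∧
      s.nv 10 + s.nv 11 ≤ m)
    (fun _ s s' => AscAt s' 52 (s.na 53 (s.nv 55)) (s'.na 54 (s.nv 55)) ∧
      (∀ v, v ≠ s.nv 55 → s'.na 54 v = s.na 54 v) ∧
      (∀ j, j < s.na 53 (s.nv 55) ∨ s.na 53 (s.nv 55) + s'.na 54 (s.nv 55) ≤ j →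
        ivl s' 52 j = ivl s 52 j) ∧
      ∀ R S : Set (ℝ × ℝ), R.Finite → S.Finite → ivs s 10 (s.nv 10) = minimals R →
        ivsAt s 52 (s.na 53 (s.nv 55)) (s.nv 11) = minimals S →
        ivsAt s' 52 (s.na 53 (s.nv 55)) (s'.na 54 (s.nv 55)) = minimals (hullSet (s.rv 0) R S)) := by
  have hlast : Lin (.putNat 54 (.var 55) (.var 14)) (fun _ _ => True)
      (fun _ s s' => s'.na 54 = Function.update (s.na 54) (s.nv 55) (s.nv 14)) :=
    Lin.of_run rfl fun m s _ => by simp [Prog.run, State.putNat, NExp.val]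
  have c1 : Lin (copy 52 12 (.get 53 (.var 55)) (.const 0) (.var 11)) (fun m s => s.nv 11 ≤ m)
      (fun _ s s' => Copied 52 12 (s.na 53 (s.nv 55)) 0 (s.nv 11) s s') :=
    lin_copy 52 12 (by norm_num) (by norm_num) (by norm_num) (NExp.stable_const 0)
      (NExp.stable_var (by norm_num))
  have c2 : Lin (copy 24 52 (.const 0) (.get 53 (.var 55)) (.var 14)) (fun m s => s.nv 14 ≤ m)
      (fun _ s s' => Copied 24 52 0 (s.na 53 (s.nv 55)) (s.nv 14) s s') :=
    lin_copy 24 52 (by norm_num) (by norm_num) (by norm_num)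
      (NExp.stable_get (NExp.stable_var (by norm_num))) (NExp.stable_var (by norm_num))
  refine (Lin.seq (c1.mono (Pre' := fun m s => AscAt s 52 (s.na 53 (s.nv 55)) (s.nv 11) ∧
    Asc s 10 (s.nv 10) ∧ s.nv 10 + s.nv 11 ≤ m) (fun _ _ h => by omega) fun _ _ _ _ _ h => h)
    (Lin.seq lin_hullCore (Lin.seq c2 hlast fun _ _ _ _ _ _ => trivial) ?_) ?_).mono
    (fun _ _ h => h) ?_
  · rintro m s s' ⟨h1, h2, h3⟩ - ⟨-, h4, -⟩
    omega
  · rintro m s s' ⟨h1, h2, h3⟩ hf h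
    have e10 := hf.nv 10 (by decide)
    have e11 := hf.nv 11 (by decide)
    rw [TwoLists, e10, e11]
    exact ⟨h2.of_ra (hf.ra 10 (by decide)), h.asc_of_ascAt h1, h3⟩
  · rintro m s s₄ - - ⟨s₁, f₁, hc, -, s₂, f₂, ⟨a1, a2, a3⟩, -, s₃, f₃, hc', f₄, hl⟩
    have e55 : s₂.nv 55 = s.nv 55 := by rw [f₂.nv 55 (by decide), f₁.nv 55 (by decide)]
    have e55' : s₃.nv 55 = s.nv 55 := by rw [f₃.nv 55 (by decide), e55]
    have e53 : s₂.na 53 = s.na 53 := by rw [f₂.na 53 (by decide), f₁.na 53 (by decide)]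
    have e54 : s₃.na 54 = s.na 54 := by
      rw [f₃.na 54 (by decide), f₂.na 54 (by decide), f₁.na 54 (by decide)]
    have e14 : s₃.nv 14 = s₂.nv 14 := f₃.nv 14 (by decide)
    have hlen : s₄.na 54 (s.nv 55) = s₂.nv 14 := by rw [hl, e55', Function.update_self, e14]
    have hivl : ∀ j, ivl s₄ 52 j = ivl s₃ 52 j := fun j => by
      simp only [ivl, f₄.ra 52 (by decide), f₄.ra (52 + 1) (by decide)]
    rw [e55, e53] at hc'
    rw [hlen]
    refine ⟨(hc'.ascAt a1).congr fun i _ => hivl _, fun v hv => ?_, fun j hj => ?_,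
      fun R S hR hS hsR hsS => ?_⟩
    · rw [hl, e55', Function.update_of_ne hv, e54]
    · rw [hivl, hc'.old j hj]
      simp only [ivl, f₂.ra 52 (by decide), f₂.ra (52 + 1) (by decide), f₁.ra 52 (by decide),
        f₁.ra (52 + 1) (by decide)]
    · rw [ivsAt_congr fun i _ => hivl _, hc'.ivsAt_eq]
      rw [f₁.rv 0 (by decide), f₁.nv 10 (by decide), f₁.nv 11 (by decide),
        ivs_eq_of_ra (f₁.ra 10 (by decide)) (f₁.ra (10 + 1) (by decide)), hc.ivs_eq_ivsAt] at a3
      exact a3 R S hR hS hsR hsS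

/-- Absorb the last vertex into its parent. -/
def absorbStep : Prog := .seq absorbShift absorbHull

/-- The specification of `absorbStep` for the child `c`, its parent `u` and the edge weight `x`. -/
theorem lin_absorbStep : Lin absorbStep
    (fun m s => AscAt s 52 (s.na 53 (s.na 51 (s.nv 52 - 1))) (s.na 54 (s.na 51 (s.nv 52 - 1))) ∧
      s.na 54 (s.na 51 (s.nv 52 - 1)) ≤ m ∧
      AscAt s 52 (s.na 53 (s.na 52 (s.nv 52 - 1))) (s.na 54 (s.na 52 (s.nv 52 - 1))) ∧
      s.na 54 (s.na 52 (s.nv 52 - 1)) ≤ m)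
    (fun _ s s' => s'.nv 52 = s.nv 52 - 1 ∧
      AscAt s' 52 (s.na 53 (s.na 52 (s.nv 52 - 1))) (s'.na 54 (s.na 52 (s.nv 52 - 1))) ∧
      (∀ v, v ≠ s.na 52 (s.nv 52 - 1) → s'.na 54 v = s.na 54 v) ∧
      (∀ j, j < s.na 53 (s.na 52 (s.nv 52 - 1)) ∨
        s.na 53 (s.na 52 (s.nv 52 - 1)) + s'.na 54 (s.na 52 (s.nv 52 - 1)) ≤ j →
        ivl s' 52 j = ivl s 52 j) ∧
      ∀ R S, 0 ≤ s.ra 54 (s.nv 52 - 1) → Admissible (s.rv 0) R →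
        Admissible (s.rv 0) (shiftSet (s.rv 0) (s.ra 54 (s.nv 52 - 1)) R) → S.Finite →
        ivsAt s 52 (s.na 53 (s.na 51 (s.nv 52 - 1))) (s.na 54 (s.na 51 (s.nv 52 - 1))) =
          minimals R →
        ivsAt s 52 (s.na 53 (s.na 52 (s.nv 52 - 1))) (s.na 54 (s.na 52 (s.nv 52 - 1))) =
          minimals S →
        ivsAt s' 52 (s.na 53 (s.na 52 (s.nv 52 - 1))) (s'.na 54 (s.na 52 (s.nv 52 - 1))) =
          minimals (hullSet (s.rv 0) (shiftSet (s.rv 0) (s.ra 54 (s.nv 52 - 1)) R) S)) := by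
  refine (Lin.seq (lin_absorbShift.mono (Pre' := fun m s =>
      AscAt s 52 (s.na 53 (s.na 51 (s.nv 52 - 1))) (s.na 54 (s.na 51 (s.nv 52 - 1))) ∧
      s.na 54 (s.na 51 (s.nv 52 - 1)) ≤ m ∧
      AscAt s 52 (s.na 53 (s.na 52 (s.nv 52 - 1))) (s.na 54 (s.na 52 (s.nv 52 - 1))) ∧
      s.na 54 (s.na 52 (s.nv 52 - 1)) ≤ m) (fun _ _ h => ⟨h.1, h.2.1⟩) fun _ _ _ _ _ h => h)
    -- The shifted list of the child is only known to have at most `4 * m` elements here, and the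
    -- list of the parent has at most `m`.
    ((lin_absorbHull.scale 5).mono (Pre' := fun m s => AscAt s 52 (s.na 53 (s.nv 55)) (s.nv 11) ∧
      Asc s 10 (s.nv 10) ∧ s.nv 10 + s.nv 11 ≤ 5 * m) (fun _ _ h => h) fun _ _ _ _ _ h => h)
    ?_).mono (fun _ _ h => h) ?_
  · rintro m s s' ⟨h1, h2, h3, h4⟩ hf ⟨k1, k2, k3, k4, k5, -⟩
    rw [k2, k3, hf.na 53 (by decide)]
    refine ⟨h3.congr fun i _ => ?_, k4, by omega⟩
    simp only [ivl, hf.ra 52 (by decide), hf.ra (52 + 1) (by decide)]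
  · rintro m s s₂ - - ⟨s₁, f₁, ⟨k1, k2, k3, k4, k5, k6⟩, f₂, a1, a2, a3, a4⟩
    have e53 := f₁.na 53 (by decide)
    have e54 := f₁.na 54 (by decide)
    rw [k2, e53] at a1 a3 a4
    rw [k2, e54] at a2
    have hivl : ∀ j, ivl s₁ 52 j = ivl s 52 j := fun j => by
      simp only [ivl, f₁.ra 52 (by decide), f₁.ra (52 + 1) (by decide)]
    refine ⟨(f₂.nv 52 (by decide)).trans k1, a1, a2, fun j hj => (a3 j hj).trans (hivl j),
      fun R S hx hR hR' hS hsR hsS => ?_⟩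
    rw [f₁.rv 0 (by decide), k3, ivsAt_congr fun i _ => hivl _] at a4
    exact a4 _ S hR'.finite hS (k6 R hx hR hR' hsR) hsS

end RealRAM

/-! ### The decision algorithm: absorbing the vertices into their parents. -/

namespace RealRAM

open Rounding

/-! ### Deciding the existence of a rounding -/

/-- Prepare the memory for `grow`. -/
def setup : Prog :=
  .seq (.seq (.setNat 50 (.var 0)) (.setNat 51 (.var 1))) <|
  .seq (copy 0 50 (.const 0) (.const 0) (.var 51)) (.putNat 50 (.const 0) (.const 1))

theorem lin_setup : Lin setup (fun m s => s.nv 1 ≤ m)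
    (fun _ s s' => s'.nv 50 = s.nv 0 ∧ s'.nv 51 = s.nv 1 ∧
      s'.na 50 = Function.update (s.na 50) 0 1 ∧ ∀ i < s.nv 1, s'.ra 50 i = s.ra 0 i) := by
  have h1 : Lin (.seq (.setNat 50 (.var 0)) (.setNat 51 (.var 1))) (fun m s => s.nv 1 ≤ m)
      (fun _ s s' => s'.nv 50 = s.nv 0 ∧ s'.nv 51 = s.nv 1) :=
    Lin.of_run rfl fun m s _ => by simp [Prog.run, State.setNat, NExp.val]
  have h2 : Lin (copy 0 50 (.const 0) (.const 0) (.var 51)) (fun m s => s.nv 51 ≤ m)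
      (fun _ s s' => Copied 0 50 0 0 (s.nv 51) s s') :=
    lin_copy 0 50 (by norm_num) (by norm_num) (by norm_num) (NExp.stable_const 0)
      (NExp.stable_var (by norm_num))
  have h3 : Lin (.putNat 50 (.const 0) (.const 1)) (fun _ _ => True)
      (fun _ s s' => s'.na 50 = Function.update (s.na 50) 0 1) :=
    Lin.of_run rfl fun m s _ => by simp [Prog.run, State.putNat, NExp.val]
  refine (Lin.seq h1 (Lin.seq h2 h3 fun _ _ _ _ _ _ => trivial) ?_).mono (fun _ _ h => h) ?_
  · rintro m s s' h - ⟨-, h'⟩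
    exact h'.le.trans h
  · rintro m s s₃ - - ⟨s₁, f₁, ⟨k1, k2⟩, -, s₂, f₂, hc, f₃, k3⟩
    refine ⟨?_, ?_, ?_, fun i hi => ?_⟩
    · rw [f₃.nv 50 (by decide), f₂.nv 50 (by decide), k1]
    · rw [f₃.nv 51 (by decide), f₂.nv 51 (by decide), k2]
    · rw [k3, f₂.na 50 (by decide), f₁.na 50 (by decide)]
    · have := congrArg Prod.fst (hc.new i (by omega))
      simp only [ivl, zero_add] at this
      rw [f₃.ra 50 (by decide), this, f₁.ra 0 (by decide)]

/-- Enter the error range set of a single vertex into the table. -/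
def tableStep : Prog :=
  .seq (.putNat 53 (.var 53) (.var 57)) <|
  .seq (.putReal 52 (.var 57) (.ofNat (.const 0))) <|
  .seq (.putReal 53 (.var 57) (.ofNat (.const 0))) <|
  .seq (.cond (.realLt (.ofNat (.const 0)) (.var 0)) (.putNat 54 (.var 53) (.const 1))
    (.putNat 54 (.var 53) (.const 0))) <|
  .seq (.setNat 57 (.add (.var 57) (.add (.var 50) (.var 50)))) <|
  .setNat 53 (.add (.var 53) (.const 1))

/-- Initialise the table. -/
def table : Prog :=
  .seq (.seq (.setNat 53 (.const 0)) (.setNat 57 (.const 0))) <|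
  .loop (.natLt (.var 53) (.var 50)) tableStep

/-- The entry `v` of the initial table. -/
def TableEntry (s : State) (N v : ℕ) : Prop :=
  s.na 53 v = v * (2 * N) ∧ ivl s 52 (v * (2 * N)) = (0, 0) ∧
    s.na 54 v = open Classical in if 0 < s.rv 0 then 1 else 0

/-- Vertex `v` owns a slot of `2 * n` positions starting at `v * (2 * n)`; the offsets are obtained
by repeated addition, as the machine cannot multiply. A single vertex has the range `[0, 0]` if `ε >
0` and no range otherwise. -/
theorem lin_table : Lin table (fun m s => s.nv 50 ≤ m)
    (fun _ s s' => ∀ v < s.nv 50, TableEntry s' (s.nv 50) v) := by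
  have h1 : Lin (.seq (.setNat 53 (.const 0)) (.setNat 57 (.const 0))) (fun m s => s.nv 50 ≤ m)
      (fun _ _ s' => s'.nv 53 = 0 ∧ s'.nv 57 = 0) :=
    Lin.of_run rfl fun m s _ => by simp [Prog.run, State.setNat, NExp.val]
  have h2 : Lin (.loop (.natLt (.var 53) (.var 50)) tableStep)
      (fun m s => s.nv 50 ≤ m ∧ s.nv 53 = 0 ∧ s.nv 57 = 0)
      (fun _ s s' => ∀ v < s.nv 50, TableEntry s' (s.nv 50) v) := by
    refine Lin.loop rfl 1 (fun _ s₀ k s => s.nv 53 + k = s₀.nv 50 ∧ s.nv 50 = s₀.nv 50 ∧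
      s.nv 57 = s.nv 53 * (2 * s₀.nv 50) ∧
      ∀ v < s.nv 53, TableEntry s (s₀.nv 50) v) ?_ ?_ ?_
    · rintro m s ⟨hm, h53, h57⟩
      exact ⟨s.nv 50, by omega, by omega, rfl, by rw [h57, h53, zero_mul], by omega⟩
    · rintro m s₀ k s - ⟨hk, h50, h57, hinv⟩ hb
      simp only [Test.Holds, NExp.val] at hb
      obtain ⟨a, hrun, ha⟩ : ∃ a, tableStep.run s = (((((s.putNat 53 (s.nv 53) (s.nv 57)).putReal 52
          (s.nv 57) 0).putReal 53 (s.nv 57) 0).putNat 54 (s.nv 53) a).setNat 57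
            (s.nv 57 + (s.nv 50 + s.nv 50))).setNat 53 (s.nv 53 + 1) ∧
          a = open Classical in if 0 < s.rv 0 then 1 else 0 := by
        by_cases hc : 0 < s.rv 0
        · refine ⟨1, ?_, (if_pos hc).symm⟩
          simp [tableStep, Prog.run, Test.Holds, NExp.val, RExp.val, State.setNat, State.putNat,
            State.putReal, hc]
        · refine ⟨0, ?_, (if_neg hc).symm⟩
          simp [tableStep, Prog.run, Test.Holds, NExp.val, RExp.val, State.setNat, State.putNat,
            State.putReal, hc]
      refine ⟨k - 1, by omega, ?_⟩
      rw [hrun]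
      refine ⟨by simp [State.setNat]; omega, by simpa [State.setNat, State.putNat, State.putReal] using h50, ?_, ?_⟩
      · simp [State.setNat, State.putNat, State.putReal, h57, h50]
        ring
      · intro v hv
        simp only [TableEntry, ivl, State.setNat, State.putNat, State.putReal,
          Function.update_self, ne_eq, Nat.reduceEqDiff, not_false_eq_true,
          Function.update_of_ne, Nat.reduceAdd] at hv ⊢
        rcases Nat.lt_succ_iff_lt_or_eq.1 hv with hv | rfl
        · obtain ⟨h1, h2, h3⟩ := hinv v hv
          simp only [ivl, Prod.mk.injEq, Nat.reduceAdd] at h2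
          rw [Function.update_of_ne hv.ne, Function.update_of_ne hv.ne, Function.update_apply,
            Function.update_apply, h2.1, h2.2]
          exact ⟨h1, by simp, h3⟩
        · rw [Function.update_self, Function.update_self, ← h57, Function.update_self,
            Function.update_self]
          exact ⟨rfl, rfl, ha⟩
    · rintro m s₀ k s - ⟨hk, h50, h57, hinv⟩ hb
      simp only [Test.Holds, NExp.val] at hb
      intro v hv
      exact hinv v (by omega)
  refine (Lin.seq h1 h2 ?_).mono (fun _ _ h => h) ?_
  · rintro m s s' h hf h'
    exact ⟨(hf.nv 50 (by decide)).le.trans h, h'⟩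
  · rintro m s s₂ - - ⟨s₁, f₁, -, -, h⟩
    rwa [f₁.nv 50 (by decide)] at h

/-- The state during the absorbing phase: the remaining vertices are the roots of disjoint subtrees
that cover the tree, and their lists of intervals are in the table. -/
structure AbsorbInv {n : ℕ} (T : SimpleGraph (Fin n)) (w : Sym2 (Fin n) → ℝ≥0) (ε : ℝ)
    (D : Fin n → Set (Fin n)) (s : State) : Prop where
  eps : s.rv 0 = ε
  grown : Grown T w (s.na 51) (s.na 52) (s.ra 54) (s.nv 52)
  offset : ∀ v : Fin n, s.na 53 v = v * (2 * n)
  mem : ∀ v ∈ reached n (s.na 51) (s.nv 52), v ∈ D v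
  closed : ∀ v ∈ reached n (s.na 51) (s.nv 52), PathClosed T (D v)
  asc : ∀ v ∈ reached n (s.na 51) (s.nv 52), AscAt s 52 (v * (2 * n)) (s.na 54 v)
  eq : ∀ v ∈ reached n (s.na 51) (s.nv 52),
    ivsAt s 52 (v * (2 * n)) (s.na 54 v) = minimals (ranges T w ε (D v) v)
  disj : ∀ v ∈ reached n (s.na 51) (s.nv 52), ∀ v' ∈ reached n (s.na 51) (s.nv 52), v ≠ v' →
    Disjoint (D v) (D v')
  cover : ∀ x, ∃ v ∈ reached n (s.na 51) (s.nv 52), x ∈ D v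

/-- By the cardinality bound, the list of a subtree always fits into its slot. -/
theorem AbsorbInv.length_le {n : ℕ} {T : SimpleGraph (Fin n)} (hT : T.IsTree)
    {w : Sym2 (Fin n) → ℝ≥0} {ε : ℝ} {D : Fin n → Set (Fin n)} {s : State}
    (h : AbsorbInv T w ε D s) {v : Fin n} (hv : v ∈ reached n (s.na 51) (s.nv 52)) :
    s.na 54 v ≤ 2 * n := by
  rw [← (h.asc v hv).ncard_eq, h.eq v hv]
  refine (ncard_minimals_ranges_le hT w ε (h.mem v hv)).trans ?_
  exact Nat.mul_le_mul_left 2 ((Set.ncard_le_card _).trans (by simp))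

/-- The last listed vertex `x` has a parent `y` that was reached earlier and thus still remains. The
subtree of `x`, extended by the edge to `y`, is merged at `y` with the subtree of `y`; the two share
only `y` by disjointness. -/
theorem exists_runs_absorbStep : ∃ C, ∀ (n : ℕ) (T : SimpleGraph (Fin n)), T.IsTree →
    ∀ (w : Sym2 (Fin n) → ℝ≥0) (ε : ℝ) (D : Fin n → Set (Fin n)) (s : State),
    AbsorbInv T w ε D s → 0 < s.nv 52 →
    ∃ t s', Runs absorbStep s t s' ∧ t ≤ C * (2 * n + 1) ∧ s'.nv 52 + 1 = s.nv 52 ∧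
      ∃ D', AbsorbInv T w ε D' s' := by
  obtain ⟨C, hC⟩ := lin_absorbStep
  refine ⟨C, fun n T hT w ε D s h hpos => ?_⟩
  obtain ⟨k, hk⟩ : ∃ k, s.nv 52 = k + 1 := ⟨s.nv 52 - 1, by omega⟩
  obtain ⟨x, y, hx, hy, hwt, hadj, hxn, hyr⟩ := h.grown k (by omega)
  have hreach : reached n (s.na 51) (s.nv 52) = insert x (reached n (s.na 51) k) := by
    rw [hk, reached_succ hx]
  have hxr : x ∈ reached n (s.na 51) (s.nv 52) := hreach ▸ Or.inl rfl
  have hyr' : y ∈ reached n (s.na 51) (s.nv 52) := hreach ▸ Or.inr hyr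
  have hsub : ∀ v ∈ reached n (s.na 51) k, v ∈ reached n (s.na 51) (s.nv 52) :=
    fun v hv => hreach ▸ Or.inr hv
  have hxy : x ≠ y := fun e => hxn (e ▸ hyr)
  obtain ⟨t, s', hrun, ht, h52, hasc, hlen, hframe, hset⟩ := hC (2 * n) s (by
    beta_reduce
    rw [hk, Nat.add_sub_cancel, hx, hy, h.offset, h.offset]
    exact ⟨h.asc x hxr, h.length_le hT hxr, h.asc y hyr', h.length_le hT hyr'⟩)
  rw [hk, Nat.add_sub_cancel] at h52 hasc hlen hframe hset
  rw [hx, hy, h.offset, h.offset, h.eps] at hset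
  rw [hy, h.offset] at hasc hframe
  rw [hy] at hlen
  have hf := hrun.sameOutside
  have e51 := hf.na 51 (by decide)
  have e53 := hf.na 53 (by decide)
  have hyx : y ∉ D x := Set.disjoint_left.1 (h.disj y hyr' x hxr hxy.symm) (h.mem y hyr')
  have hE : PathClosed T (insert y (D x)) :=
    (h.closed x hxr).insert hT hyx (h.mem x hxr) hadj.symm
  have hEy : insert y (D x) ∩ D y = {y} := by
    ext v
    constructor
    · rintro ⟨rfl | hv, hv'⟩
      · rfl
      · exact absurd hv' (Set.disjoint_left.1 (h.disj x hxr y hyr' hxy) hv)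
    · rintro rfl
      exact ⟨Or.inl rfl, h.mem _ hyr'⟩
  have hshift := ranges_insert_eq_shiftSet hT (Set.toFinite _) (h.closed x hxr) hyx (h.mem x hxr)
    hadj.symm w ε
  have hunion := ranges_union hT (Set.toFinite _) (Set.toFinite _) hE (h.closed y hyr') hEy w ε
  have hw : s.ra 54 k = w s(y, x) := by rw [hwt, Sym2.eq_swap]
  have hnew : ivsAt s' 52 (y * (2 * n)) (s'.na 54 y) =
      minimals (ranges T w ε (insert y (D x) ∪ D y) y) := by
    have h1 := admissible_ranges hT w ε (h.mem x hxr)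
    have h2 := admissible_ranges hT w ε (Set.mem_insert y (D x))
    rw [hshift, ← hw] at h2
    rw [hunion, hshift, ← hw]
    exact hset _ _ (by rw [hw]; exact NNReal.coe_nonneg _) h1 h2
      (admissible_ranges hT w ε (h.mem y hyr')).finite (h.eq x hxr) (h.eq y hyr')
  -- Writing affects just the positions of the new list of `y`. As this list fits into the slot of
  -- `y`, the slots of the other vertices are intact.
  have hlen_y : s'.na 54 y ≤ 2 * n := by
    rw [← hasc.ncard_eq, hnew]
    refine (ncard_minimals_ranges_le hT w ε (Or.inr (h.mem y hyr'))).trans ?_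
    exact Nat.mul_le_mul_left 2 ((Set.ncard_le_card _).trans (by simp))
  have hold : ∀ v ∈ reached n (s.na 51) k, v ≠ y → s'.na 54 v = s.na 54 v ∧
      ∀ i < s.na 54 v, ivl s' 52 (v * (2 * n) + i) = ivl s 52 (v * (2 * n) + i) := by
    intro v hv hvy
    refine ⟨hlen v fun e => hvy (Fin.ext e), fun i hi => hframe _ ?_⟩
    have hi' := h.length_le hT (hsub v hv)
    rcases Nat.lt_or_gt_of_ne (fun e => hvy (Fin.ext e)) with hlt | hlt
    · left
      have := Nat.mul_le_mul_right (2 * n) (Nat.succ_le_of_lt hlt)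
      rw [Nat.succ_mul] at this
      omega
    · right
      have := Nat.mul_le_mul_right (2 * n) (Nat.succ_le_of_lt hlt)
      rw [Nat.succ_mul] at this
      omega
  refine ⟨t, s', hrun, ht, by omega, Function.update D y (insert y (D x) ∪ D y), ?_⟩
  have hdisj : ∀ v ∈ reached n (s.na 51) k, v ≠ y → Disjoint (insert y (D x) ∪ D y) (D v) := by
    intro v hv hvy
    have hvx : x ≠ v := fun e => hxn (e ▸ hv)
    have h1 := h.disj x hxr v (hsub v hv) hvx
    have h2 := h.disj y hyr' v (hsub v hv) hvy.symm
    rw [Set.insert_union, Set.disjoint_insert_left, Set.disjoint_union_left]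
    exact ⟨Set.disjoint_left.1 h2 (h.mem y hyr'), h1, h2⟩
  constructor
  case eps => rw [hf.rv 0 (by decide), h.eps]
  case grown =>
    rw [e51, hf.na 52 (by decide), hf.ra 54 (by decide), h52]
    exact fun j hj => h.grown j (by omega)
  case offset => rw [e53]; exact h.offset
  all_goals rw [e51, h52]
  case mem =>
    intro v hv
    rw [Function.update_apply]
    split_ifs with e
    · exact e ▸ Or.inl (Or.inl rfl)
    · exact h.mem v (hsub v hv)
  case closed =>
    intro v hv
    rw [Function.update_apply]
    split_ifs with e
    · exact hE.union hT (h.closed y hyr') hEy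
    · exact h.closed v (hsub v hv)
  case asc =>
    intro v hv
    by_cases e : v = y
    · subst e; exact hasc
    · obtain ⟨h1, h2⟩ := hold v hv e
      rw [h1]
      exact (h.asc v (hsub v hv)).congr h2
  case eq =>
    intro v hv
    by_cases e : v = y
    · subst e; rw [Function.update_self]; exact hnew
    · obtain ⟨h1, h2⟩ := hold v hv e
      rw [h1, Function.update_of_ne e, ivsAt_congr h2]
      exact h.eq v (hsub v hv)
  case disj =>
    intro v hv v' hv' hne
    rw [Function.update_apply, Function.update_apply]
    split_ifs with e e' e'
    · exact absurd (e.trans e'.symm) hne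
    · exact hdisj v' hv' e'
    · exact (hdisj v hv e).symm
    · exact h.disj v (hsub v hv) v' (hsub v' hv') hne
  case cover =>
    intro z
    obtain ⟨v, hv, hz⟩ := h.cover z
    rw [hreach] at hv
    by_cases e : v = y
    · subst e
      exact ⟨v, hyr, by rw [Function.update_self]; exact Or.inr hz⟩
    rcases hv with rfl | hv
    · exact ⟨y, hyr, by rw [Function.update_self]; exact Or.inl (Or.inr hz)⟩
    · exact ⟨v, hv, by rwa [Function.update_of_ne e]⟩

/-- Absorb all vertices into the vertex `0`. -/
def absorb : Prog := .loop (.natLt (.const 0) (.var 52)) absorbStep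

theorem exists_runs_absorb : ∃ C, ∀ (n : ℕ) (T : SimpleGraph (Fin n)), T.IsTree →
    ∀ (w : Sym2 (Fin n) → ℝ≥0) (ε : ℝ) (D : Fin n → Set (Fin n)) (s : State),
    AbsorbInv T w ε D s → s.nv 52 + 1 = n →
    ∃ t s', Runs absorb s t s' ∧ t ≤ C * n ^ 2 ∧ s'.nv 52 = 0 ∧ ∃ D', AbsorbInv T w ε D' s' := by
  obtain ⟨C, hC⟩ := exists_runs_absorbStep
  let b : Test := .natLt (.const 0) (.var 52)
  refine ⟨3 * C + 2 * (b.cost + 1), fun n T hT w ε D s h hn => ?_⟩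
  obtain ⟨t, s', hrun, ht, ⟨k', -, hinv⟩, hnb⟩ := exists_runs_loop (b := b) (P := absorbStep)
    (fun k s' => s'.nv 52 = k ∧ ∃ D', AbsorbInv T w ε D' s') (C * (2 * n + 1)) (by
      rintro k s₁ ⟨hk, D', h'⟩ hb
      simp only [b, Test.Holds, NExp.val] at hb
      obtain ⟨t, s₂, hrun, ht, hk', h''⟩ := hC n T hT w ε D' s₁ h' hb
      exact ⟨t, s₂, hrun, ht, k - 1, by omega, by omega, h''⟩) (s.nv 52) s ⟨rfl, D, h⟩
  simp only [b, Test.Holds, NExp.val] at hnb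
  refine ⟨t, s', hrun, ht.trans ?_, by omega, hinv⟩
  have h1 : (C * (2 * n + 1) + b.cost + 1) * s.nv 52 ≤ (C * (2 * n + 1) + b.cost + 1) * n :=
    Nat.mul_le_mul_left _ (by omega)
  have h2 : 1 ≤ n := by omega
  have h3 : n ≤ n ^ 2 := by nlinarith
  nlinarith [Nat.mul_le_mul_left C h3, Nat.mul_le_mul_left (b.cost + 1) h3,
    Nat.mul_le_mul_left (b.cost + 1) (h2.trans h3)]

end RealRAM

namespace RealRAM

open Rounding

/-- Output `1` if the list of the vertex `0` is nonempty, and `0` otherwise. -/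
def answer : Prog :=
  .cond (.natLt (.const 0) (.get 54 (.const 0))) (.setNat 0 (.const 1)) (.setNat 0 (.const 0))

theorem exists_runs_answer : ∃ C, ∀ s : State, ∃ t s', Runs answer s t s' ∧ t ≤ C ∧
    (0 < s.na 54 0 → s'.nv 0 = 1) ∧ (¬ 0 < s.na 54 0 → s'.nv 0 = 0) := by
  refine ⟨answer.maxCost, fun s => ?_⟩
  obtain ⟨t, hrun, ht⟩ := exists_runs_run answer rfl s
  refine ⟨t, _, hrun, ht, fun h => ?_, fun h => ?_⟩
  · simp [answer, Prog.run, Test.Holds, State.setNat, NExp.val, h]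
  · simp [answer, Prog.run, Test.Holds, State.setNat, NExp.val, h]

/-- A rounding has a root error range, which contains a minimal one because there are only finitely
many. The decision is therefore a test for an empty list. -/
theorem exists_isPathOblivious_iff {V : Type u} [Finite V] {T : SimpleGraph V} (hT : T.IsTree)
    (w : Sym2 V → ℝ≥0) (ε : ℝ) (r : V) :
    (∃ w', IsPathOblivious T w ε w') ↔ (minimals (ranges T w ε Set.univ r)).Nonempty := by
  constructor
  · rintro ⟨w', h⟩
    rw [isPathOblivious_iff hT] at h
    obtain ⟨I, hI⟩ := exists_isLeast_isGreatest Set.finite_univ ⟨r, trivial⟩ (treeErr T w w' r)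
    obtain ⟨J, hJ, -⟩ := dominates_minimals
      (admissible_ranges hT w ε (Set.mem_univ r)).finite I ⟨w', h, hI⟩
    exact ⟨J, hJ⟩
  · rintro ⟨I, ⟨w', h, -⟩, -⟩
    exact ⟨w', (isPathOblivious_iff hT w ε w').2 h⟩

section Input

variable {n : ℕ} {T : SimpleGraph (Fin n)} {es : List (Fin n × Fin n)}

theorem IsEdgeListOf.length_le (hT : T.IsTree) (h : IsEdgeListOf es T) : es.length ≤ n := by
  classical
  have h1 : (es.map fun e => s(e.1, e.2)).toFinset = T.edgeFinset := by
    ext e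
    induction e with
    | _ a b => simpa using h.2 a b
  have h2 := List.toFinset_card_of_nodup h.1
  have h3 := hT.card_edgeFinset
  rw [h1, List.length_map] at h2
  rw [Fintype.card_fin] at h3
  omega

variable (w : Sym2 (Fin n) → ℝ≥0) (ε : ℝ)

theorem edgesIn_of_graphInput (h : IsEdgeListOf es T) {s : State} (h51 : s.nv 51 = es.length)
    (h0 : s.na 0 = (graphInput es w ε).na 0) (h1 : s.na 1 = (graphInput es w ε).na 1)
    (h50 : ∀ i < es.length, s.ra 50 i = (graphInput es w ε).ra 0 i) : EdgesIn T w s := by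
  have key : ∀ (i : ℕ) (hi : i < es.length), s.na 0 i = es[i].1 ∧ s.na 1 i = es[i].2 := by
    intro i hi
    simp [h0, h1, graphInput, hi]
  constructor
  · intro i hi
    rw [h51] at hi
    refine ⟨es[i].1, es[i].2, (key i hi).1, (key i hi).2, ?_, ?_⟩
    · exact (h.2 _ _).1 (List.mem_map.2 ⟨es[i], List.getElem_mem hi, rfl⟩)
    · rw [h50 i hi]
      simp [graphInput, hi]
  · intro a b hab
    obtain ⟨e, he, hee⟩ := List.mem_map.1 ((h.2 a b).2 hab)
    obtain ⟨i, hi, rfl⟩ := List.getElem_of_mem he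
    refine ⟨i, h51 ▸ hi, ?_⟩
    rw [(key i hi).1, (key i hi).2]
    rcases Sym2.eq_iff.1 hee with ⟨ha, hb⟩ | ⟨ha, hb⟩
    · exact Or.inl ⟨by rw [ha], by rw [hb]⟩
    · exact Or.inr ⟨by rw [ha], by rw [hb]⟩

end Input

/-- Initially each subtree is a single vertex. After `n - 1` vertices have been listed every vertex
is reached, by counting, so these subtrees cover the tree. -/
theorem absorbInv_of_table {n : ℕ} {T : SimpleGraph (Fin n)} (hT : T.IsTree)
    {w : Sym2 (Fin n) → ℝ≥0} {s : State} (hn : s.nv 52 + 1 = n)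
    (hg : Grown T w (s.na 51) (s.na 52) (s.ra 54) (s.nv 52)) (h : ∀ v < n, TableEntry s n v) :
    AbsorbInv T w (s.rv 0) (fun v => {v}) s := by
  have huniv : ∀ v, v ∈ reached n (s.na 51) (s.nv 52) := by
    have h1 : reached n (s.na 51) (s.nv 52) = Set.univ := by
      refine Set.eq_of_subset_of_ncard_le (Set.subset_univ _) ?_ (Set.toFinite _)
      rw [Set.ncard_univ, Nat.card_fin, hg.ncard_reached (by omega), hn]
    exact fun v => h1 ▸ trivial
  refine ⟨rfl, hg, fun v => (h v v.2).1, fun v _ => rfl, fun v _ => PathClosed.singleton T v,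
    fun v _ i j hij hj => ?_, fun v _ => ?_, fun v _ v' _ hne => by simpa using hne,
    fun x => ⟨x, huniv x, rfl⟩⟩
  · have h3 := (h v v.2).2.2
    split_ifs at h3 <;> omega
  · obtain ⟨-, h2, h3⟩ := h v v.2
    rw [ranges_singleton hT, h3]
    split_ifs with hε
    · ext I
      constructor
      · rintro ⟨i, hi, rfl⟩
        obtain rfl : i = 0 := by omega
        rw [add_zero, h2]
        exact ⟨⟨hε, rfl⟩, fun J hJ _ => hJ.2⟩
      · rintro ⟨⟨-, rfl⟩, -⟩
        exact ⟨0, one_pos, by rw [add_zero, h2]⟩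
    · ext I
      constructor
      · rintro ⟨i, hi, -⟩
        omega
      · rintro ⟨⟨hε', -⟩, -⟩
        exact absurd hε' hε

/-- Decide the existence of a rounding of a tree. -/
def decideRounding : Prog := .seq setup <| .seq grow <| .seq table <| .seq absorb answer

theorem exists_decision_algorithm : ∃ (P : Prog) (C : ℕ),
    ∀ (n : ℕ) (T : SimpleGraph (Fin n)), T.IsTree →
    ∀ (w : Sym2 (Fin n) → ℝ≥0) (ε : ℝ) (es : List (Fin n × Fin n)), IsEdgeListOf es T →
      ∃ (t : ℕ) (s : State), Runs P (graphInput es w ε) t s ∧ t ≤ C * n ^ 2 ∧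
        ((∃ w', IsPathOblivious T w ε w') → s.nv 0 = 1) ∧
        ((¬ ∃ w', IsPathOblivious T w ε w') → s.nv 0 = 0) := by
  obtain ⟨C₁, h₁⟩ := lin_setup
  obtain ⟨C₂, h₂⟩ := exists_runs_grow
  obtain ⟨C₃, h₃⟩ := lin_table
  obtain ⟨C₄, h₄⟩ := exists_runs_absorb
  obtain ⟨C₅, h₅⟩ := exists_runs_answer
  refine ⟨decideRounding, 2 * C₁ + C₂ + 2 * C₃ + C₄ + C₅, fun n T hT w ε es hes => ?_⟩
  have hlen := hes.length_le hT
  obtain ⟨⟨r, hr⟩⟩ := hT.connected.nonempty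
  have hn : 0 < n := by omega
  obtain ⟨t₁, s₁, r₁, ht₁, k50, k51, kvis, kwt⟩ := h₁ n (graphInput es w ε) hlen
  have f₁ := r₁.sameOutside
  have e50 : s₁.nv 50 = n := k50
  have e51 : s₁.nv 51 = es.length := k51
  have e52 : s₁.nv 52 = 0 := f₁.nv 52 (by decide)
  have evis : s₁.na 50 = Function.update (fun _ => 0) 0 1 := by
    rw [kvis]
    congr 1
    funext i
    simp [graphInput]
  have hedges : EdgesIn T w s₁ := edgesIn_of_graphInput w ε hes e51 (f₁.na 0 (by decide))
    (f₁.na 1 (by decide)) kwt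
  have hgrow : GrowInv T w s₁ s₁ := by
    refine ⟨e50, rfl, rfl, rfl, rfl, rfl, by omega, ?_, ?_, ?_⟩
    · rw [e52]
      exact fun j hj => absurd hj (Nat.not_lt_zero j)
    · rw [e52, evis]
      rintro v (hv | ⟨j, hj, -⟩)
      · rw [hv, Function.update_self]
      · exact absurd hj (Nat.not_lt_zero j)
    · rw [evis]
      intro v hv
      exact Function.update_of_ne (fun h => hv (Or.inl h)) _ _
  obtain ⟨t₂, s₂, r₂, ht₂, hinv, hfull⟩ := h₂ n T hT w s₁ hedges (e51.le.trans hlen) hgrow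
  obtain ⟨t₃, s₃, r₃, ht₃, htab⟩ := h₃ n s₂ hinv.size.le
  rw [hinv.size] at htab
  have f₃ := r₃.sameOutside
  have eε : s₃.rv 0 = ε := by
    rw [f₃.rv 0 (by decide), hinv.ε, f₁.rv 0 (by decide)]
    rfl
  have e52' : s₃.nv 52 = s₂.nv 52 := f₃.nv 52 (by decide)
  have habs := absorbInv_of_table hT (w := w) (s := s₃) (e52' ▸ hfull) (by
    rw [e52', f₃.na 51 (by decide), f₃.na 52 (by decide), f₃.ra 54 (by decide)]
    exact hinv.grown) htab
  rw [eε] at habs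
  obtain ⟨t₄, s₄, r₄, ht₄, hzero, D, hD⟩ := h₄ n T hT w ε _ s₃ habs (e52' ▸ hfull)
  obtain ⟨t₅, s₅, r₅, ht₅, hyes, hno⟩ := h₅ s₄
  have hroot : (⟨0, hn⟩ : Fin n) ∈ reached n (s₄.na 51) (s₄.nv 52) := Or.inl rfl
  -- Only vertex `0` remains, so the covering property gives it the whole tree.
  have huniv : D ⟨0, hn⟩ = Set.univ := by
    refine Set.eq_univ_of_forall fun x => ?_
    obtain ⟨v, hv, hx⟩ := hD.cover x
    rw [hzero] at hv
    rcases hv with hv | ⟨j, hj, -⟩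
    · rwa [show v = ⟨0, hn⟩ from Fin.ext hv] at hx
    · exact absurd hj (Nat.not_lt_zero j)
  have hanswer : 0 < s₄.na 54 0 ↔ ∃ w', IsPathOblivious T w ε w' := by
    rw [exists_isPathOblivious_iff hT w ε ⟨0, hn⟩, ← huniv, ← hD.eq _ hroot]
    constructor
    · exact fun h => ⟨_, 0, h, rfl⟩
    · rintro ⟨-, i, hi, -⟩
      exact Nat.zero_lt_of_lt hi
  refine ⟨_, s₅, .seq r₁ (.seq r₂ (.seq r₃ (.seq r₄ r₅))), ?_, fun h => hyes (hanswer.2 h),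
    fun h => hno (hanswer.not.2 h)⟩
  have h1 : n + 1 ≤ 2 * n ^ 2 := by nlinarith
  have h2 : 1 ≤ n ^ 2 := Nat.one_le_pow _ _ hn
  nlinarith [Nat.mul_le_mul_left C₁ h1, Nat.mul_le_mul_left C₃ h1, Nat.mul_le_mul_left C₅ h2]

end RealRAM

theorem mainTheorem2 :
    -- on a tree, the three notions of rounding coincide
    (∀ (V : Type u) (T : SimpleGraph V), T.IsTree →
      ∀ (w : Sym2 V → ℝ≥0) (ε : ℝ) (w' : Sym2 V → ℕ),
        (Rounding.IsPathOblivious T w ε w' ↔ Rounding.IsWeak T w ε w') ∧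
        (Rounding.IsWeak T w ε w' ↔ Rounding.IsStrong T w ε w')) ∧
    -- existence of a rounding of a tree is decided in quadratic time
    (∃ (P : RealRAM.Prog) (C : ℕ),
      ∀ (n : ℕ) (T : SimpleGraph (Fin n)), T.IsTree →
      ∀ (w : Sym2 (Fin n) → ℝ≥0) (ε : ℝ) (es : List (Fin n × Fin n)),
        RealRAM.IsEdgeListOf es T →
        ∃ (t : ℕ) (s : RealRAM.State), RealRAM.Runs P (RealRAM.graphInput es w ε) t s ∧
          t ≤ C * n ^ 2 ∧
          ((∃ w' : Sym2 (Fin n) → ℕ, Rounding.IsPathOblivious T w ε w') → s.nv 0 = 1) ∧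
          ((¬ ∃ w' : Sym2 (Fin n) → ℕ, Rounding.IsPathOblivious T w ε w') → s.nv 0 = 0)) ∧
    -- the error range set of a rooted tree has at most twice as many elements as the tree
    (∀ (V : Type u) [Finite V] (T : SimpleGraph V), T.IsTree →
      ∀ (w : Sym2 V → ℝ≥0) (ε : ℝ) (r : V),
        (Rounding.errorRangeSet T w ε r).Finite ∧
        (Rounding.errorRangeSet T w ε r).ncard ≤ 2 * Nat.card V) ∧
    -- adding the edge from the root `u` to its parent `p`, in linear time
    (∃ (P : RealRAM.Prog) (C : ℕ),
      ∀ (V : Type u) [Finite V] (T' : SimpleGraph V), T'.IsTree →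
      ∀ (w : Sym2 V → ℝ≥0) (ε : ℝ) (p u : V) (hu : u ∈ ({p}ᶜ : Set V)),
        (∀ v, T'.Adj p v ↔ v = u) →
        ∀ L : List (ℝ × ℝ),
          Rounding.IsAscendingListOf L
            (Rounding.errorRangeSet (T'.induce {p}ᶜ) (Rounding.restrictWeight w {p}ᶜ) ε ⟨u, hu⟩) →
          ∃ (t : ℕ) (s : RealRAM.State) (L' : List (ℝ × ℝ)),
            RealRAM.Runs P (RealRAM.intervalInput L [] ε (w s(p, u))) t s ∧
            t ≤ C * ({p}ᶜ : Set V).ncard ∧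
            RealRAM.OutputsIntervals s L' ∧
            Rounding.IsAscendingListOf L' (Rounding.errorRangeSet T' w ε p)) ∧
    -- merging two trees that share exactly their root `r`, in linear time
    (∃ (P : RealRAM.Prog) (C : ℕ),
      ∀ (V : Type u) [Finite V] (T : SimpleGraph V), T.IsTree →
      ∀ (w : Sym2 V → ℝ≥0) (ε : ℝ) (r : V) (A B : Set V) (hA : r ∈ A) (hB : r ∈ B),
        A ∪ B = Set.univ → A ∩ B = {r} → (T.induce A).IsTree → (T.induce B).IsTree →
        ∀ L₁ L₂ : List (ℝ × ℝ),
          Rounding.IsAscendingListOf L₁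
            (Rounding.errorRangeSet (T.induce A) (Rounding.restrictWeight w A) ε ⟨r, hA⟩) →
          Rounding.IsAscendingListOf L₂
            (Rounding.errorRangeSet (T.induce B) (Rounding.restrictWeight w B) ε ⟨r, hB⟩) →
          ∃ (t : ℕ) (s : RealRAM.State) (L : List (ℝ × ℝ)),
            RealRAM.Runs P (RealRAM.intervalInput L₁ L₂ ε 0) t s ∧
            t ≤ C * (A.ncard + B.ncard) ∧
            RealRAM.OutputsIntervals s L ∧
            Rounding.IsAscendingListOf L (Rounding.errorRangeSet T w ε r)) := by
  refine ⟨fun V T hT w ε w' => ⟨Rounding.isPathOblivious_iff_isWeak hT.isAcyclic w ε w',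
    Rounding.isWeak_iff_isStrong hT.isAcyclic w ε w'⟩, RealRAM.exists_decision_algorithm,
    fun V _ T hT w ε r => ?_, RealRAM.exists_shift_algorithm, RealRAM.exists_hull_algorithm⟩
  rw [Rounding.errorRangeSet_eq_minimals hT, ← Set.ncard_univ]
  exact ⟨(Rounding.admissible_ranges hT w ε (Set.mem_univ r)).finite.subset
    (Rounding.minimals_subset _), Rounding.ncard_minimals_ranges_le hT w ε (Set.mem_univ r)⟩
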